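/- Let $d\in\mathbb N$, let $\mathbb T^d=\mathbb R^d/\mathbb Z^d$, $T>0$, $\alpha>0$ and $0<\mu<1$. Let $H:\mathbb T^d\times\mathbb R^d\to\mathbb R$, $g:[0,\infty)\to\mathbb R$, $u_T,m_0:\mathbb T^d\to\mathbb R$ satisfy: A1. $H$ is $C^\infty$, $p\mapsto H(x,p)$ is strictly convex, $\lim_{|p|\to\infty}H(x,p)/|p|=+\infty$ for every $x$, and $H\ge 1$. A2. $g$ is non-negative and increasing; $u_T,m_0\in C^\infty(\mathbb T^d)$, $m_0\ge 0$, $\int_{\mathbb T^d}m_0=1$. A3. For some $c,C>0$, $D_pH(x,p)\cdot p-H(x,p)\ge cH(x,p)-C$ for all $x,p$. A4. $g(z)=z^\alpha$. A5. $|D_xH|,|D^2_{xx}H|\le CH+C$ for some $C$, and for every $\delta>0$ there is $C_\delta$ such that $\operatorname{tr}(D^2_{px}H\,M)\le\delta\operatorname{tr}(D^2_{pp}H\,M^2)+C_\delta H$ for all $x,p$ and all symmetric matrices $M$. A6. $m_0\ge\kappa_0$ for some $\kappa_0>0$. A7. $c_1|p|^{2+\mu}+C_1\le H(x,p)\le c_2|p|^{2+\mu}+C_2$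 for some constants $c_1,c_2,C_1,C_2\ge0$. A8. $|D_pH(x,p)|^2\le C|p|^\mu H(x,p)+C$ for some $C$. A9. For some $C$, $|D^2_{xp}H|^2\le CH^{\frac{2+2\mu}{2+\mu}}$, and $|D^2_{pp}H\,M|^2\le CH^{\frac{\mu}{2+\mu}}\operatorname{tr}(D^2_{pp}H\,M M)$ for all symmetric matrices $M$. Let $\eta\in C_c^\infty(\mathbb R^d)$ be non-negative and even with $\int\eta=1$, and put $\eta_\epsilon(y)=\epsilon^{-d}\eta(y/\epsilon)$, $g_\epsilon(m)=\eta_\epsilon*g(\eta_\epsilon*m)$ for $\epsilon>0$ (convolution in $x$) and $g_0(m)=g(m)$. Let $\theta>1$, $0\le\upsilon\le1$, $\beta_0\in\left[1,\frac{d(1+\mu)}{d(1+\mu)-2}\right)$ (this interval is empty for $d\le 1$), and $$\beta_{\upsilon,\theta}=\frac{\theta\beta_0}{\theta+\upsilon-\theta\upsilon},\qquad r=\frac{d(\theta-1)+2}{2},\qquad p=\frac{\beta_{\upsilon,\theta}}{\alpha},$$ and suppose $p>1$. Then there is a constant $C\geq 0$ such that, for every $\epsilon\ge0$ and every $C^\infty$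 solution $(u^\epsilon,m^\epsilon)$ on $\mathbb T^d\times[0,T]$ of $$-u^\epsilon_t+H(x,Du^\epsilon)=\Delta u^\epsilon+g_\epsilon(m^\epsilon),\qquad m^\epsilon_t-\operatorname{div}\bigl(D_pH(x,Du^\epsilon)\,m^\epsilon\bigr)=\Delta m^\epsilon,$$ $$u^\epsilon(x,T)=u_T(x),\qquad m^\epsilon(x,0)=m_0(x),$$ one has $$\|g_\epsilon(m^\epsilon)\|_{L^\infty(0,T;L^p(\mathbb T^d))}\le C+C\,\|Du^\epsilon\|_{L^\infty(0,T;L^\infty(\mathbb T^d))}^{\frac{(2+2\mu)r\upsilon\alpha}{\theta\beta_0}}.$$ The constant $C$ does not depend on $\epsilon$ or on the solution. -/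

import Mathlib

open Set Filter Topology MeasureTheory
open scoped NNReal ENNReal ContDiff

noncomputable section

namespace MFG

/-- The space `ℝ^d` with its Euclidean norm. -/
abbrev E (d : ℕ) : Type := EuclideanSpace ℝ (Fin d)

/-- `ℤ^d`-periodicity: functions on the torus `𝕋^d` are identified with the functions on `ℝ^d`
that are `1`-periodic in each coordinate. -/
def IsPeriodic {d : ℕ} {F : Type*} (f : E d → F) : Prop :=
  ∀ (x : E d) (i : Fin d), f (x + EuclideanSpace.single i 1) = f x

/-- The unit cube `[0,1)^d`, a fundamental domain of the torus `𝕋^d = ℝ^d / ℤ^d`. -/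
def unitCube (d : ℕ) : Set (E d) := {x | ∀ i, x i ∈ Ico (0 : ℝ) 1}

/-- Lebesgue measure of the torus, realised on the unit cube. -/
def torusMeasure (d : ℕ) : Measure (E d) := volume.restrict (unitCube d)

/-- Partial derivative `∂f/∂x_i`. -/
def pd {d : ℕ} (i : Fin d) (f : E d → ℝ) (x : E d) : ℝ :=
  fderiv ℝ f x (EuclideanSpace.single i 1)

/-- Divergence `∑ i, ∂F_i/∂x_i` of a vector field. -/
def divergence {d : ℕ} (F : E d → E d) (x : E d) : ℝ := ∑ i, pd i (fun y => F y i) x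

/-- Squared Euclidean (Frobenius) norm `|M|²` of a matrix. -/
def sqNorm {d : ℕ} (M : Matrix (Fin d) (Fin d) ℝ) : ℝ := ∑ i, ∑ j, M i j ^ 2

/-! ### The Hamiltonian and its derivatives -/

/-- `D_x H`. -/
def DxH {d : ℕ} (H : E d → E d → ℝ) (x p : E d) : E d := gradient (fun y => H y p) x

/-- `D_p H`. -/
def DpH {d : ℕ} (H : E d → E d → ℝ) (x p : E d) : E d := gradient (fun q => H x q) p

/-- `D²_xx H`. -/
def D2xxH {d : ℕ} (H : E d → E d → ℝ) (x p : E d) : Matrix (Fin d) (Fin d) ℝ :=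
  Matrix.of fun i j => pd i (fun y => pd j (fun z => H z p) y) x

/-- `D²_px H`, with entries `∂²H/∂p_i∂x_j`. -/
def D2pxH {d : ℕ} (H : E d → E d → ℝ) (x p : E d) : Matrix (Fin d) (Fin d) ℝ :=
  Matrix.of fun i j => pd i (fun q => pd j (fun y => H y q) x) p

/-- `D²_xp H`, with entries `∂²H/∂x_i∂p_j`. -/
def D2xpH {d : ℕ} (H : E d → E d → ℝ) (x p : E d) : Matrix (Fin d) (Fin d) ℝ :=
  Matrix.of fun i j => pd i (fun y => pd j (fun q => H y q) p) x

/-- `D²_pp H`. -/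
def D2ppH {d : ℕ} (H : E d → E d → ℝ) (x p : E d) : Matrix (Fin d) (Fin d) ℝ :=
  Matrix.of fun i j => pd i (fun q => pd j (fun q' => H x q') q) p

/-- `L̂(x,p) = D_p H(x,p) · p - H(x,p)`. -/
def Lhat {d : ℕ} (H : E d → E d → ℝ) (x p : E d) : ℝ := inner ℝ (DpH H x p) p - H x p

/-! ### Assumptions on the data -/

/-- `H : 𝕋^d × ℝ^d → ℝ` is smooth, strictly convex and superlinear in `p`, and `H ≥ 1`. -/
structure HamiltonianBasic {d : ℕ} (H : E d → E d → ℝ) : Prop where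
  periodic : ∀ p, IsPeriodic (fun x => H x p)
  smooth : ContDiff ℝ ∞ (fun z : E d × E d => H z.1 z.2)
  strictConvex : ∀ x, StrictConvexOn ℝ univ (H x)
  coercive : ∀ x, Tendsto (fun p => H x p / ‖p‖) (Bornology.cobounded (E d)) atTop
  one_le : ∀ x p, 1 ≤ H x p

/-- `g` is non-negative and increasing on `[0,∞)`; the terminal value `uT` and the initial density
`m0` are smooth functions on the torus, `m0 ≥ 0` and `∫ m0 = 1`. -/
structure DataBasic {d : ℕ} (g : ℝ → ℝ) (uT m0 : E d → ℝ) : Prop where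
  g_nonneg : ∀ z, 0 ≤ z → 0 ≤ g z
  g_mono : StrictMonoOn g (Ici 0)
  uT_periodic : IsPeriodic uT
  uT_smooth : ContDiff ℝ ∞ uT
  m0_periodic : IsPeriodic m0
  m0_smooth : ContDiff ℝ ∞ m0
  m0_nonneg : ∀ x, 0 ≤ m0 x
  m0_mass : ∫ x, m0 x ∂(torusMeasure d) = 1

/-- `L̂ ≥ c H - C` for some `c, C > 0`. -/
def LagrangianBound {d : ℕ} (H : E d → E d → ℝ) : Prop :=
  ∃ c > 0, ∃ C > 0, ∀ x p, c * H x p - C ≤ Lhat H x p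

/-- `g(z) = z^α` on `[0,∞)`, with `α > 0`. -/
structure PowerNonlinearity (g : ℝ → ℝ) (α : ℝ) : Prop where
  pos : 0 < α
  eq_rpow : ∀ z, 0 ≤ z → g z = z ^ α

/-- `|D_x H|, |D²_xx H| ≤ C H + C`, and for every `δ > 0` there is `C_δ` such that
`tr(D²_px H M) ≤ δ tr(D²_pp H M²) + C_δ H` for all symmetric `M`. -/
structure SpaceDerivativeBounds {d : ℕ} (H : E d → E d → ℝ) : Prop where
  dx : ∃ C : ℝ, ∀ x p, ‖DxH H x p‖ ≤ C * H x p + C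
  dxx : ∃ C : ℝ, ∀ x p, √(sqNorm (D2xxH H x p)) ≤ C * H x p + C
  dpx : ∀ δ : ℝ, 0 < δ → ∃ C : ℝ, ∀ x p, ∀ M : Matrix (Fin d) (Fin d) ℝ, M.IsSymm →
    (D2pxH H x p * M).trace ≤ δ * (D2ppH H x p * M ^ 2).trace + C * H x p

/-- `m0 ≥ κ₀` for some `κ₀ > 0`. -/
def InitialLowerBound {d : ℕ} (m0 : E d → ℝ) : Prop := ∃ κ₀ > 0, ∀ x, κ₀ ≤ m0 x

/-- `0 < μ < 1` and `c₁ |p|^{2+μ} + C₁ ≤ H ≤ c₂ |p|^{2+μ} + C₂` with non-negative constants. -/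
structure SuperquadraticGrowth {d : ℕ} (H : E d → E d → ℝ) (μ : ℝ) : Prop where
  pos : 0 < μ
  lt_one : μ < 1
  growth : ∃ c₁ ≥ 0, ∃ C₁ ≥ 0, ∃ c₂ ≥ 0, ∃ C₂ ≥ 0, ∀ x p,
    c₁ * ‖p‖ ^ (2 + μ) + C₁ ≤ H x p ∧ H x p ≤ c₂ * ‖p‖ ^ (2 + μ) + C₂

/-- `|D_p H|² ≤ C |p|^μ H + C`. -/
def DpBound {d : ℕ} (H : E d → E d → ℝ) (μ : ℝ) : Prop :=
  ∃ C : ℝ, ∀ x p, ‖DpH H x p‖ ^ 2 ≤ C * ‖p‖ ^ μ * H x p + C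

/-- `|D²_xp H|² ≤ C H^{(2+2μ)/(2+μ)}` and `|D²_pp H M|² ≤ C H^{μ/(2+μ)} tr(D²_pp H M M)` for all
symmetric `M`. -/
structure SecondDerivativeBounds {d : ℕ} (H : E d → E d → ℝ) (μ : ℝ) : Prop where
  dxp : ∃ C : ℝ, ∀ x p, sqNorm (D2xpH H x p) ≤ C * H x p ^ ((2 + 2 * μ) / (2 + μ))
  dpp : ∃ C : ℝ, ∀ x p, ∀ M : Matrix (Fin d) (Fin d) ℝ, M.IsSymm →
    sqNorm (D2ppH H x p * M) ≤ C * H x p ^ (μ / (2 + μ)) * (D2ppH H x p * M * M).trace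

/-! ### The regularised system -/

/-- A symmetric mollifying kernel. -/
structure IsMollifier {d : ℕ} (η : E d → ℝ) : Prop where
  smooth : ContDiff ℝ ∞ η
  compact : HasCompactSupport η
  nonneg : ∀ x, 0 ≤ η x
  even : ∀ x, η (-x) = η x
  mass : ∫ x, η x = 1

/-- `η_ε * f`, where `η_ε(y) = ε^{-d} η(y/ε)`; for `ε = 0` it is `f` itself. For periodic `f`, this
is the convolution on the torus of `f` with the periodisation of `η_ε`. -/
def mollify {d : ℕ} (η : E d → ℝ) (ε : ℝ) (f : E d → ℝ) (x : E d) : ℝ :=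
  if ε = 0 then f x else ∫ y, ((ε ^ d)⁻¹ * η (ε⁻¹ • y)) * f (x - y)

/-- `g_ε(f) = η_ε * g(η_ε * f)`; in particular `g_0(f) = g(f)`. -/
def gEps {d : ℕ} (η : E d → ℝ) (g : ℝ → ℝ) (ε : ℝ) (f : E d → ℝ) : E d → ℝ :=
  mollify η ε (fun x => g (mollify η ε f x))

/-- `(u, m)` is a smooth solution on `𝕋^d × [0,T]` of
`-u_t + H(x, Du) = Δu + g_ε(m)`, `m_t - div(D_p H(x, Du) m) = Δm`,
with `u(·, T) = uT` and `m(·, 0) = m0`. Time is the first argument. -/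
structure IsSolution {d : ℕ} (T : ℝ) (H : E d → E d → ℝ) (g : ℝ → ℝ) (uT m0 : E d → ℝ)
    (η : E d → ℝ) (ε : ℝ) (u m : ℝ → E d → ℝ) : Prop where
  u_smooth : ContDiffOn ℝ ∞ (fun z : ℝ × E d => u z.1 z.2) (Icc 0 T ×ˢ univ)
  m_smooth : ContDiffOn ℝ ∞ (fun z : ℝ × E d => m z.1 z.2) (Icc 0 T ×ˢ univ)
  u_periodic : ∀ t ∈ Icc 0 T, IsPeriodic (u t)
  m_periodic : ∀ t ∈ Icc 0 T, IsPeriodic (m t)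
  hamiltonJacobi : ∀ t ∈ Ioo 0 T, ∀ x,
    -deriv (fun s => u s x) t + H x (gradient (u t) x)
      = Laplacian.laplacian (u t) x + gEps η g ε (m t) x
  fokkerPlanck : ∀ t ∈ Ioo 0 T, ∀ x,
    deriv (fun s => m s x) t - divergence (fun y => m t y • DpH H y (gradient (u t) y)) x
      = Laplacian.laplacian (m t) x
  terminal : ∀ x, u T x = uT x
  initial : ∀ x, m 0 x = m0 x

/-! ### Norms and exponents -/

/-- The norm of `L^∞(0,T; L^p(𝕋^d))`, as an extended non-negative real. -/
def LInfLp {d : ℕ} {F : Type*} [NormedAddCommGroup F] (T : ℝ) (p : ℝ≥0∞) (f : ℝ → E d → F) :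
    ℝ≥0∞ :=
  essSup (fun t => eLpNorm (f t) p (torusMeasure d)) (volume.restrict (Ioo 0 T))

/-- `β_{υ,θ} = θ β₀ / (θ + υ - θ υ)`. -/
def betaExp (θ υ β₀ : ℝ) : ℝ := θ * β₀ / (θ + υ - θ * υ)

/-- `r_θ = (d (θ - 1) + 2) / 2`. -/
def rExp (d : ℕ) (θ : ℝ) : ℝ := (d * (θ - 1) + 2) / 2

end MFG

end

/-! The bound interpolates between an estimate of m that is independent of Du and one that pays for
the size of the drift b = D_pH(x, Du).

A priori estimates. The minimum principle keeps m strictly positive, so that all its powers are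
smooth, and bounds u from below. Pairing the Hamilton–Jacobi equation with m and with m0 and
subtracting bounds ∫∫ H m (`exists_first_order_bound`). Differentiating ∫ u Δm in time bounds ∫∫
tr(D²_pp H (D²u)²) m (`exists_second_order_bound`): the fourth-order terms cancel, and the coupling
has a favourable sign because the kernel is even and z^α is increasing. Thus E = H + tr(D²_pp H
(D²u)²) is integrable against m, uniformly in ε.

Drift-free integrability (`exists_integral_rpow_le`). In the energy identity for ∫ m^β the drift
enters through div b, and the second-derivative assumptions give |div b| ≤ C E^a with a =
(1+μ)/(2+μ). Young's inequality splits m^β E^a into l·E m, which is integrable, and l^{-(1+μ)} (1 +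
m^Q), where a Gagliardo–Nirenberg inequality handles m^Q when β is at most the critical exponent. If
R dominates sup_t ∫ m^β and the dissipation, then R ≤ A + b₀ l + b₀ l^{-(1+μ)} R² for a fixed
constant b₀ and all l > 0; taking l proportional to R makes the last term of order R^{1-μ}, so μ > 0
closes the estimate.

Integrability at the price of the drift (`exists_integral_rpow_le_drift`). If |b|² ≤ K, the energy
identity for m^{θβ₀}, after completing a square, contains K ∫ m^{θβ₀}. Gagliardo–Nirenberg with the
known L^{β₀} bound dominates ∫ m^{θβ₀} by the power 1 - 1/r of the dissipation, and absorption
leaves K^r. The growth of D_pH allows K of order 1 + ‖Du‖_∞^{2+2μ}.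

Conclusion. Interpolating between β₀ and θβ₀ controls ∫ m^{β_{υ,θ}}
(`exists_integral_rpow_betaExp_le`). Since αp = β_{υ,θ}, Jensen's inequality bounds ∫ g_ε(m)^p by
this integral, and the p-th root produces the stated exponent. -/

namespace MFG

/-! ### Integration over the torus -/

open scoped Pointwise

section Torus

variable {d : ℕ}

/-- The `i`-th coordinate vector. -/
noncomputable abbrev ev (i : Fin d) : E d := EuclideanSpace.single i 1

theorem unitCube_eq_fundamentalDomain :
    unitCube d = ZSpan.fundamentalDomain (EuclideanSpace.basisFun (Fin d) ℝ).toBasis := by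
  ext x
  simp [unitCube, ZSpan.mem_fundamentalDomain]

theorem measurableSet_unitCube : MeasurableSet (unitCube d) := by
  rw [unitCube_eq_fundamentalDomain]
  exact ZSpan.fundamentalDomain_measurableSet _

theorem volume_unitCube : volume (unitCube d) = 1 := by
  rw [unitCube_eq_fundamentalDomain,
    measure_congr (ZSpan.fundamentalDomain_ae_parallelepiped _ volume)]
  simpa using (EuclideanSpace.basisFun (Fin d) ℝ).volume_parallelepiped

instance : IsProbabilityMeasure (torusMeasure d) :=
  ⟨by simp [torusMeasure, volume_unitCube]⟩

theorem isBounded_unitCube : Bornology.IsBounded (unitCube d) := by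
  rw [unitCube_eq_fundamentalDomain]
  exact ZSpan.fundamentalDomain_isBounded _

/-- The closed unit cube, as the closure of the fundamental domain. -/
theorem isCompact_closure_unitCube : IsCompact (closure (unitCube d)) :=
  isBounded_unitCube.isCompact_closure

theorem IsPeriodic.add_mem {F : Type*} {f : E d → F} (hf : IsPeriodic f) (x : E d) {v : E d}
    (hv : v ∈ Submodule.span ℤ (Set.range (EuclideanSpace.basisFun (Fin d) ℝ).toBasis)) :
    f (x + v) = f x := by
  induction hv using Submodule.span_induction generalizing x with
  | mem v hv =>
    obtain ⟨i, rfl⟩ := hv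
    simpa using hf x i
  | zero => simp
  | add v w _ _ h1 h2 => rw [← add_assoc, h2, h1]
  | smul n v _ h =>
    induction n using Int.induction_on generalizing x with
    | zero => simp
    | succ n ih => rw [add_smul, one_smul, ← add_assoc, h, ih]
    | pred n ih =>
      rw [sub_smul, one_smul, ← h (x + _), add_assoc, sub_add_cancel, ih]

theorem IsPeriodic.exists_mem_unitCube {F : Type*} {f : E d → F} (hf : IsPeriodic f) (x : E d) :
    ∃ y ∈ unitCube d, ∃ v : E d, (∀ {G : Type} {h : E d → G}, IsPeriodic h → ∀ z, h (z + v) = h z) ∧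
      y = x + v ∧ f y = f x := by
  refine ⟨ZSpan.fract (EuclideanSpace.basisFun (Fin d) ℝ).toBasis x, ?_,
    -(ZSpan.floor (EuclideanSpace.basisFun (Fin d) ℝ).toBasis x : E d), ?_, ?_, ?_⟩
  · rw [unitCube_eq_fundamentalDomain]
    exact ZSpan.fract_mem_fundamentalDomain _ _
  · intro G h hh z
    exact hh.add_mem z (Submodule.neg_mem _ (SetLike.coe_mem _))
  · rw [ZSpan.fract_apply, sub_eq_add_neg]
  · rw [ZSpan.fract_apply, sub_eq_add_neg]
    exact hf.add_mem x (Submodule.neg_mem _ (SetLike.coe_mem _))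

theorem isAddFundamentalDomain_unitCube :
    IsAddFundamentalDomain
      (Submodule.span ℤ (Set.range (EuclideanSpace.basisFun (Fin d) ℝ).toBasis)).toAddSubgroup
      (unitCube d) (volume : Measure (E d)) := by
  rw [unitCube_eq_fundamentalDomain]
  exact ZSpan.isAddFundamentalDomain' _ _

instance : Countable
    (Submodule.span ℤ (Set.range (EuclideanSpace.basisFun (Fin d) ℝ).toBasis)).toAddSubgroup :=
  inferInstanceAs (Countable
    (Submodule.span ℤ (Set.range (EuclideanSpace.basisFun (Fin d) ℝ).toBasis)))

theorem IsPeriodic.setLIntegral_vadd {f : E d → ℝ≥0∞} (hf : IsPeriodic f) (a : E d) :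
    ∫⁻ x in a +ᵥ unitCube d, f x = ∫⁻ x in unitCube d, f x :=
  (isAddFundamentalDomain_unitCube.vadd_of_comm a).setLIntegral_eq isAddFundamentalDomain_unitCube f
    fun g x => by
      have := hf.add_mem x g.2
      rwa [add_comm] at this

/-- The cube and its translate are both fundamental domains of the lattice, so an invariant function
has the same integral over each. -/
theorem IsPeriodic.integral_comp_add {f : E d → ℝ} (hf : IsPeriodic f) (a : E d) :
    ∫ x, f (x + a) ∂(torusMeasure d) = ∫ x, f x ∂(torusMeasure d) := by
  have h1 : ∫ x in a +ᵥ unitCube d, f x = ∫ x in unitCube d, f x :=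
    (isAddFundamentalDomain_unitCube.vadd_of_comm a).setIntegral_eq
      isAddFundamentalDomain_unitCube (fun g x => by
        have := hf.add_mem x g.2
        rwa [add_comm] at this)
  have h2 := (measurePreserving_add_left volume a).setIntegral_image_emb
    (measurableEmbedding_addLeft a) f (unitCube d)
  rw [torusMeasure, ← h1, ← Set.image_vadd]
  simp only [vadd_eq_add]
  rw [h2]
  simp [add_comm]

theorem ae_torus_of_forall_mem {p : E d → Prop} (h : ∀ x ∈ unitCube d, p x) :
    ∀ᵐ x ∂(torusMeasure d), p x :=
  (ae_restrict_iff' measurableSet_unitCube).2 (Eventually.of_forall h)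

theorem integrable_torus {f : E d → ℝ} (hf : Continuous f) : Integrable f (torusMeasure d) :=
  (hf.continuousOn.integrableOn_compact isCompact_closure_unitCube).mono_set subset_closure

/-! ### Periodic functions -/

theorem IsPeriodic.comp {F G : Type*} {f : E d → F} (hf : IsPeriodic f) (φ : F → G) :
    IsPeriodic (fun x => φ (f x)) := fun x i => by simp only [hf x i]

theorem IsPeriodic.comp₂ {F G K : Type*} {f : E d → F} {g : E d → G} (hf : IsPeriodic f)
    (hg : IsPeriodic g) (φ : F → G → K) : IsPeriodic (fun x => φ (f x) (g x)) :=
  fun x i => by simp only [hf x i, hg x i]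

theorem IsPeriodic.mul {f g : E d → ℝ} (hf : IsPeriodic f) (hg : IsPeriodic g) :
    IsPeriodic (fun x => f x * g x) := hf.comp₂ hg _

theorem IsPeriodic.sum {ι : Type*} {s : Finset ι} {f : ι → E d → ℝ}
    (hf : ∀ i ∈ s, IsPeriodic (f i)) : IsPeriodic (fun x => ∑ i ∈ s, f i x) :=
  fun x j => Finset.sum_congr rfl fun i hi => hf i hi x j

theorem isPeriodic_const {F : Type*} (c : F) : IsPeriodic (fun _ : E d => c) := fun _ _ => rfl

theorem IsPeriodic.comp_add {F : Type*} {f : E d → F} (hf : IsPeriodic f) (a : E d) :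
    IsPeriodic (fun x => f (x + a)) := fun x i => by
  show f (x + _ + a) = f (x + a)
  rw [add_right_comm, hf]

theorem IsPeriodic.pd {f : E d → ℝ} (hf : IsPeriodic f) (i : Fin d) :
    IsPeriodic (fun x => pd i f x) := fun x j => by
  have h : (fun y => f (y + EuclideanSpace.single j 1)) = f := funext fun y => hf y j
  simp only [MFG.pd]
  rw [← fderiv_comp_add_right, h]

/-- A continuous periodic function attains its maximum on the unit cube. -/
theorem IsPeriodic.exists_bound {f : E d → ℝ} (hf : IsPeriodic f) (hc : Continuous f) :
    ∃ C : ℝ, 0 ≤ C ∧ ∀ x, |f x| ≤ C := by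
  obtain ⟨C, hC⟩ := isCompact_closure_unitCube.exists_bound_of_continuousOn hc.continuousOn
  have hC' : ∀ x, |f x| ≤ C := fun x => by
    obtain ⟨y, hy, _, _, _, hxy⟩ := hf.exists_mem_unitCube x
    rw [← hxy]
    exact hC y (subset_closure hy)
  exact ⟨C, (abs_nonneg _).trans (hC' 0), hC'⟩

/-! ### Partial derivatives -/

theorem pd_eq_of_hasFDerivAt {f : E d → ℝ} {f' : E d →L[ℝ] ℝ} {x : E d} (h : HasFDerivAt f f' x)
    (i : Fin d) : pd i f x = f' (ev i) := by rw [pd, h.fderiv]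

theorem hasDerivAt_line {f : E d → ℝ} {x : E d} {i : Fin d} {s : ℝ}
    (hf : DifferentiableAt ℝ f (x + s • ev i)) :
    HasDerivAt (fun s : ℝ => f (x + s • ev i)) (pd i f (x + s • ev i)) s := by
  have h : HasDerivAt (fun s : ℝ => x + s • ev i) (ev i) s := by
    simpa using ((hasDerivAt_id s).smul_const (ev i)).const_add x
  exact hf.hasFDerivAt.comp_hasDerivAt s h

theorem contDiff_pd {f : E d → ℝ} (hf : ContDiff ℝ ∞ f) (i : Fin d) : ContDiff ℝ ∞ (pd i f) :=
  (hf.fderiv_right (m := ∞) (by simp)).clm_apply contDiff_const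

theorem continuous_pd {f : E d → ℝ} (hf : ContDiff ℝ 1 f) (i : Fin d) : Continuous (pd i f) :=
  (hf.continuous_fderiv (by simp)).clm_apply continuous_const

theorem pd_add {f g : E d → ℝ} {x : E d} (i : Fin d) (hf : DifferentiableAt ℝ f x)
    (hg : DifferentiableAt ℝ g x) : pd i (fun y => f y + g y) x = pd i f x + pd i g x :=
  pd_eq_of_hasFDerivAt (hf.hasFDerivAt.add hg.hasFDerivAt) i

theorem pd_mul {f g : E d → ℝ} {x : E d} (i : Fin d) (hf : DifferentiableAt ℝ f x)
    (hg : DifferentiableAt ℝ g x) :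
    pd i (fun y => f y * g y) x = pd i f x * g x + f x * pd i g x := by
  refine (pd_eq_of_hasFDerivAt (hf.hasFDerivAt.mul hg.hasFDerivAt) i).trans ?_
  simp [pd]
  ring

theorem pd_sum {ι : Type*} {s : Finset ι} {f : ι → E d → ℝ} {x : E d} (i : Fin d)
    (hf : ∀ j ∈ s, DifferentiableAt ℝ (f j) x) :
    pd i (fun y => ∑ j ∈ s, f j y) x = ∑ j ∈ s, pd i (f j) x := by
  rw [pd_eq_of_hasFDerivAt (HasFDerivAt.fun_sum fun j hj => (hf j hj).hasFDerivAt) i]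
  simp [pd]

/-- Chain rule for the composition with a function of one variable. -/
theorem pd_comp {f : E d → ℝ} {φ : ℝ → ℝ} {φ' : ℝ} {x : E d} (i : Fin d)
    (hφ : HasDerivAt φ φ' (f x)) (hf : DifferentiableAt ℝ f x) :
    pd i (fun y => φ (f y)) x = φ' * pd i f x := by
  refine (pd_eq_of_hasFDerivAt (hφ.comp_hasFDerivAt x hf.hasFDerivAt) i).trans ?_
  simp [pd]

theorem pd_comm {f : E d → ℝ} (hf : ContDiff ℝ ∞ f) (i j : Fin d) (x : E d) :
    pd i (pd j f) x = pd j (pd i f) x := by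
  have hs : IsSymmSndFDerivAt ℝ f x :=
    (hf.contDiffAt.of_le (m := 2) (WithTop.coe_le_coe.2 le_top)).isSymmSndFDerivAt (n := 2) (by simp)
  have hd : DifferentiableAt ℝ (fderiv ℝ f) x :=
    ((hf.fderiv_right (m := ∞) (by simp)).differentiable (by simp)).differentiableAt
  have key : ∀ k l : Fin d, pd k (pd l f) x = fderiv ℝ (fderiv ℝ f) x (ev k) (ev l) := fun k l => by
    have := (hd.hasFDerivAt.clm_apply (hasFDerivAt_const (ev l) x))
    rw [show pd l f = fun y => fderiv ℝ f y (ev l) from rfl, pd_eq_of_hasFDerivAt this k]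
    simp
  rw [key, key, hs]

/-- The second derivative test: necessary condition at a minimum. -/
theorem pd_pd_nonneg_of_isMin {f : E d → ℝ} (hf : ContDiff ℝ ∞ f) {x : E d}
    (hx : ∀ y, f x ≤ f y) (i : Fin d) : pd i f x = 0 ∧ 0 ≤ pd i (pd i f) x := by
  set φ : ℝ → ℝ := fun s => f (x + s • ev i) with hφ
  have hd1 : ∀ s, HasDerivAt φ (pd i f (x + s • ev i)) s := fun s =>
    hasDerivAt_line (hf.differentiable (by simp)).differentiableAt
  have hd2 : ∀ s, HasDerivAt (fun s : ℝ => pd i f (x + s • ev i))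
      (pd i (pd i f) (x + s • ev i)) s := fun s =>
    hasDerivAt_line ((contDiff_pd hf i).differentiable (by simp)).differentiableAt
  have e1 : deriv φ = fun s : ℝ => pd i f (x + s • ev i) := funext fun s => (hd1 s).deriv
  have hmin : IsLocalMin φ 0 := Eventually.of_forall fun s => by simpa [hφ] using hx _
  have h0 : pd i f x = 0 := by simpa [e1] using hmin.deriv_eq_zero
  refine ⟨h0, not_lt.1 fun hneg => ?_⟩
  have e2 : deriv (deriv φ) 0 = pd i (pd i f) x := by rw [e1, (hd2 0).deriv]; simp
  -- A negative second derivative would make the minimum a local maximum as well; φ would then be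
  -- locally constant, with vanishing second derivative.
  have hmax : IsLocalMax φ 0 := isLocalMax_of_deriv_deriv_neg (by rw [e2]; exact hneg)
    hmin.deriv_eq_zero (hd1 0).continuousAt
  have hconst : φ =ᶠ[𝓝 0] fun _ => φ 0 := by
    filter_upwards [hmin, hmax] with s h1 h2 using le_antisymm h2 h1
  have : deriv (deriv φ) 0 = 0 := by
    rw [(hconst.deriv).deriv_eq]; simp
  rw [e2] at this
  exact hneg.ne this

theorem gradient_apply (f : E d → ℝ) (x : E d) (i : Fin d) : gradient f x i = pd i f x := by
  have h : inner ℝ (gradient f x) (ev i) = fderiv ℝ f x (ev i) := by simp [gradient]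
  rw [pd, ← h, EuclideanSpace.inner_single_right]
  simp

theorem laplacian_eq_sum {f : E d → ℝ} (hf : ContDiff ℝ ∞ f) (x : E d) :
    Laplacian.laplacian f x = ∑ i, pd i (pd i f) x := by
  rw [InnerProductSpace.laplacian_eq_iteratedFDeriv_orthonormalBasis f
    (EuclideanSpace.basisFun (Fin d) ℝ)]
  refine Finset.sum_congr rfl fun i _ => ?_
  have hd : DifferentiableAt ℝ (fderiv ℝ f) x :=
    ((hf.fderiv_right (m := ∞) (by simp)).differentiable (by simp)).differentiableAt
  rw [iteratedFDeriv_two_apply, show pd i f = fun y => fderiv ℝ f y (ev i) from rfl,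
    pd_eq_of_hasFDerivAt (hd.hasFDerivAt.clm_apply (hasFDerivAt_const (ev i) x)) i]
  simp

/-! ### Integration by parts -/

theorem intervalIntegral_torus_swap {F : ℝ → E d → ℝ} {a b : ℝ} (hab : a ≤ b)
    (hF : ContinuousOn (fun z : ℝ × E d => F z.1 z.2) (Icc a b ×ˢ univ)) :
    ∫ s in a..b, ∫ x, F s x ∂(torusMeasure d) = ∫ x, (∫ s in a..b, F s x) ∂(torusMeasure d) := by
  simp only [intervalIntegral.integral_of_le hab]
  refine integral_integral_swap ?_
  have : IntegrableOn (fun z : ℝ × E d => F z.1 z.2) (Ioc a b ×ˢ unitCube d)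
      (volume.prod volume) :=
    ((hF.mono (prod_mono le_rfl (subset_univ _))).integrableOn_compact
      (isCompact_Icc.prod isCompact_closure_unitCube)).mono_set
      (prod_mono Ioc_subset_Icc_self subset_closure)
  rw [IntegrableOn, ← Measure.prod_restrict] at this
  exact this

/-- The integral of ∂_i f is unchanged by translation along e_i, hence equals its average over
translations by s ∈ [0,1]. By Fubini the s-integral can be done first, and it gives f(x + e_i) -
f(x) = 0. No boundary of the cube appears. -/
theorem integral_pd_eq_zero {f : E d → ℝ} (hf : ContDiff ℝ 1 f) (hp : IsPeriodic f) (i : Fin d) :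
    ∫ x, pd i f x ∂(torusMeasure d) = 0 := by
  have hc := continuous_pd hf i
  have h1 : ∀ s : ℝ, ∫ x, pd i f (x + s • ev i) ∂(torusMeasure d)
      = ∫ x, pd i f x ∂(torusMeasure d) := fun s => (hp.pd i).integral_comp_add _
  have hcont : Continuous (fun z : ℝ × E d => pd i f (z.2 + z.1 • ev i)) := by fun_prop
  have h2 := intervalIntegral_torus_swap (F := fun s x => pd i f (x + s • ev i)) zero_le_one
    hcont.continuousOn
  have h3 : ∀ x, ∫ s in (0 : ℝ)..1, pd i f (x + s • ev i) = 0 := fun x => by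
    rw [intervalIntegral.integral_eq_sub_of_hasDerivAt
      (fun s _ => hasDerivAt_line (hf.differentiable (by simp)).differentiableAt)
      ((by fun_prop : Continuous fun s : ℝ => pd i f (x + s • ev i)).intervalIntegrable _ _)]
    simpa using sub_eq_zero.2 (hp x i)
  simpa [h1, h3] using h2

theorem integral_mul_pd {f g : E d → ℝ} (hf : ContDiff ℝ ∞ f) (hg : ContDiff ℝ ∞ g)
    (pf : IsPeriodic f) (pg : IsPeriodic g) (i : Fin d) :
    ∫ x, f x * pd i g x ∂(torusMeasure d) = -∫ x, pd i f x * g x ∂(torusMeasure d) := by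
  have h := integral_pd_eq_zero ((hf.mul hg).of_le (m := 1) (WithTop.coe_le_coe.2 le_top)) (pf.mul pg) i
  have e : ∀ x, pd i (fun y => f y * g y) x = pd i f x * g x + f x * pd i g x := fun x =>
    pd_mul i (hf.differentiable (by simp)).differentiableAt
      (hg.differentiable (by simp)).differentiableAt
  simp only [e] at h
  have h' := integral_add (integrable_torus ((contDiff_pd hf i).continuous.mul hg.continuous))
    (integrable_torus (hf.continuous.mul (contDiff_pd hg i).continuous))
  simp only [Pi.mul_apply] at h'
  rw [h'] at h
  linarith

/-- Green's formula on the torus. -/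
theorem integral_mul_pd_pd {f g : E d → ℝ} (hf : ContDiff ℝ ∞ f) (hg : ContDiff ℝ ∞ g)
    (pf : IsPeriodic f) (pg : IsPeriodic g) (i : Fin d) :
    ∫ x, f x * pd i (pd i g) x ∂(torusMeasure d)
      = ∫ x, pd i (pd i f) x * g x ∂(torusMeasure d) := by
  rw [integral_mul_pd hf (contDiff_pd hg i) pf (pg.pd i), integral_mul_pd (contDiff_pd hf i) hg
    (pf.pd i) pg, neg_neg]

end Torus

end MFG

namespace MFG

/-! ### Functions on the slab `[0,T] × ℝ^d` -/

section Slab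

variable {d : ℕ} {T : ℝ}

/-- Continuity on `[0,T] × ℝ^d`. -/
def SlabContinuous {F : Type*} [TopologicalSpace F] (T : ℝ) (f : ℝ → E d → F) : Prop :=
  ContinuousOn (fun z : ℝ × E d => f z.1 z.2) (Icc 0 T ×ˢ univ)

/-- Smoothness up to the boundary on `[0,T] × ℝ^d`. -/
def SlabSmooth {F : Type*} [NormedAddCommGroup F] [NormedSpace ℝ F] (T : ℝ) (f : ℝ → E d → F) :
    Prop :=
  ContDiffOn ℝ ∞ (fun z : ℝ × E d => f z.1 z.2) (Icc 0 T ×ˢ univ)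

/-- Time derivative within `[0,T]`. -/
noncomputable def dtW (T : ℝ) (f : ℝ → E d → ℝ) (t : ℝ) (x : E d) : ℝ :=
  derivWithin (fun s => f s x) (Icc 0 T) t

theorem uniqueDiffOn_slab (hT : 0 < T) : UniqueDiffOn ℝ (Icc 0 T ×ˢ (univ : Set (E d))) :=
  (uniqueDiffOn_Icc hT).prod uniqueDiffOn_univ

theorem SlabSmooth.slabContinuous {F : Type*} [NormedAddCommGroup F] [NormedSpace ℝ F]
    {f : ℝ → E d → F} (hf : SlabSmooth T f) : SlabContinuous T f := hf.continuousOn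

theorem SlabContinuous.slice {F : Type*} [TopologicalSpace F] {f : ℝ → E d → F}
    (hf : SlabContinuous T f) {t : ℝ} (ht : t ∈ Icc 0 T) : Continuous (f t) := by
  rw [← continuousOn_univ]
  exact ContinuousOn.comp (g := fun z : ℝ × E d => f z.1 z.2) (f := fun x => (t, x)) hf
    (by fun_prop) fun x _ => ⟨ht, mem_univ _⟩

theorem SlabContinuous.time {F : Type*} [TopologicalSpace F] {f : ℝ → E d → F}
    (hf : SlabContinuous T f) (x : E d) : ContinuousOn (fun t => f t x) (Icc 0 T) :=
  ContinuousOn.comp (g := fun z : ℝ × E d => f z.1 z.2) (f := fun t => (t, x)) hf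
    (by fun_prop) fun t ht => ⟨ht, mem_univ _⟩

theorem SlabSmooth.slice {F : Type*} [NormedAddCommGroup F] [NormedSpace ℝ F]
    {f : ℝ → E d → F} (hf : SlabSmooth T f) {t : ℝ} (ht : t ∈ Icc 0 T) : ContDiff ℝ ∞ (f t) := by
  rw [← contDiffOn_univ]
  exact ContDiffOn.comp (g := fun z : ℝ × E d => f z.1 z.2) (f := fun x => (t, x)) hf
    (by fun_prop) fun x _ => ⟨ht, mem_univ _⟩

theorem SlabSmooth.hasFDerivWithinAt {f : ℝ → E d → ℝ} (hf : SlabSmooth T f) {t : ℝ}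
    (ht : t ∈ Icc 0 T) (x : E d) :
    HasFDerivWithinAt (fun z : ℝ × E d => f z.1 z.2)
      (fderivWithin ℝ (fun z : ℝ × E d => f z.1 z.2) (Icc 0 T ×ˢ univ) (t, x))
      (Icc 0 T ×ˢ univ) (t, x) :=
  (hf.differentiableOn (by simp) _ ⟨ht, mem_univ _⟩).hasFDerivWithinAt

theorem SlabSmooth.pd_eq {f : ℝ → E d → ℝ} (hf : SlabSmooth T f) {t : ℝ} (ht : t ∈ Icc 0 T)
    (x : E d) (i : Fin d) : pd i (f t) x =
      fderivWithin ℝ (fun z : ℝ × E d => f z.1 z.2) (Icc 0 T ×ˢ univ) (t, x) (0, ev i) := by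
  have h := (hf.hasFDerivWithinAt ht x).comp x
    (s := univ) (f := fun y : E d => (t, y)) (hasFDerivAt_prodMk_right t x).hasFDerivWithinAt
    fun y _ => ⟨ht, mem_univ _⟩
  rw [hasFDerivWithinAt_univ] at h
  exact pd_eq_of_hasFDerivAt h i

theorem SlabSmooth.hasDerivWithinAt_aux {f : ℝ → E d → ℝ} (hf : SlabSmooth T f) {t : ℝ}
    (ht : t ∈ Icc 0 T) (x : E d) : HasDerivWithinAt (fun s => f s x)
      (fderivWithin ℝ (fun z : ℝ × E d => f z.1 z.2) (Icc 0 T ×ˢ univ) (t, x) (1, 0))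
      (Icc 0 T) t := by
  have h := (hf.hasFDerivWithinAt ht x).comp t
    (s := Icc 0 T) (f := fun s : ℝ => (s, x)) (hasFDerivAt_prodMk_left t x).hasFDerivWithinAt
    fun s hs => ⟨hs, mem_univ _⟩
  have h' := h.hasDerivWithinAt
  simp only [ContinuousLinearMap.comp_apply, ContinuousLinearMap.inl_apply] at h'
  exact h'

theorem SlabSmooth.dtW_eq (hT : 0 < T) {f : ℝ → E d → ℝ} (hf : SlabSmooth T f) {t : ℝ}
    (ht : t ∈ Icc 0 T) (x : E d) : dtW T f t x =
      fderivWithin ℝ (fun z : ℝ × E d => f z.1 z.2) (Icc 0 T ×ˢ univ) (t, x) (1, 0) :=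
  (hf.hasDerivWithinAt_aux ht x).derivWithin (uniqueDiffOn_Icc hT t ht)

theorem SlabSmooth.hasDerivWithinAt (hT : 0 < T) {f : ℝ → E d → ℝ} (hf : SlabSmooth T f) {t : ℝ}
    (ht : t ∈ Icc 0 T) (x : E d) : HasDerivWithinAt (fun s => f s x) (dtW T f t x) (Icc 0 T) t := by
  rw [hf.dtW_eq hT ht]
  exact hf.hasDerivWithinAt_aux ht x

theorem SlabSmooth.hasDerivAt (hT : 0 < T) {f : ℝ → E d → ℝ} (hf : SlabSmooth T f) {t : ℝ}
    (ht : t ∈ Ioo 0 T) (x : E d) : HasDerivAt (fun s => f s x) (dtW T f t x) t :=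
  (hf.hasDerivWithinAt hT (Ioo_subset_Icc_self ht) x).hasDerivAt (Icc_mem_nhds ht.1 ht.2)

/-- Spatial and time derivatives are this full derivative evaluated on (0, e_i) and (1, 0), so their
smoothness up to t = 0 and t = T comes from one statement. -/
theorem SlabSmooth.fderivWithin_apply (hT : 0 < T) {f : ℝ → E d → ℝ} (hf : SlabSmooth T f)
    (v : ℝ × E d) : SlabSmooth T (fun t x =>
      fderivWithin ℝ (fun z : ℝ × E d => f z.1 z.2) (Icc 0 T ×ˢ univ) (t, x) v) :=
  (ContDiffOn.fderivWithin (m := ∞) hf (uniqueDiffOn_slab hT) (by simp)).clm_apply contDiffOn_const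

theorem SlabSmooth.congr {F : Type*} [NormedAddCommGroup F] [NormedSpace ℝ F] {f g : ℝ → E d → F}
    (hf : SlabSmooth T f) (h : ∀ t ∈ Icc 0 T, ∀ x, g t x = f t x) : SlabSmooth T g :=
  ContDiffOn.congr hf fun z hz => h z.1 hz.1 z.2

theorem SlabSmooth.pd (hT : 0 < T) {f : ℝ → E d → ℝ} (hf : SlabSmooth T f) (i : Fin d) :
    SlabSmooth T (fun t x => pd i (f t) x) :=
  (hf.fderivWithin_apply hT (0, ev i)).congr fun _ ht x => hf.pd_eq ht x i

theorem SlabSmooth.dtW (hT : 0 < T) {f : ℝ → E d → ℝ} (hf : SlabSmooth T f) :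
    SlabSmooth T (dtW T f) :=
  (hf.fderivWithin_apply hT (1, 0)).congr fun _ ht x => hf.dtW_eq hT ht x

theorem SlabSmooth.add {f g : ℝ → E d → ℝ} (hf : SlabSmooth T f) (hg : SlabSmooth T g) :
    SlabSmooth T (fun t x => f t x + g t x) := ContDiffOn.add hf hg

theorem SlabSmooth.sub {f g : ℝ → E d → ℝ} (hf : SlabSmooth T f) (hg : SlabSmooth T g) :
    SlabSmooth T (fun t x => f t x - g t x) := ContDiffOn.sub hf hg

theorem SlabSmooth.mul {f g : ℝ → E d → ℝ} (hf : SlabSmooth T f) (hg : SlabSmooth T g) :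
    SlabSmooth T (fun t x => f t x * g t x) := ContDiffOn.mul hf hg

theorem SlabSmooth.sum {ι : Type*} {s : Finset ι} {f : ι → ℝ → E d → ℝ}
    (hf : ∀ i ∈ s, SlabSmooth T (f i)) : SlabSmooth T (fun t x => ∑ i ∈ s, f i t x) :=
  ContDiffOn.sum hf

theorem slabSmooth_of_contDiff {f : E d → ℝ} (hf : ContDiff ℝ ∞ f) :
    SlabSmooth T (fun _ x => f x) := (hf.comp contDiff_snd).contDiffOn

theorem slabSmooth_of_time {f : ℝ → ℝ} (hf : ContDiff ℝ ∞ f) :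
    SlabSmooth T (fun t (_ : E d) => f t) := (hf.comp contDiff_fst).contDiffOn

theorem SlabSmooth.rpow {f : ℝ → E d → ℝ} (hf : SlabSmooth T f)
    (hpos : ∀ t ∈ Icc 0 T, ∀ x, 0 < f t x) (q : ℝ) : SlabSmooth T (fun t x => f t x ^ q) :=
  ContDiffOn.rpow_const_of_ne hf fun z hz => (hpos z.1 hz.1 z.2).ne'

theorem SlabSmooth.gradient (hT : 0 < T) {f : ℝ → E d → ℝ} (hf : SlabSmooth T f) :
    SlabSmooth T (fun t x => gradient (f t) x) := by
  rw [SlabSmooth, contDiffOn_euclidean]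
  exact fun i => (hf.pd hT i).congr fun t _ x => gradient_apply (f t) x i

theorem SlabContinuous.add {f g : ℝ → E d → ℝ} (hf : SlabContinuous T f)
    (hg : SlabContinuous T g) : SlabContinuous T (fun t x => f t x + g t x) :=
  ContinuousOn.add hf hg

theorem SlabContinuous.sub {f g : ℝ → E d → ℝ} (hf : SlabContinuous T f)
    (hg : SlabContinuous T g) : SlabContinuous T (fun t x => f t x - g t x) :=
  ContinuousOn.sub hf hg

theorem SlabContinuous.mul {f g : ℝ → E d → ℝ} (hf : SlabContinuous T f)
    (hg : SlabContinuous T g) : SlabContinuous T (fun t x => f t x * g t x) :=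
  ContinuousOn.mul hf hg

theorem slabContinuous_const (c : ℝ) : SlabContinuous T (fun _ (_ : E d) => c) := continuousOn_const

/-- Two functions continuous on the slab which satisfy an inequality on `(0,T)` satisfy it
on `[0,T]`. -/
theorem SlabContinuous.le_of_le {f g : ℝ → E d → ℝ} (hT : 0 < T) (hf : SlabContinuous T f)
    (hg : SlabContinuous T g) (h : ∀ t ∈ Ioo 0 T, ∀ x, f t x ≤ g t x) :
    ∀ t ∈ Icc 0 T, ∀ x, f t x ≤ g t x := fun t ht x => by
  rw [← closure_Ioo hT.ne] at ht
  refine ContinuousWithinAt.closure_le (f := fun s => f s x) (g := fun s => g s x) ht ?_ ?_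
    fun s hs => h s hs x
  · exact ((hf.time x) t (by rwa [closure_Ioo hT.ne] at ht)).mono Ioo_subset_Icc_self
  · exact ((hg.time x) t (by rwa [closure_Ioo hT.ne] at ht)).mono Ioo_subset_Icc_self

/-- The equations are assumed only for 0 < t < T; by continuity this carries such an identity to the
endpoint times. -/
theorem SlabContinuous.eq_of_eq {f g : ℝ → E d → ℝ} (hT : 0 < T) (hf : SlabContinuous T f)
    (hg : SlabContinuous T g) (h : ∀ t ∈ Ioo 0 T, ∀ x, f t x = g t x) :
    ∀ t ∈ Icc 0 T, ∀ x, f t x = g t x := fun t ht x =>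
  le_antisymm (hf.le_of_le hT hg (fun s hs y => (h s hs y).le) t ht x)
    (hg.le_of_le hT hf (fun s hs y => (h s hs y).ge) t ht x)

theorem isPeriodic_dtW {f : ℝ → E d → ℝ} (hp : ∀ t ∈ Icc 0 T, IsPeriodic (f t)) {t : ℝ}
    (ht : t ∈ Icc 0 T) : IsPeriodic (dtW T f t) := fun x i =>
  derivWithin_congr (fun s hs => hp s hs x i) (hp t ht x i)

theorem SlabContinuous.exists_bound {f : ℝ → E d → ℝ} (hf : SlabContinuous T f)
    (hp : ∀ t ∈ Icc 0 T, IsPeriodic (f t)) :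
    ∃ C : ℝ, 0 ≤ C ∧ ∀ t ∈ Icc 0 T, ∀ x, |f t x| ≤ C := by
  obtain ⟨C, hC⟩ := (isCompact_Icc.prod
    (isCompact_closure_unitCube (d := d))).exists_bound_of_continuousOn
      (ContinuousOn.mono hf (prod_mono le_rfl (subset_univ _)))
  refine ⟨max C 0, le_max_right _ _, fun t ht x => ?_⟩
  obtain ⟨y, hy, _, _, _, hxy⟩ := (hp t ht).exists_mem_unitCube x
  rw [← hxy]
  exact (hC (t, y) ⟨ht, subset_closure hy⟩).trans (le_max_left _ _)

theorem SlabContinuous.continuousOn_integral {f : ℝ → E d → ℝ} (hf : SlabContinuous T f) :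
    ContinuousOn (fun t => ∫ x, f t x ∂(torusMeasure d)) (Icc 0 T) := by
  obtain ⟨C, hC⟩ := (isCompact_Icc.prod
    (isCompact_closure_unitCube (d := d))).exists_bound_of_continuousOn
      (ContinuousOn.mono hf (prod_mono le_rfl (subset_univ _)))
  refine continuousOn_of_dominated (bound := fun _ => C)
    (fun t ht => (hf.slice ht).aestronglyMeasurable) (fun t ht => ?_) (integrable_const _)
    (Eventually.of_forall fun x => hf.time x)
  exact ae_torus_of_forall_mem fun x hx => hC (t, x) ⟨ht, subset_closure hx⟩

theorem SlabContinuous.intervalIntegrable_integral {f : ℝ → E d → ℝ} (hf : SlabContinuous T f)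
    {t : ℝ} (ht : t ∈ Icc 0 T) :
    IntervalIntegrable (fun s => ∫ x, f s x ∂(torusMeasure d)) volume 0 t :=
  (hf.continuousOn_integral.mono (by
    rw [uIcc_of_le ht.1]; exact Icc_subset_Icc_right ht.2)).intervalIntegrable

/-- Fundamental theorem of calculus for spatial integrals. -/
theorem SlabSmooth.integral_sub (hT : 0 < T) {f : ℝ → E d → ℝ} (hf : SlabSmooth T f) {t : ℝ}
    (ht : t ∈ Icc 0 T) :
    ∫ x, f t x ∂(torusMeasure d) - ∫ x, f 0 x ∂(torusMeasure d)
      = ∫ s in (0 : ℝ)..t, ∫ x, MFG.dtW T f s x ∂(torusMeasure d) := by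
  have hsub : Icc 0 t ⊆ Icc 0 T := Icc_subset_Icc_right ht.2
  have hc := (hf.dtW hT).slabContinuous
  rw [intervalIntegral_torus_swap ht.1 (ContinuousOn.mono hc (prod_mono hsub le_rfl)),
    ← MeasureTheory.integral_sub (integrable_torus (hf.slice ht).continuous)
    (integrable_torus (hf.slice ⟨le_rfl, hT.le⟩).continuous)]
  congr 1 with x
  refine (intervalIntegral.integral_eq_sub_of_hasDerivAt_of_le ht.1
    ((hf.slabContinuous.time x).mono hsub)
    (fun s hs => hf.hasDerivAt hT ⟨hs.1, hs.2.trans_le ht.2⟩ x) ?_).symm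
  exact ((hc.time x).mono (by rw [uIcc_of_le ht.1]; exact hsub)).intervalIntegrable

/-- Monotonicity of the space-time integral with respect to the values on `(0,T)`. -/
theorem SlabContinuous.integral_integral_mono {f g : ℝ → E d → ℝ} (hf : SlabContinuous T f)
    (hg : SlabContinuous T g) {t : ℝ} (ht : t ∈ Icc 0 T)
    (h : ∀ s ∈ Ioo 0 T, ∫ x, f s x ∂(torusMeasure d) ≤ ∫ x, g s x ∂(torusMeasure d)) :
    ∫ s in (0 : ℝ)..t, ∫ x, f s x ∂(torusMeasure d)
      ≤ ∫ s in (0 : ℝ)..t, ∫ x, g s x ∂(torusMeasure d) :=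
  intervalIntegral.integral_mono_on_of_le_Ioo ht.1 (hf.intervalIntegrable_integral ht)
    (hg.intervalIntegrable_integral ht) fun s hs => h s ⟨hs.1, hs.2.trans_le ht.2⟩

/-! ### Minimum principle -/

/-- Value and derivative information at a space-time minimum of a periodic slab function. -/
theorem exists_slab_min (hT : 0 < T) {f : ℝ → E d → ℝ} (hf : SlabSmooth T f)
    (hp : ∀ t ∈ Icc 0 T, IsPeriodic (f t)) :
    ∃ t ∈ Icc 0 T, ∃ x, (∀ s ∈ Icc 0 T, ∀ y, f t x ≤ f s y) ∧ (∀ i, MFG.pd i (f t) x = 0) ∧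
      (∀ i, 0 ≤ MFG.pd i (MFG.pd i (f t)) x) ∧ (0 < t → MFG.dtW T f t x ≤ 0) ∧
      (t < T → 0 ≤ MFG.dtW T f t x) := by
  have hne : (Icc 0 T ×ˢ closure (unitCube d)).Nonempty :=
    ⟨(0, 0), ⟨le_rfl, hT.le⟩, subset_closure fun i => by simp⟩
  obtain ⟨⟨t, x⟩, ⟨ht, hx⟩, hmin⟩ := (isCompact_Icc.prod
    (isCompact_closure_unitCube (d := d))).exists_isMinOn hne
      (ContinuousOn.mono hf.slabContinuous (prod_mono le_rfl (subset_univ _)))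
  have hall : ∀ s ∈ Icc 0 T, ∀ y, f t x ≤ f s y := fun s hs y => by
    obtain ⟨z, hz, _, _, _, hzy⟩ := (hp s hs).exists_mem_unitCube y
    rw [← hzy]
    exact hmin (show (s, z) ∈ _ from ⟨hs, subset_closure hz⟩)
  have hd := hf.hasDerivWithinAt hT ht x
  refine ⟨t, ht, x, hall, fun i => (pd_pd_nonneg_of_isMin (hf.slice ht) (hall t ht) i).1,
    fun i => (pd_pd_nonneg_of_isMin (hf.slice ht) (hall t ht) i).2, fun h0 => ?_, fun h1 => ?_⟩
  -- At a minimum with t > 0 the difference quotients from the left are non-positive, even if t = T.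
  -- The second bullet is the mirror image from the right.
  · have hd' := (hd.mono (Icc_subset_Icc_right ht.2)).mono
      (Ico_subset_Icc_self : Ico 0 t ⊆ Icc 0 t)
    rw [hasDerivWithinAt_iff_tendsto_slope' (by simp)] at hd'
    have : (𝓝[Ico 0 t] t).NeBot := by
      rw [← mem_closure_iff_nhdsWithin_neBot, closure_Ico h0.ne]; exact ⟨h0.le, le_rfl⟩
    refine le_of_tendsto hd' (eventually_nhdsWithin_of_forall fun s hs => ?_)
    rw [slope_def_field]
    exact div_nonpos_of_nonneg_of_nonpos
      (sub_nonneg.2 (hall s ⟨hs.1, hs.2.le.trans ht.2⟩ x)) (sub_nonpos.2 hs.2.le)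
  · have hd' := (hd.mono (Icc_subset_Icc_left ht.1)).mono
      (Ioc_subset_Icc_self : Ioc t T ⊆ Icc t T)
    rw [hasDerivWithinAt_iff_tendsto_slope' (by simp)] at hd'
    have : (𝓝[Ioc t T] t).NeBot := by
      rw [← mem_closure_iff_nhdsWithin_neBot, closure_Ioc h1.ne]; exact ⟨le_rfl, h1.le⟩
    refine ge_of_tendsto hd' (eventually_nhdsWithin_of_forall fun s hs => ?_)
    rw [slope_def_field]
    exact div_nonneg (sub_nonneg.2 (hall s ⟨ht.1.trans hs.1.le, hs.2⟩ x)) (sub_nonneg.2 hs.1.le)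

end Slab

end MFG

namespace MFG

/-! ### Interpolation and Sobolev inequalities on the torus -/

open scoped Pointwise

section Sobolev

variable {d : ℕ}

theorem memLp_torus {f : E d → ℝ} (hf : Continuous f) (p : ℝ≥0∞) : MemLp f p (torusMeasure d) := by
  obtain ⟨C, hC⟩ := isCompact_closure_unitCube.exists_bound_of_continuousOn hf.continuousOn
  exact MemLp.of_bound hf.aestronglyMeasurable C
    (ae_torus_of_forall_mem fun x hx => hC x (subset_closure hx))

theorem integral_torus_mono {f g : E d → ℝ} (hf : Continuous f) (hg : Continuous g)
    (h : ∀ x, f x ≤ g x) : ∫ x, f x ∂(torusMeasure d) ≤ ∫ x, g x ∂(torusMeasure d) :=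
  integral_mono (integrable_torus hf) (integrable_torus hg) h

theorem integral_torus_pos {f : E d → ℝ} (hf : Continuous f) (h : ∀ x, 0 < f x) :
    0 < ∫ x, f x ∂(torusMeasure d) := by
  refine (integral_pos_iff_support_of_nonneg (fun x => (h x).le) (integrable_torus hf)).2 ?_
  have : Function.support f = univ := eq_univ_of_forall fun x => (h x).ne'
  rw [this, measure_univ]
  exact one_pos

theorem integral_torus_nonneg {f : E d → ℝ} (h : ∀ x, 0 ≤ f x) :
    0 ≤ ∫ x, f x ∂(torusMeasure d) := integral_nonneg h

theorem integral_torus_mul_le {f g : E d → ℝ} (hf : Continuous f) (hg : Continuous g)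
    (f0 : ∀ x, 0 ≤ f x) (g0 : ∀ x, 0 ≤ g x) {p q : ℝ} (hpq : p.HolderConjugate q) :
    ∫ x, f x * g x ∂(torusMeasure d) ≤
      (∫ x, f x ^ p ∂(torusMeasure d)) ^ (1 / p) * (∫ x, g x ^ q ∂(torusMeasure d)) ^ (1 / q) :=
  integral_mul_le_Lp_mul_Lq_of_nonneg hpq (Eventually.of_forall f0) (Eventually.of_forall g0)
    (memLp_torus hf _) (memLp_torus hg _)

/-- Interpolation of the integrals of powers of a positive function. -/
theorem integral_rpow_interpolate {w : E d → ℝ} (hw : Continuous w) (hpos : ∀ x, 0 < w x)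
    (a b : ℝ) {t : ℝ} (h0 : 0 ≤ t) (h1 : t ≤ 1) :
    ∫ x, w x ^ ((1 - t) * a + t * b) ∂(torusMeasure d) ≤
      (∫ x, w x ^ a ∂(torusMeasure d)) ^ (1 - t) * (∫ x, w x ^ b ∂(torusMeasure d)) ^ t := by
  -- Hölder with exponents 1/(1-t) and 1/t needs 0 < t < 1; the endpoints are trivial.
  rcases h0.eq_or_lt with rfl | h0
  · simp
  rcases h1.eq_or_lt with rfl | h1
  · simp
  have hpq : (1 / (1 - t)).HolderConjugate (1 / t) := by
    rw [Real.holderConjugate_iff]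
    refine ⟨?_, by simp⟩
    rw [lt_div_iff₀ (by linarith)]; linarith
  have hc : ∀ c : ℝ, Continuous fun x => w x ^ c := fun c =>
    hw.rpow_const fun x => Or.inl (hpos x).ne'
  have key := integral_torus_mul_le (hc ((1 - t) * a)) (hc (t * b))
    (fun x => (Real.rpow_pos_of_pos (hpos x) _).le)
    (fun x => (Real.rpow_pos_of_pos (hpos x) _).le) hpq
  have e1 : ∀ x, w x ^ ((1 - t) * a) * w x ^ (t * b) = w x ^ ((1 - t) * a + t * b) := fun x =>
    (Real.rpow_add (hpos x) _ _).symm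
  have e2 : ∀ x, (w x ^ ((1 - t) * a)) ^ (1 / (1 - t)) = w x ^ a := fun x => by
    rw [← Real.rpow_mul (hpos x).le]
    congr 1
    field_simp [(sub_pos.2 h1).ne']
  have e3 : ∀ x, (w x ^ (t * b)) ^ (1 / t) = w x ^ b := fun x => by
    rw [← Real.rpow_mul (hpos x).le]
    congr 1
    field_simp
  simpa only [e1, e2, e3, one_div_one_div] using key

/-- Periodic functions have comparable integrals over compact sets and over the unit cube. -/
theorem exists_setLIntegral_le_of_isCompact {K : Set (E d)} (hK : IsCompact K) :
    ∃ N : ℝ≥0, ∀ h : E d → ℝ≥0∞, IsPeriodic h →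
      ∫⁻ x in K, h x ≤ N * ∫⁻ x in unitCube d, h x := by
  refine hK.induction_on (p := fun s => ∃ N : ℝ≥0, ∀ h : E d → ℝ≥0∞, IsPeriodic h →
      ∫⁻ x in s, h x ≤ N * ∫⁻ x in unitCube d, h x) ⟨0, by simp⟩ ?_ ?_ ?_
  · rintro s t hst ⟨N, hN⟩
    exact ⟨N, fun h hh => (lintegral_mono_set hst).trans (hN h hh)⟩
  · rintro s t ⟨N, hN⟩ ⟨M, hM⟩
    refine ⟨N + M, fun h hh => (lintegral_union_le _ _ _).trans ?_⟩
    rw [ENNReal.coe_add, add_mul]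
    exact add_le_add (hN h hh) (hM h hh)
  · intro x _
    set c : E d := WithLp.toLp 2 fun _ => (1 / 2 : ℝ)
    -- The half-open cube centred at x is a neighbourhood of x and has the same integral as the unit
    -- cube. Compactness then leaves finitely many such cubes.
    refine ⟨(x - c) +ᵥ unitCube d, mem_nhdsWithin_of_mem_nhds ?_, 1, fun h hh => ?_⟩
    · have hopen : IsOpen {y : E d | ∀ i, (y - (x - c)) i ∈ Ioo (0 : ℝ) 1} := by
        simp only [ofPred_forall]
        exact isOpen_iInter_of_finite fun i => isOpen_Ioo.preimage (by fun_prop)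
      refine mem_of_superset (hopen.mem_nhds fun i => ?_) fun y hy => ?_
      · simp [c]; norm_num
      · rw [mem_vadd_set_iff_neg_vadd_mem]
        intro i
        have := hy i
        rw [vadd_eq_add, neg_add_eq_sub]
        exact Ioo_subset_Ico_self this
    · rw [hh.setLIntegral_vadd]; simp

/-- The `W^{1,1}` Sobolev inequality on the torus. -/
theorem exists_lintegral_rpow_le_fderiv {p : ℝ} (hp : Real.HolderConjugate (d : ℝ) p) :
    ∃ C : ℝ≥0, ∀ f : E d → ℝ, ContDiff ℝ 1 f → IsPeriodic f →
      ∫⁻ x in unitCube d, ‖f x‖ₑ ^ p ≤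
        C * (∫⁻ x in unitCube d, (‖fderiv ℝ f x‖ₑ + ‖f x‖ₑ)) ^ p := by
  obtain ⟨R, hR⟩ := (isBounded_unitCube (d := d)).subset_closedBall 0
  -- The Sobolev inequality on ℝ^d needs compact support, so f is multiplied by a cut-off equal to 1
  -- on the cube. The derivative of χ f lives on a ball, over which periodic integrals are
  -- comparable to those over the cube.
  let χ : ContDiffBump (0 : E d) := ⟨max R 1, max R 1 + 1, by positivity, by linarith⟩
  have hχ : ContDiff ℝ ∞ χ := χ.contDiff
  obtain ⟨M, hM⟩ := (isCompact_closedBall (0 : E d) (max R 1 + 1)).exists_bound_of_continuousOn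
    (hχ.continuous_fderiv (by simp)).continuousOn
  set M' : ℝ≥0 := Real.toNNReal (max M 1)
  have hM' : (M' : ℝ) = max M 1 := Real.coe_toNNReal _ (by positivity)
  obtain ⟨N, hN⟩ := exists_setLIntegral_le_of_isCompact (isCompact_closedBall (0 : E d)
    (max R 1 + 1))
  refine ⟨lintegralPowLePowLIntegralFDerivConst (volume : Measure (E d)) p * (M' * N) ^ p,
    fun f hf hper => ?_⟩
  have hu : ContDiff ℝ 1 (fun x => χ x * f x) :=
    (hχ.of_le (m := 1) (WithTop.coe_le_coe.2 le_top)).mul hf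
  have hsupp : HasCompactSupport (fun x => χ x * f x) := χ.hasCompactSupport.mul_right
  have h1 := lintegral_pow_le_pow_lintegral_fderiv (volume : Measure (E d)) hu hsupp
    (p := p) (by simpa using hp)
  have h2 : ∫⁻ x in unitCube d, ‖f x‖ₑ ^ p ≤ ∫⁻ x, ‖χ x * f x‖ₑ ^ p := by
    refine le_trans (le_of_eq ?_) (setLIntegral_le_lintegral (unitCube d) _)
    refine setLIntegral_congr_fun measurableSet_unitCube fun x hx => ?_
    have : χ x = 1 := χ.one_of_mem_closedBall
      (Metric.closedBall_subset_closedBall (le_max_left _ _) (hR hx))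
    simp only [this, one_mul]
  have h3 : ∀ x, ‖fderiv ℝ (fun x => χ x * f x) x‖ₑ ≤
      (Metric.closedBall (0 : E d) (max R 1 + 1)).indicator
        (fun x => M' * (‖fderiv ℝ f x‖ₑ + ‖f x‖ₑ)) x := fun x => by
    by_cases hx : x ∈ Metric.closedBall (0 : E d) (max R 1 + 1)
    · rw [indicator_of_mem hx]
      have hfd : fderiv ℝ (fun x => χ x * f x) x = χ x • fderiv ℝ f x + f x • fderiv ℝ χ x :=
        fderiv_fun_mul (hχ.differentiable (by simp)).differentiableAt
          (hf.differentiable (by simp)).differentiableAt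
      have hle : ‖fderiv ℝ (fun x => χ x * f x) x‖ ≤ M' * (‖fderiv ℝ f x‖ + ‖f x‖) := by
        rw [hfd, hM']
        refine (norm_add_le _ _).trans ?_
        rw [norm_smul, norm_smul, mul_add]
        refine add_le_add (mul_le_mul_of_nonneg_right ?_ (norm_nonneg _)) ?_
        · rw [Real.norm_of_nonneg χ.nonneg]
          exact χ.le_one.trans (le_max_right _ _)
        · rw [mul_comm]
          exact mul_le_mul_of_nonneg_right ((hM x hx).trans (le_max_left _ _)) (norm_nonneg _)
      rw [← ofReal_norm, ← ofReal_norm, ← ofReal_norm, ← ENNReal.ofReal_coe_nnreal,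
        ← ENNReal.ofReal_add (norm_nonneg _) (norm_nonneg _), ← ENNReal.ofReal_mul (NNReal.coe_nonneg M')]
      exact ENNReal.ofReal_le_ofReal hle
    · have hx' : x ∉ tsupport (fun x => χ x * f x) := fun h =>
        hx (χ.tsupport_eq ▸ tsupport_mul_subset_left h)
      rw [indicator_of_notMem hx, fderiv_of_notMem_tsupport ℝ hx']
      exact (enorm_zero (E := E d →L[ℝ] ℝ)).le
  have hper' : IsPeriodic (fun x => M' * (‖fderiv ℝ f x‖ₑ + ‖f x‖ₑ)) := fun x i => by
    have h : (fun y => f (y + EuclideanSpace.single i 1)) = f := funext fun y => hper y i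
    have h' : fderiv ℝ f (x + EuclideanSpace.single i 1) = fderiv ℝ f x := by
      rw [← fderiv_comp_add_right, h]
    simp only [h', hper x i]
  have h4 : ∫⁻ x, ‖fderiv ℝ (fun x => χ x * f x) x‖ₑ ≤
      (M' * N) * ∫⁻ x in unitCube d, (‖fderiv ℝ f x‖ₑ + ‖f x‖ₑ) := by
    refine (lintegral_mono h3).trans ?_
    rw [lintegral_indicator Metric.isClosed_closedBall.measurableSet]
    refine (hN _ hper').trans (le_of_eq ?_)
    rw [lintegral_const_mul' _ _ ENNReal.coe_ne_top]
    ring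
  have hp0 : 0 ≤ p := hp.symm.nonneg
  refine h2.trans (h1.trans ?_)
  rw [ENNReal.coe_mul, mul_assoc]
  gcongr
  refine (ENNReal.rpow_le_rpow h4 hp0).trans (le_of_eq ?_)
  rw [ENNReal.mul_rpow_of_nonneg _ _ hp0, ENNReal.coe_rpow_of_nonneg _ hp0, ENNReal.coe_mul]

theorem exists_integral_rpow_le_fderiv {p : ℝ} (hp : Real.HolderConjugate (d : ℝ) p) :
    ∃ C : ℝ, 0 < C ∧ ∀ f : E d → ℝ, ContDiff ℝ 1 f → IsPeriodic f → (∀ x, 0 < f x) →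
      ∫ x, f x ^ p ∂(torusMeasure d) ≤
        C * (∫ x, (‖fderiv ℝ f x‖ + f x) ∂(torusMeasure d)) ^ p := by
  obtain ⟨C, hC⟩ := exists_lintegral_rpow_le_fderiv hp
  refine ⟨C + 1, by positivity, fun f hf hper hpos => ?_⟩
  have hp0 : 0 ≤ p := hp.symm.nonneg
  have hc1 : Continuous fun x => f x ^ p := hf.continuous.rpow_const fun x => Or.inr hp0
  have hc2 : Continuous fun x => ‖fderiv ℝ f x‖ + f x :=
    ((hf.continuous_fderiv (by simp)).norm).add hf.continuous
  have hI : 0 ≤ ∫ x, (‖fderiv ℝ f x‖ + f x) ∂(torusMeasure d) :=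
    integral_torus_nonneg fun x => add_nonneg (norm_nonneg _) (hpos x).le
  have e1 : ∫⁻ x in unitCube d, ‖f x‖ₑ ^ p = ENNReal.ofReal (∫ x, f x ^ p ∂(torusMeasure d)) := by
    rw [ofReal_integral_eq_lintegral_ofReal (integrable_torus hc1)
      (Eventually.of_forall fun x => (Real.rpow_nonneg (hpos x).le _))]
    refine lintegral_congr fun x => ?_
    rw [← ofReal_norm, Real.norm_of_nonneg (hpos x).le,
      ENNReal.ofReal_rpow_of_nonneg (hpos x).le hp0]
  have e2 : ∫⁻ x in unitCube d, (‖fderiv ℝ f x‖ₑ + ‖f x‖ₑ) =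
      ENNReal.ofReal (∫ x, (‖fderiv ℝ f x‖ + f x) ∂(torusMeasure d)) := by
    rw [ofReal_integral_eq_lintegral_ofReal (integrable_torus hc2)
      (Eventually.of_forall fun x => add_nonneg (norm_nonneg _) (hpos x).le)]
    refine lintegral_congr fun x => ?_
    rw [← ofReal_norm, ← ofReal_norm, Real.norm_of_nonneg (hpos x).le,
      ENNReal.ofReal_add (norm_nonneg _) (hpos x).le]
  have h := hC f hf hper
  rw [e1, e2, ENNReal.ofReal_rpow_of_nonneg hI hp0, ← ENNReal.ofReal_coe_nnreal,
    ← ENNReal.ofReal_mul (NNReal.coe_nonneg C)] at h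
  have h' := (ENNReal.ofReal_le_ofReal_iff
    (mul_nonneg (NNReal.coe_nonneg C) (Real.rpow_nonneg hI _))).1 h
  refine h'.trans (mul_le_mul_of_nonneg_right (by linarith) (Real.rpow_nonneg hI _))

theorem norm_fderiv_eq_norm_gradient (f : E d → ℝ) (x : E d) :
    ‖fderiv ℝ f x‖ = ‖gradient f x‖ := by simp [gradient]

theorem norm_gradient_sq (f : E d → ℝ) (x : E d) : ‖gradient f x‖ ^ 2 = ∑ i, pd i f x ^ 2 := by
  rw [EuclideanSpace.norm_sq_eq]
  simp [gradient_apply]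

/-- A Gagliardo–Nirenberg inequality on the torus. -/
theorem exists_gagliardoNirenberg (hd : 2 ≤ d) {σ : ℝ} (hσ : 0 < σ) :
    ∃ C : ℝ, 0 < C ∧ ∀ w : E d → ℝ, ContDiff ℝ 1 w → IsPeriodic w → (∀ x, 0 < w x) →
      ∫ x, w x ^ (2 + 2 * σ / d) ∂(torusMeasure d) ≤
        C * (∫ x, w x ^ σ ∂(torusMeasure d)) ^ (2 / d : ℝ) *
          ∫ x, (‖gradient w x‖ ^ 2 + w x ^ 2) ∂(torusMeasure d) := by
  have hd' : (2 : ℝ) ≤ d := by exact_mod_cast hd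
  have hd0 : (0 : ℝ) < d := by linarith
  have hd1 : (0 : ℝ) < d - 1 := by linarith
  have hpq : Real.HolderConjugate (d : ℝ) (d / (d - 1)) := by
    rw [Real.holderConjugate_iff]
    refine ⟨by linarith, ?_⟩
    field_simp
    ring
  obtain ⟨C, hC0, hC⟩ := exists_integral_rpow_le_fderiv hpq
  -- The W^{1,1} inequality is applied to w^γ; γ is chosen so that its left side is the integral of
  -- w^ρ with ρ = 2 + 2σ/d, and d ≥ 2 gives γ ≥ 1.
  set γ : ℝ := 2 * (d - 1) * (d + σ) / d ^ 2 with hγ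
  have hγ1 : 1 ≤ γ := by
    rw [hγ, le_div_iff₀ (by positivity)]
    nlinarith [mul_pos hσ hd1]
  set ρ : ℝ := 2 + 2 * σ / d with hρ
  have hγρ : γ * (d / (d - 1)) = ρ := by rw [hγ, hρ]; field_simp
  -- Cauchy–Schwarz on w^{γ-1}|Dw| produces the exponent 2γ - 2, which lies between σ and ρ with
  -- weight (d-2)/d on ρ.
  set B : ℝ := 2 * γ - 2 with hB
  have hBint : (1 - (d - 2) / d) * σ + (d - 2) / d * ρ = B := by
    rw [hB, hγ, hρ]; field_simp; ring
  refine ⟨C ^ (2 * (d - 1) / d : ℝ) * (2 * γ ^ 2), by positivity, fun w hw hper hpos => ?_⟩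
  have hwc := hw.continuous
  have hc : ∀ c : ℝ, Continuous fun x => w x ^ c := fun c =>
    hwc.rpow_const fun x => Or.inl (hpos x).ne'
  have hgc : Continuous fun x => ‖gradient w x‖ := by
    simp only [← norm_fderiv_eq_norm_gradient]
    exact (hw.continuous_fderiv (by simp)).norm
  set X := ∫ x, w x ^ ρ ∂(torusMeasure d) with hX
  set S := ∫ x, w x ^ σ ∂(torusMeasure d) with hS
  set Z := ∫ x, (‖gradient w x‖ ^ 2 + w x ^ 2) ∂(torusMeasure d) with hZ
  have hX0 : 0 < X := integral_torus_pos (hc ρ) fun x => Real.rpow_pos_of_pos (hpos x) _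
  have hS0 : 0 < S := integral_torus_pos (hc σ) fun x => Real.rpow_pos_of_pos (hpos x) _
  have hZ0 : 0 ≤ Z := integral_torus_nonneg fun x => by positivity
  have hfw : ContDiff ℝ 1 fun x => w x ^ γ := hw.rpow_const_of_ne fun x => (hpos x).ne'
  have h1 := hC _ hfw (hper.comp fun z => z ^ γ) fun x => Real.rpow_pos_of_pos (hpos x) _
  have e1 : ∀ x, (w x ^ γ) ^ ((d : ℝ) / (d - 1)) = w x ^ ρ := fun x => by
    rw [← Real.rpow_mul (hpos x).le, hγρ]
  have e2 : ∀ x, ‖fderiv ℝ (fun x => w x ^ γ) x‖ + w x ^ γ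
      = w x ^ (γ - 1) * (γ * ‖gradient w x‖ + w x) := fun x => by
    have hdw : HasFDerivAt w (fderiv ℝ w x) x :=
      (hw.differentiable (by simp)).differentiableAt.hasFDerivAt
    rw [(hdw.rpow_const (p := γ) (Or.inl (hpos x).ne')).fderiv, norm_smul,
      norm_fderiv_eq_norm_gradient, Real.norm_of_nonneg
        (mul_nonneg (by linarith) (Real.rpow_nonneg (hpos x).le _)), mul_add,
      ← Real.rpow_add_one (hpos x).ne', sub_add_cancel]
    ring
  simp only [e1, e2] at h1
  have h2 : ∫ x, w x ^ (γ - 1) * (γ * ‖gradient w x‖ + w x) ∂(torusMeasure d) ≤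
      (∫ x, w x ^ B ∂(torusMeasure d)) ^ (1 / 2 : ℝ) * (2 * γ ^ 2 * Z) ^ (1 / 2 : ℝ) := by
    refine (integral_torus_mul_le (hc _) (show Continuous fun x => γ * ‖gradient w x‖ + w x from
      (hgc.const_mul γ).add hwc)
      (fun x => Real.rpow_nonneg (hpos x).le _)
      (fun x => add_nonneg (mul_nonneg (by linarith) (norm_nonneg _)) (hpos x).le)
      (p := 2) (q := 2) (by rw [Real.holderConjugate_iff]; norm_num)).trans ?_
    have e3 : ∀ x, (w x ^ (γ - 1)) ^ (2 : ℝ) = w x ^ B := fun x => by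
      rw [← Real.rpow_mul (hpos x).le]; congr 1; rw [hB]; ring
    simp only [e3]
    refine mul_le_mul_of_nonneg_left (Real.rpow_le_rpow (integral_torus_nonneg fun x =>
      Real.rpow_nonneg (add_nonneg (mul_nonneg (by linarith) (norm_nonneg _)) (hpos x).le) _)
      ?_ (by norm_num))
      (Real.rpow_nonneg (integral_torus_nonneg fun x => Real.rpow_nonneg (hpos x).le _) _)
    rw [hZ, ← integral_const_mul]
    simp only [Real.rpow_two]
    refine integral_torus_mono (by fun_prop) (by fun_prop) fun x => ?_
    nlinarith [sq_nonneg (γ * ‖gradient w x‖ - w x), sq_nonneg (w x),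
      mul_nonneg (sub_nonneg.2 (one_le_pow₀ hγ1 (n := 2))) (sq_nonneg (w x))]
  have h3 : ∫ x, w x ^ B ∂(torusMeasure d) ≤ S ^ (2 / d : ℝ) * X ^ ((d - 2) / d : ℝ) := by
    have := integral_rpow_interpolate hwc hpos σ ρ (t := (d - 2) / d)
      (div_nonneg (by linarith) hd0.le) (by rw [div_le_one hd0]; linarith)
    rw [hBint] at this
    convert this using 3
    field_simp
    ring
  have hB0 : 0 ≤ ∫ x, w x ^ B ∂(torusMeasure d) :=
    integral_torus_nonneg fun x => Real.rpow_nonneg (hpos x).le _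
  have hY0 : 0 ≤ S ^ (2 / d : ℝ) * X ^ ((d - 2) / d : ℝ) * (2 * γ ^ 2 * Z) := by positivity
  have h4 : X ≤ C * (S ^ (2 / d : ℝ) * X ^ ((d - 2) / d : ℝ) * (2 * γ ^ 2 * Z))
      ^ (d / (2 * (d - 1)) : ℝ) := by
    refine h1.trans (mul_le_mul_of_nonneg_left ?_ hC0.le)
    refine (Real.rpow_le_rpow (integral_torus_nonneg fun x => mul_nonneg
      (Real.rpow_nonneg (hpos x).le _)
      (add_nonneg (mul_nonneg (by linarith) (norm_nonneg _)) (hpos x).le)) h2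
      (by positivity)).trans ?_
    rw [← Real.mul_rpow hB0 (by positivity), ← Real.rpow_mul (by positivity)]
    rw [show (1 / 2 : ℝ) * (d / (d - 1)) = d / (2 * (d - 1)) by field_simp]
    exact Real.rpow_le_rpow (by positivity) (mul_le_mul_of_nonneg_right h3 (by positivity))
      (by positivity)
  have h5 : X ^ (2 * (d - 1) / d : ℝ) ≤ C ^ (2 * (d - 1) / d : ℝ) *
      (S ^ (2 / d : ℝ) * X ^ ((d - 2) / d : ℝ) * (2 * γ ^ 2 * Z)) := by
    refine (Real.rpow_le_rpow hX0.le h4 (by positivity)).trans (le_of_eq ?_)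
    rw [Real.mul_rpow hC0.le (Real.rpow_nonneg hY0 _), ← Real.rpow_mul hY0]
    rw [show (d / (2 * (d - 1)) : ℝ) * (2 * (d - 1) / d) = 1 by field_simp, Real.rpow_one]
  -- The power of X created by the interpolation is split off on the left and cancelled, leaving X
  -- to the first power.
  have h6 : X ^ (2 * (d - 1) / d : ℝ) = X * X ^ ((d - 2) / d : ℝ) := by
    rw [← Real.rpow_one_add' hX0.le]
    · congr 1; field_simp; ring
    · have : (0 : ℝ) ≤ (d - 2) / d := div_nonneg (by linarith) hd0.le
      linarith
  rw [h6] at h5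
  refine le_of_mul_le_mul_right (h5.trans (le_of_eq ?_)) (Real.rpow_pos_of_pos hX0 ((d - 2) / d))
  ring

end Sobolev

end MFG

namespace MFG

/-! ### Mollification -/

section Mollify

variable {d : ℕ}

/-- Convolution on `ℝ^d` with a kernel. -/
noncomputable def kconv (k f : E d → ℝ) (x : E d) : ℝ := ∫ y, k y * f (x - y)

theorem IsMollifier.scale {η : E d → ℝ} (hη : IsMollifier η) {ε : ℝ} (hε : 0 < ε) :
    IsMollifier (fun y => (ε ^ d)⁻¹ * η (ε⁻¹ • y)) where
  smooth := contDiff_const.mul (hη.smooth.comp (contDiff_const_smul _))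
  compact := (hη.compact.comp_smul (inv_ne_zero hε.ne')).mul_left
  nonneg x := mul_nonneg (by positivity) (hη.nonneg _)
  even x := by simp only [smul_neg, hη.even]
  mass := by
    rw [integral_const_mul, Measure.integral_comp_smul]
    simp [hη.mass, abs_of_pos hε, hε.ne']

variable {k : E d → ℝ}

theorem IsMollifier.integrable (hk : IsMollifier k) : Integrable k :=
  hk.smooth.continuous.integrable_of_hasCompactSupport hk.compact

theorem IsMollifier.integrable_mul (hk : IsMollifier k) {f : E d → ℝ} (hf : Continuous f) :
    Integrable (fun y => k y * f y) :=
  (hk.smooth.continuous.mul hf).integrable_of_hasCompactSupport hk.compact.mul_right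

theorem IsMollifier.contDiff_kconv (hk : IsMollifier k) {f : E d → ℝ} (hf : Continuous f) :
    ContDiff ℝ ∞ (kconv k f) :=
  hk.compact.contDiff_convolution_left (ContinuousLinearMap.lsmul ℝ ℝ) hk.smooth
    (μ := volume) hf.locallyIntegrable

theorem isPeriodic_kconv {f : E d → ℝ} (hf : IsPeriodic f) : IsPeriodic (kconv k f) := fun x i => by
  unfold kconv
  simp only [add_sub_right_comm, hf _ i]

theorem IsMollifier.kconv_mono (hk : IsMollifier k) {f g : E d → ℝ} (hf : Continuous f)
    (hg : Continuous g) {x : E d} (h : ∀ y, f y ≤ g y) : kconv k f x ≤ kconv k g x :=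
  integral_mono (hk.integrable_mul (hf.comp (continuous_sub_left x)))
    (hk.integrable_mul (hg.comp (continuous_sub_left x)))
    fun y => mul_le_mul_of_nonneg_left (h _) (hk.nonneg y)

theorem IsMollifier.kconv_const (hk : IsMollifier k) (c : ℝ) (x : E d) :
    kconv k (fun _ => c) x = c := by
  rw [kconv, integral_mul_const, hk.mass, one_mul]

/-- Self-adjointness of convolution with an even kernel: exchange the integrals, translate x by y,
then replace y by -y. Periodicity supplies the translation invariance and the bounds that justify
Fubini. -/
theorem IsMollifier.integral_kconv_mul (hk : IsMollifier k) {f h : E d → ℝ} (hf : Continuous f)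
    (hh : Continuous h) (pf : IsPeriodic f) (ph : IsPeriodic h) :
    ∫ x, kconv k f x * h x ∂(torusMeasure d) = ∫ x, f x * kconv k h x ∂(torusMeasure d) := by
  obtain ⟨A, hA0, hA⟩ := pf.exists_bound hf
  obtain ⟨B, hB0, hB⟩ := ph.exists_bound hh
  have hkc := hk.smooth.continuous
  have hint : ∀ (a b : E d × E d → E d), Continuous a → Continuous b →
      Integrable (fun z : E d × E d => k z.2 * (f (a z) * h (b z)))
        ((torusMeasure d).prod volume) := fun a b ha hb => by
    have h1 : Integrable (fun z : E d × E d => (A * B) * ‖k z.2‖)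
        ((torusMeasure d).prod volume) :=
      (integrable_const (A * B)).mul_prod hk.integrable.norm
    refine h1.mono' (by fun_prop) (Eventually.of_forall fun z => ?_)
    rw [norm_mul, norm_mul, mul_comm]
    exact mul_le_mul_of_nonneg_right
      (mul_le_mul (hA _) (hB _) (norm_nonneg _) hA0) (norm_nonneg _)
  calc ∫ x, kconv k f x * h x ∂(torusMeasure d)
      = ∫ x, (∫ y, k y * (f (x - y) * h x)) ∂(torusMeasure d) := by
        simp only [kconv, ← integral_mul_const, mul_assoc]
    _ = ∫ y, (∫ x, k y * (f (x - y) * h x) ∂(torusMeasure d)) :=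
        integral_integral_swap (hint (fun z => z.1 - z.2) (fun z => z.1) (by fun_prop)
          (by fun_prop))
    _ = ∫ y, (∫ x, k y * (f x * h (x + y)) ∂(torusMeasure d)) := by
        congr 1 with y
        rw [integral_const_mul, integral_const_mul]
        congr 1
        have := ((pf.comp_add (-y)).mul ph).integral_comp_add y
        simpa [sub_eq_add_neg] using this.symm
    _ = ∫ y, (∫ x, k y * (f x * h (x - y)) ∂(torusMeasure d)) := by
        rw [← integral_neg_eq_self]
        simp only [hk.even, ← sub_eq_add_neg]
    _ = ∫ x, (∫ y, k y * (f x * h (x - y))) ∂(torusMeasure d) :=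
        (integral_integral_swap (hint (fun z => z.1) (fun z => z.1 - z.2) (by fun_prop)
          (by fun_prop))).symm
    _ = ∫ x, f x * kconv k h x ∂(torusMeasure d) := by
        simp only [kconv, ← integral_const_mul, mul_left_comm]

theorem IsMollifier.pd_kconv (hk : IsMollifier k) {f : E d → ℝ} (hf : ContDiff ℝ ∞ f)
    (pf : IsPeriodic f) (i : Fin d) (x : E d) :
    pd i (kconv k f) x = kconv k (pd i f) x := by
  have hc := (contDiff_pd hf i).continuous
  obtain ⟨C, hC0, hC⟩ := (pf.pd i).exists_bound hc
  have h1 : HasDerivAt (fun s : ℝ => kconv k f (x + s • ev i)) (pd i (kconv k f) x) 0 := by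
    simpa using hasDerivAt_line (i := i) (x := x) (s := 0)
      ((hk.contDiff_kconv hf.continuous).differentiable (by simp)).differentiableAt
  have hcont : ∀ {g : E d → ℝ}, Continuous g → ∀ s : ℝ,
      Continuous fun y : E d => g (x + s • ev i - y) := fun hg s => by fun_prop
  have h2 := (hasDerivAt_integral_of_dominated_loc_of_deriv_le (μ := (volume : Measure (E d)))
    (F := fun (s : ℝ) y => k y * f (x + s • ev i - y))
    (F' := fun (s : ℝ) y => k y * pd i f (x + s • ev i - y)) (x₀ := 0) (s := univ)
    (bound := fun y => C * ‖k y‖) univ_mem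
    (Eventually.of_forall fun s =>
      (hk.integrable_mul (hcont hf.continuous s)).aestronglyMeasurable)
    (hk.integrable_mul (hcont hf.continuous 0))
    (hk.integrable_mul (hcont hc 0)).aestronglyMeasurable
    (Eventually.of_forall fun y s _ => by
      rw [norm_mul, mul_comm]
      exact mul_le_mul_of_nonneg_right (hC _) (norm_nonneg _))
    (hk.integrable.norm.const_mul C)
    (Eventually.of_forall fun y s _ => by
      have h := hasDerivAt_line (f := f) (i := i) (x := x - y) (s := s)
        (hf.differentiable (by simp)).differentiableAt
      simp only [sub_add_eq_add_sub] at h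
      exact h.const_mul (k y))).2
  have h3 := h1.unique h2
  simpa [kconv] using h3

/-- Jensen's inequality: z^p lies above its tangent line at a = (k * f)(x), and averaging the
tangent against the unit-mass kernel returns a^p. -/
theorem IsMollifier.kconv_rpow_le (hk : IsMollifier k) {f : E d → ℝ} (hf : Continuous f)
    (pos : ∀ x, 0 < f x) {p : ℝ} (hp : 1 ≤ p) {x : E d} (hx : 0 < kconv k f x) :
    kconv k f x ^ p ≤ kconv k (fun y => f y ^ p) x := by
  set a := kconv k f x with ha
  have hfp : Continuous fun y => f y ^ p := hf.rpow_const fun y => Or.inl (pos y).ne'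
  have tangent : ∀ y, a ^ p + p * a ^ (p - 1) * (f y - a) ≤ f y ^ p := fun y => by
    -- Bernoulli's inequality for f(y)/a, multiplied by a^p, is the tangent-line inequality.
    have hb := one_add_mul_self_le_rpow_one_add (s := f y / a - 1)
      (by linarith [div_pos (pos y) hx]) hp
    rw [add_sub_cancel, Real.div_rpow (pos y).le hx.le, le_div_iff₀ (Real.rpow_pos_of_pos hx p)]
      at hb
    refine le_trans (le_of_eq ?_) hb
    have : a ^ p = a ^ (p - 1) * a := by rw [← Real.rpow_add_one hx.ne', sub_add_cancel]
    rw [this]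
    field_simp
  have hlin : kconv k (fun y => a ^ p + p * a ^ (p - 1) * (f y - a)) x = a ^ p := by
    have e : ∀ y, k y * (a ^ p + p * a ^ (p - 1) * (f (x - y) - a)) =
        (a ^ p - p * a ^ (p - 1) * a) * k y + p * a ^ (p - 1) * (k y * f (x - y)) := fun y => by
      ring
    have hi : Integrable fun y => k y * f (x - y) :=
      hk.integrable_mul (hf.comp (continuous_sub_left x))
    simp only [kconv, e]
    rw [integral_add (hk.integrable.const_mul _) (hi.const_mul _), integral_const_mul,
      integral_const_mul, hk.mass]
    change _ + p * a ^ (p - 1) * kconv k f x = _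
    rw [← ha]; ring
  rw [← hlin]
  exact hk.kconv_mono (by fun_prop) hfp tangent

/-! ### The mollification at scale `ε ≥ 0` -/

variable {η : E d → ℝ} {ε : ℝ}

theorem mollify_zero (f : E d → ℝ) : mollify η 0 f = f := by ext; simp [mollify]

theorem mollify_eq_kconv (hε : 0 < ε) (f : E d → ℝ) :
    mollify η ε f = kconv (fun y => (ε ^ d)⁻¹ * η (ε⁻¹ • y)) f := by
  ext; simp [mollify, hε.ne', kconv]

theorem IsMollifier.continuous_mollify (hη : IsMollifier η) (hε : 0 ≤ ε) {f : E d → ℝ}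
    (hf : Continuous f) : Continuous (mollify η ε f) := by
  rcases hε.eq_or_lt with rfl | hε
  · rwa [mollify_zero]
  · rw [mollify_eq_kconv hε]
    exact ((hη.scale hε).contDiff_kconv hf).continuous

theorem IsMollifier.contDiff_mollify (hη : IsMollifier η) (hε : 0 ≤ ε) {f : E d → ℝ}
    (hf : ContDiff ℝ ∞ f) : ContDiff ℝ ∞ (mollify η ε f) := by
  rcases hε.eq_or_lt with rfl | hε
  · rwa [mollify_zero]
  · rw [mollify_eq_kconv hε]
    exact (hη.scale hε).contDiff_kconv hf.continuous

theorem isPeriodic_mollify (hε : 0 ≤ ε) {f : E d → ℝ} (hf : IsPeriodic f) :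
    IsPeriodic (mollify η ε f) := by
  rcases hε.eq_or_lt with rfl | hε
  · rwa [mollify_zero]
  · rw [mollify_eq_kconv hε]
    exact isPeriodic_kconv hf

theorem IsMollifier.mollify_mono (hη : IsMollifier η) (hε : 0 ≤ ε) {f g : E d → ℝ}
    (hf : Continuous f) (hg : Continuous g) (h : ∀ y, f y ≤ g y) (x : E d) :
    mollify η ε f x ≤ mollify η ε g x := by
  rcases hε.eq_or_lt with rfl | hε
  · simpa only [mollify_zero] using h x
  · simp only [mollify_eq_kconv hε]
    exact (hη.scale hε).kconv_mono hf hg h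

theorem IsMollifier.mollify_const (hη : IsMollifier η) (hε : 0 ≤ ε) (c : ℝ) (x : E d) :
    mollify η ε (fun _ => c) x = c := by
  rcases hε.eq_or_lt with rfl | hε
  · rw [mollify_zero]
  · rw [mollify_eq_kconv hε, (hη.scale hε).kconv_const]

theorem IsMollifier.mollify_pos (hη : IsMollifier η) (hε : 0 ≤ ε) {f : E d → ℝ}
    (hf : Continuous f) {a : ℝ} (ha : 0 < a) (h : ∀ y, a ≤ f y) (x : E d) :
    0 < mollify η ε f x :=
  ha.trans_le ((hη.mollify_const hε a x).ge.trans (hη.mollify_mono hε continuous_const hf h x))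

theorem IsMollifier.integral_mollify_mul (hη : IsMollifier η) (hε : 0 ≤ ε) {f h : E d → ℝ}
    (hf : Continuous f) (hh : Continuous h) (pf : IsPeriodic f) (ph : IsPeriodic h) :
    ∫ x, mollify η ε f x * h x ∂(torusMeasure d) =
      ∫ x, f x * mollify η ε h x ∂(torusMeasure d) := by
  rcases hε.eq_or_lt with rfl | hε
  · simp only [mollify_zero]
  · simp only [mollify_eq_kconv hε]
    exact (hη.scale hε).integral_kconv_mul hf hh pf ph

theorem IsMollifier.pd_mollify (hη : IsMollifier η) (hε : 0 ≤ ε) {f : E d → ℝ}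
    (hf : ContDiff ℝ ∞ f) (pf : IsPeriodic f) (i : Fin d) :
    pd i (mollify η ε f) = mollify η ε (pd i f) := by
  rcases hε.eq_or_lt with rfl | hε
  · simp only [mollify_zero]
  · simp only [mollify_eq_kconv hε]
    exact funext fun x => (hη.scale hε).pd_kconv hf pf i x

/-- Mollification does not increase the `L^p` norm. -/
theorem IsMollifier.integral_mollify_rpow_le (hη : IsMollifier η) (hε : 0 ≤ ε) {f : E d → ℝ}
    (hf : Continuous f) (pf : IsPeriodic f) {a : ℝ} (ha : 0 < a) (h : ∀ y, a ≤ f y) {p : ℝ}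
    (hp : 1 ≤ p) :
    ∫ x, mollify η ε f x ^ p ∂(torusMeasure d) ≤ ∫ x, f x ^ p ∂(torusMeasure d) := by
  have pos : ∀ y, 0 < f y := fun y => ha.trans_le (h y)
  have hm := hη.mollify_pos hε hf ha h
  have hfp : Continuous fun x => f x ^ p := hf.rpow_const fun y => Or.inl (pos y).ne'
  have hle : ∀ x, mollify η ε f x ^ p ≤ mollify η ε (fun y => f y ^ p) x := fun x => by
    rcases hε.eq_or_lt with rfl | hε
    · simp only [mollify_zero]; exact le_rfl
    · have := hm x
      simp only [mollify_eq_kconv hε] at this ⊢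
      exact (hη.scale hε).kconv_rpow_le hf pos hp this
  have h1 := integral_torus_mono ((hη.continuous_mollify hε hf).rpow_const
    fun y => Or.inl (hm y).ne') (hη.continuous_mollify hε hfp) hle
  have h2 := hη.integral_mollify_mul hε hfp (continuous_const (y := (1 : ℝ)))
    (pf.comp fun z => z ^ p) (isPeriodic_const 1)
  simp only [mul_one, hη.mollify_const hε] at h2
  rwa [h2] at h1

/-! ### The regularised power nonlinearity -/

variable {g : ℝ → ℝ} {α : ℝ}

/-- The form of g is known only on [0,∞); a positive lower bound on f survives mollification, so
only that range is met. -/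
theorem gEps_eq (hη : IsMollifier η) (hε : 0 ≤ ε) (hg : PowerNonlinearity g α) {f : E d → ℝ}
    (hf : Continuous f) {a : ℝ} (ha : 0 < a) (h : ∀ y, a ≤ f y) :
    gEps η g ε f = mollify η ε (fun x => mollify η ε f x ^ α) := by
  unfold gEps
  congr 1 with x
  exact hg.eq_rpow _ (hη.mollify_pos hε hf ha h x).le

theorem continuous_mollify_rpow (hη : IsMollifier η) (hε : 0 ≤ ε) {f : E d → ℝ}
    (hf : Continuous f) {a : ℝ} (ha : 0 < a) (h : ∀ y, a ≤ f y) (α : ℝ) :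
    Continuous fun x => mollify η ε f x ^ α :=
  (hη.continuous_mollify hε hf).rpow_const fun y => Or.inl (hη.mollify_pos hε hf ha h y).ne'

theorem continuous_gEps (hη : IsMollifier η) (hε : 0 ≤ ε) (hg : PowerNonlinearity g α)
    {f : E d → ℝ} (hf : Continuous f) {a : ℝ} (ha : 0 < a) (h : ∀ y, a ≤ f y) :
    Continuous (gEps η g ε f) := by
  rw [gEps_eq hη hε hg hf ha h]
  exact hη.continuous_mollify hε (continuous_mollify_rpow hη hε hf ha h α)

theorem gEps_nonneg (hη : IsMollifier η) (hε : 0 ≤ ε) (hg : PowerNonlinearity g α)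
    {f : E d → ℝ} (hf : Continuous f) {a : ℝ} (ha : 0 < a) (h : ∀ y, a ≤ f y) (x : E d) :
    0 ≤ gEps η g ε f x := by
  rw [gEps_eq hη hε hg hf ha h]
  refine (hη.mollify_const hε 0 x).ge.trans (hη.mollify_mono hε continuous_const
    (continuous_mollify_rpow hη hε hf ha h α) (fun y => ?_) x)
  exact Real.rpow_nonneg (hη.mollify_pos hε hf ha h y).le _

/-- The outer mollification moves onto the test function. With h = f or a derivative of f, both
factors are then expressed through the single function η_ε * f, and this is where the signs come
from. -/
theorem integral_gEps_mul (hη : IsMollifier η) (hε : 0 ≤ ε) (hg : PowerNonlinearity g α)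
    {f h : E d → ℝ} (hf : Continuous f) (pf : IsPeriodic f) {a : ℝ} (ha : 0 < a)
    (hle : ∀ y, a ≤ f y) (hh : Continuous h) (ph : IsPeriodic h) :
    ∫ x, gEps η g ε f x * h x ∂(torusMeasure d) =
      ∫ x, mollify η ε f x ^ α * mollify η ε h x ∂(torusMeasure d) := by
  rw [gEps_eq hη hε hg hf ha hle]
  exact hη.integral_mollify_mul hε (continuous_mollify_rpow hη hε hf ha hle α) hh
    ((isPeriodic_mollify hε pf).comp fun z => z ^ α) ph

/-- Testing the nonlinearity against a second derivative gives a non-positive quantity. -/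
theorem integral_gEps_mul_pd_pd_nonpos (hη : IsMollifier η) (hε : 0 ≤ ε)
    (hg : PowerNonlinearity g α) {f : E d → ℝ} (hf : ContDiff ℝ ∞ f) (pf : IsPeriodic f) {a : ℝ}
    (ha : 0 < a) (hle : ∀ y, a ≤ f y) (i : Fin d) :
    ∫ x, gEps η g ε f x * pd i (pd i f) x ∂(torusMeasure d) ≤ 0 := by
  have hpos := hη.mollify_pos hε hf.continuous ha hle
  have hv := hη.contDiff_mollify hε hf
  have pv := isPeriodic_mollify (η := η) hε pf
  -- With v = η_ε * f the integral becomes ∫ v^α ∂_i∂_i v = -α ∫ v^{α-1} (∂_i v)².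
  rw [integral_gEps_mul hη hε hg hf.continuous pf ha hle (contDiff_pd (contDiff_pd hf i) i).continuous
    ((pf.pd i).pd i), ← hη.pd_mollify hε (contDiff_pd hf i) (pf.pd i), ← hη.pd_mollify hε hf pf,
    integral_mul_pd (hv.rpow_const_of_ne fun x => (hpos x).ne') (contDiff_pd hv i)
      (pv.comp fun z => z ^ α) (pv.pd i), neg_nonpos]
  refine integral_torus_nonneg fun x => ?_
  rw [pd_comp i (Real.hasDerivAt_rpow_const (p := α) (Or.inl (hpos x).ne'))
    (hv.differentiable (by simp)).differentiableAt, mul_assoc, ← sq]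
  exact mul_nonneg (mul_nonneg hg.pos.le (Real.rpow_nonneg (hpos x).le _)) (sq_nonneg _)

/-- The `L^p` norm of the nonlinearity is controlled by a power of the `L^{pα}` norm. -/
theorem integral_gEps_rpow_le (hη : IsMollifier η) (hε : 0 ≤ ε) (hg : PowerNonlinearity g α)
    {f : E d → ℝ} (hf : Continuous f) (pf : IsPeriodic f) {a : ℝ} (ha : 0 < a)
    (hle : ∀ y, a ≤ f y) {p : ℝ} (hp : 1 ≤ p) (hpα : 1 ≤ α * p) :
    ∫ x, gEps η g ε f x ^ p ∂(torusMeasure d) ≤ ∫ x, f x ^ (α * p) ∂(torusMeasure d) := by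
  have hpos := hη.mollify_pos hε hf ha hle
  rw [gEps_eq hη hε hg hf ha hle]
  have hlow : ∀ y, a ≤ mollify η ε f y := fun y =>
    (hη.mollify_const hε a y).ge.trans (hη.mollify_mono hε continuous_const hf hle y)
  refine (hη.integral_mollify_rpow_le hε (continuous_mollify_rpow hη hε hf ha hle α)
    ((isPeriodic_mollify hε pf).comp fun z => z ^ α) (Real.rpow_pos_of_pos ha α)
    (fun y => Real.rpow_le_rpow ha.le (hlow y) hg.pos.le) hp).trans ?_
  refine le_trans (le_of_eq ?_) (hη.integral_mollify_rpow_le hε hf pf ha hle hpα)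
  exact integral_congr_ae (Eventually.of_forall fun x => (Real.rpow_mul (hpos x).le α p).symm)

end Mollify

end MFG

namespace MFG

/-! ### Calculus for functions of `(x, p)` -/

section Hamiltonian

variable {d : ℕ}

/-- Joint smoothness of a function of `(x, p)`. -/
abbrev JointSmooth (Φ : E d → E d → ℝ) : Prop := ContDiff ℝ ∞ (fun z : E d × E d => Φ z.1 z.2)

theorem sum_smul_ev (v : E d) : ∑ k, v k • ev k = v := by
  ext j
  simp [Pi.single_apply]

theorem fderiv_apply_eq_sum (f : E d → ℝ) (x v : E d) : fderiv ℝ f x v = ∑ k, v k * pd k f x := by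
  conv_lhs => rw [← sum_smul_ev v]
  simp [pd]

variable {Φ : E d → E d → ℝ}

theorem JointSmooth.hasFDerivAt (hΦ : JointSmooth Φ) (z : E d × E d) :
    HasFDerivAt (fun z : E d × E d => Φ z.1 z.2)
      (fderiv ℝ (fun z : E d × E d => Φ z.1 z.2) z) z :=
  (hΦ.differentiable (by simp)).differentiableAt.hasFDerivAt

theorem JointSmooth.slice_left (hΦ : JointSmooth Φ) (p : E d) : ContDiff ℝ ∞ fun x => Φ x p :=
  hΦ.comp (contDiff_id.prodMk contDiff_const)

theorem JointSmooth.slice_right (hΦ : JointSmooth Φ) (x : E d) : ContDiff ℝ ∞ fun p => Φ x p :=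
  hΦ.comp (contDiff_const.prodMk contDiff_id)

theorem JointSmooth.pd_left_eq (hΦ : JointSmooth Φ) (i : Fin d) (x p : E d) :
    pd i (fun y => Φ y p) x = fderiv ℝ (fun z : E d × E d => Φ z.1 z.2) (x, p) (ev i, 0) := by
  have h := HasFDerivAt.comp (f := fun y => (y, p)) x (hΦ.hasFDerivAt (x, p))
    (hasFDerivAt_prodMk_left x p)
  exact pd_eq_of_hasFDerivAt h i

theorem JointSmooth.pd_right_eq (hΦ : JointSmooth Φ) (i : Fin d) (x p : E d) :
    pd i (fun q => Φ x q) p = fderiv ℝ (fun z : E d × E d => Φ z.1 z.2) (x, p) (0, ev i) := by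
  have h := HasFDerivAt.comp (f := fun q => (x, q)) p (hΦ.hasFDerivAt (x, p))
    (hasFDerivAt_prodMk_right x p)
  exact pd_eq_of_hasFDerivAt h i

theorem JointSmooth.fderiv_apply (hΦ : JointSmooth Φ) (v : E d × E d) :
    JointSmooth fun x p => fderiv ℝ (fun z : E d × E d => Φ z.1 z.2) (x, p) v :=
  (hΦ.fderiv_right (m := ∞) (by simp)).clm_apply contDiff_const

theorem JointSmooth.pd_left (hΦ : JointSmooth Φ) (i : Fin d) :
    JointSmooth fun x p => pd i (fun y => Φ y p) x := by
  simp only [hΦ.pd_left_eq]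
  exact hΦ.fderiv_apply _

theorem JointSmooth.pd_right (hΦ : JointSmooth Φ) (i : Fin d) :
    JointSmooth fun x p => pd i (fun q => Φ x q) p := by
  simp only [hΦ.pd_right_eq]
  exact hΦ.fderiv_apply _

/-- Schwarz's theorem on the product space, applied to the directions (e_i, 0) and (0, e_j). It
merges the two mixed terms in the Laplacian of H(x, Du) into one with factor 2. -/
theorem JointSmooth.pd_left_pd_right (hΦ : JointSmooth Φ) (i j : Fin d) (x p : E d) :
    pd i (fun y => pd j (fun q => Φ y q) p) x = pd j (fun q => pd i (fun y => Φ y q) x) p := by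
  have hs : IsSymmSndFDerivAt ℝ (fun z : E d × E d => Φ z.1 z.2) (x, p) :=
    (hΦ.contDiffAt.of_le (m := 2) (WithTop.coe_le_coe.2 le_top)).isSymmSndFDerivAt (n := 2)
      (by simp)
  have hd : DifferentiableAt ℝ (fderiv ℝ (fun z : E d × E d => Φ z.1 z.2)) (x, p) :=
    ((hΦ.fderiv_right (m := ∞) (by simp)).differentiable (by simp)).differentiableAt
  have key : ∀ v w : E d × E d,
      fderiv ℝ (fun z => fderiv ℝ (fun z : E d × E d => Φ z.1 z.2) z v) (x, p) w =
        fderiv ℝ (fderiv ℝ (fun z : E d × E d => Φ z.1 z.2)) (x, p) w v := fun v w => by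
    rw [(hd.hasFDerivAt.clm_apply (hasFDerivAt_const v (x, p))).fderiv]
    simp
  simp only [hΦ.pd_left_eq, hΦ.pd_right_eq]
  rw [(hΦ.fderiv_apply _).pd_left_eq, (hΦ.fderiv_apply _).pd_right_eq]
  simp only [Prod.mk.eta, key]
  exact hs _ _

/-- Chain rule for `x ↦ Φ(x, v(x))`. -/
theorem JointSmooth.pd_comp (hΦ : JointSmooth Φ) {v : E d → E d} (hv : ContDiff ℝ ∞ v) (j : Fin d)
    (x : E d) : pd j (fun y => Φ y (v y)) x = pd j (fun y => Φ y (v x)) x +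
      ∑ k, pd k (fun q => Φ x q) (v x) * pd j (fun y => v y k) x := by
  have hvx : HasFDerivAt v (fderiv ℝ v x) x :=
    (hv.differentiable (by simp)).differentiableAt.hasFDerivAt
  have h := (hΦ.hasFDerivAt (x, v x)).comp x ((hasFDerivAt_id x).prodMk hvx)
  have hk : ∀ k, pd j (fun y => v y k) x = fderiv ℝ v x (ev j) k := fun k =>
    pd_eq_of_hasFDerivAt (((EuclideanSpace.proj k : E d →L[ℝ] ℝ).hasFDerivAt).comp x hvx) j
  refine (pd_eq_of_hasFDerivAt h j).trans ?_
  rw [hΦ.pd_left_eq]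
  have e : ((ContinuousLinearMap.id ℝ (E d)).prod (fderiv ℝ v x)) (ev j) =
      (ev j, 0) + ∑ k, fderiv ℝ v x (ev j) k • ((0 : E d), ev k) := by
    refine Prod.ext ?_ ?_
    · simp [Prod.fst_sum]
    · simp [Prod.snd_sum, sum_smul_ev]
  rw [ContinuousLinearMap.comp_apply, e, map_add, map_sum]
  congr 1
  refine Finset.sum_congr rfl fun k _ => ?_
  rw [map_smul, hΦ.pd_right_eq, hk, smul_eq_mul, mul_comm]

theorem JointSmooth.contDiff_comp (hΦ : JointSmooth Φ) {v : E d → E d} (hv : ContDiff ℝ ∞ v) :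
    ContDiff ℝ ∞ fun x => Φ x (v x) := hΦ.comp (contDiff_id.prodMk hv)

theorem JointSmooth.slabSmooth_comp (hΦ : JointSmooth Φ) {T : ℝ} {v : ℝ → E d → E d}
    (hv : SlabSmooth T v) : SlabSmooth T fun t x => Φ x (v t x) :=
  hΦ.comp_contDiffOn (contDiff_snd.contDiffOn.prodMk hv)

theorem isPeriodic_comp_joint (hp : ∀ p, IsPeriodic fun x => Φ x p) {v : E d → E d}
    (hv : IsPeriodic v) : IsPeriodic fun x => Φ x (v x) := fun x i => by
  simp only [hv x i, hp _ x i]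

theorem isPeriodic_pd_right (hp : ∀ p, IsPeriodic fun x => Φ x p) (i : Fin d) (p : E d) :
    IsPeriodic fun x => pd i (fun q => Φ x q) p := fun x j => by
  have : (fun q => Φ (x + EuclideanSpace.single j 1) q) = fun q => Φ x q :=
    funext fun q => hp q x j
  simp only [this]

theorem contDiff_gradient {u : E d → ℝ} (hu : ContDiff ℝ ∞ u) : ContDiff ℝ ∞ (gradient u) := by
  rw [contDiff_euclidean]
  intro i
  simp only [gradient_apply]
  exact contDiff_pd hu i

theorem isPeriodic_gradient {u : E d → ℝ} (hu : IsPeriodic u) : IsPeriodic (gradient u) :=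
  fun x i => by
    ext j
    simp only [gradient_apply]
    exact hu.pd j x i

/-- The Hessian matrix. -/
noncomputable def hess (u : E d → ℝ) (x : E d) : Matrix (Fin d) (Fin d) ℝ :=
  Matrix.of fun i j => pd i (pd j u) x

theorem hess_isSymm {u : E d → ℝ} (hu : ContDiff ℝ ∞ u) (x : E d) : (hess u x).IsSymm := by
  ext i j
  exact pd_comm hu j i x

variable {H : E d → E d → ℝ}

theorem DpH_apply (x p : E d) (k : Fin d) : DpH H x p k = pd k (fun q => H x q) p :=
  gradient_apply _ _ _

/-- The divergence of `x ↦ D_p H(x, Du(x))`. -/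
theorem sum_pd_DpH (hH : JointSmooth H) {u : E d → ℝ} (hu : ContDiff ℝ ∞ u) (x : E d) :
    ∑ i, pd i (fun y => DpH H y (gradient u y) i) x =
      (D2xpH H x (gradient u x)).trace + (D2ppH H x (gradient u x) * hess u x).trace := by
  simp only [DpH_apply, Matrix.trace, Matrix.diag, Matrix.mul_apply]
  rw [Finset.sum_comm (s := Finset.univ) (t := Finset.univ)
    (f := fun i j => D2ppH H x (gradient u x) i j * hess u x j i), ← Finset.sum_add_distrib]
  refine Finset.sum_congr rfl fun i _ => ?_
  rw [(hH.pd_right i).pd_comp (contDiff_gradient hu) i x]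
  simp only [gradient_apply]
  rfl

/-- The Laplacian of `x ↦ H(x, Du(x))`. -/
theorem sum_pd_pd_hamiltonian (hH : JointSmooth H) {u : E d → ℝ} (hu : ContDiff ℝ ∞ u) (x : E d) :
    ∑ j, pd j (pd j (fun y => H y (gradient u y))) x =
      (D2xxH H x (gradient u x)).trace + 2 * (D2pxH H x (gradient u x) * hess u x).trace +
        (D2ppH H x (gradient u x) * hess u x ^ 2).trace +
        ∑ k, DpH H x (gradient u x) k * pd k (fun y => ∑ j, pd j (pd j u) y) x := by
  have hg := contDiff_gradient hu
  have hpp : ∀ k l, ContDiff ℝ ∞ (pd k (pd l u)) := fun k l => contDiff_pd (contDiff_pd hu l) k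
  have h1 : ∀ j, pd j (fun y => H y (gradient u y)) = fun y =>
      pd j (fun z => H z (gradient u y)) y +
        ∑ k, pd k (fun q => H y q) (gradient u y) * pd j (pd k u) y := fun j => funext fun y => by
    rw [hH.pd_comp hg]
    simp only [gradient_apply]
  have hdiff : ∀ {f : E d → ℝ}, ContDiff ℝ ∞ f → DifferentiableAt ℝ f x := fun hf =>
    (hf.differentiable (by simp)).differentiableAt
  have h2 : ∀ j, pd j (pd j (fun y => H y (gradient u y))) x =
      pd j (fun y => pd j (fun z => H z (gradient u x)) y) x +
      2 * ∑ l, pd l (fun q => pd j (fun y => H y q) x) (gradient u x) * pd j (pd l u) x +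
      ∑ k, ∑ l, pd l (fun q => pd k (fun q' => H x q') q) (gradient u x) * pd j (pd l u) x *
        pd j (pd k u) x +
      ∑ k, pd k (fun q => H x q) (gradient u x) * pd j (pd j (pd k u)) x := fun j => by
    have hb : ∀ k, ContDiff ℝ ∞ fun y => pd k (fun q => H y q) (gradient u y) := fun k =>
      (hH.pd_right k).contDiff_comp hg
    rw [h1 j, pd_add j (hdiff ((hH.pd_left j).contDiff_comp hg))
      (hdiff (ContDiff.sum fun k _ => (hb k).mul (hpp j k))),
      pd_sum j (fun k _ => hdiff ((hb k).mul (hpp j k))),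
      (hH.pd_left j).pd_comp hg]
    have h3 : ∀ k, pd j (fun y => pd k (fun q => H y q) (gradient u y) * pd j (pd k u) y) x =
        pd k (fun q => pd j (fun y => H y q) x) (gradient u x) * pd j (pd k u) x +
        (∑ l, pd l (fun q => pd k (fun q' => H x q') q) (gradient u x) * pd j (pd l u) x *
          pd j (pd k u) x) +
        pd k (fun q => H x q) (gradient u x) * pd j (pd j (pd k u)) x := fun k => by
      rw [pd_mul j (hdiff (hb k)) (hdiff (hpp j k)), (hH.pd_right k).pd_comp hg,
        hH.pd_left_pd_right, add_mul, Finset.sum_mul]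
      simp only [gradient_apply]
    simp only [h3, Finset.sum_add_distrib, gradient_apply]
    ring
  simp only [h2, Finset.sum_add_distrib]
  congr 1
  · congr 1
    · congr 1
      rw [← Finset.mul_sum]
      congr 1
      simp only [Matrix.trace, Matrix.diag, Matrix.mul_apply]
      rw [Finset.sum_comm]
      rfl
    · simp only [Matrix.trace, Matrix.diag, Matrix.mul_apply, sq, Finset.mul_sum]
      rw [Finset.sum_comm]
      rw [Finset.sum_comm (s := Finset.univ) (t := Finset.univ)
        (f := fun i j => ∑ k, D2ppH H x (gradient u x) i j * (hess u x j k * hess u x k i))]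
      refine Finset.sum_congr rfl fun k _ => ?_
      rw [Finset.sum_comm]
      refine Finset.sum_congr rfl fun l _ => Finset.sum_congr rfl fun j _ => ?_
      have : hess u x k j = pd j (pd k u) x := pd_comm hu k j x
      rw [this]
      simp only [D2ppH, hess, Matrix.of_apply]
      ring
  · rw [Finset.sum_comm]
    refine Finset.sum_congr rfl fun k _ => ?_
    rw [DpH_apply, pd_sum k fun j _ => hdiff (hpp j j), Finset.mul_sum]
    refine Finset.sum_congr rfl fun j _ => ?_
    congr 1
    -- Third derivatives are reordered so that ∂_k falls on the Laplacian of u, the form in which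
    -- they later cancel.
    have : pd j (pd k u) = pd k (pd j u) := funext fun y => pd_comm hu j k y
    rw [this]
    exact pd_comm (contDiff_pd hu j) j k x

/-- Convexity in `p` implies that `D²_pp H` is positive semi-definite. -/
theorem sum_D2ppH_nonneg (hH : JointSmooth H) (hc : ∀ x, ConvexOn ℝ univ (H x)) (x p v : E d) :
    0 ≤ ∑ l, ∑ k, D2ppH H x p l k * v k * v l := by
  have hline : ∀ s : ℝ, HasDerivAt (fun s : ℝ => p + s • v) v s := fun s => by
    simpa using ((hasDerivAt_id s).smul_const v).const_add p
  have hd : ∀ {f : E d → ℝ}, ContDiff ℝ ∞ f → ∀ s : ℝ,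
      HasDerivAt (fun s : ℝ => f (p + s • v)) (∑ k, v k * pd k f (p + s • v)) s := fun hf s => by
    rw [← fderiv_apply_eq_sum]
    exact (hf.differentiable (by simp)).differentiableAt.hasFDerivAt.comp_hasDerivAt s (hline s)
  have h1 := hd (hH.slice_right x)
  -- Along a line, convexity makes the first derivative monotone; the second derivative at 0 is the
  -- quadratic form evaluated at v.
  have hconv : ConvexOn ℝ univ fun s : ℝ => H x (p + s • v) := by
    have := (hc x).comp_affineMap (AffineMap.lineMap p (p + v) : ℝ →ᵃ[ℝ] E d)
    simpa [Function.comp_def, AffineMap.lineMap_apply, add_comm] using this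
  have hmono : Monotone (deriv fun s : ℝ => H x (p + s • v)) :=
    monotoneOn_univ.1 (hconv.monotoneOn_deriv fun s _ => (h1 s).differentiableAt)
  have e : (deriv fun s : ℝ => H x (p + s • v)) =
      fun s => ∑ k, v k * pd k (fun q => H x q) (p + s • v) := funext fun s => (h1 s).deriv
  have h2 : HasDerivAt (fun s : ℝ => ∑ k, v k * pd k (fun q => H x q) (p + s • v))
      (∑ k, v k * ∑ l, v l * pd l (pd k (fun q => H x q)) (p + (0 : ℝ) • v)) 0 :=
    HasDerivAt.fun_sum fun k _ =>
      (hd (contDiff_pd (hH.slice_right x) k) 0).const_mul (v k)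
  have h3 : 0 ≤ deriv (deriv fun s : ℝ => H x (p + s • v)) 0 := hmono.deriv_nonneg
  rw [e, h2.deriv] at h3
  refine h3.trans (le_of_eq ?_)
  simp only [Finset.mul_sum, zero_smul, add_zero]
  rw [Finset.sum_comm]
  refine Finset.sum_congr rfl fun l _ => Finset.sum_congr rfl fun k _ => ?_
  change _ = pd l (fun q => pd k (fun q' => H x q') q) p * v k * v l
  ring

theorem trace_D2ppH_mul_sq_nonneg (hH : JointSmooth H) (hc : ∀ x, ConvexOn ℝ univ (H x))
    (x p : E d) {M : Matrix (Fin d) (Fin d) ℝ} (hM : M.IsSymm) :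
    0 ≤ (D2ppH H x p * M ^ 2).trace := by
  have e : (D2ppH H x p * M ^ 2).trace =
      ∑ j, ∑ l, ∑ k, D2ppH H x p l k * M k j * M l j := by
    calc (D2ppH H x p * M ^ 2).trace
        = ∑ l, ∑ k, ∑ j, D2ppH H x p l k * M k j * M l j := by
          simp only [Matrix.trace, Matrix.diag, Matrix.mul_apply, sq, Finset.mul_sum]
          refine Finset.sum_congr rfl fun l _ => Finset.sum_congr rfl fun k _ =>
            Finset.sum_congr rfl fun j _ => ?_
          rw [← hM.apply j l]
          ring
      _ = ∑ l, ∑ j, ∑ k, D2ppH H x p l k * M k j * M l j :=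
          Finset.sum_congr rfl fun l _ => Finset.sum_comm
      _ = _ := Finset.sum_comm
  rw [e]
  exact Finset.sum_nonneg fun j _ => sum_D2ppH_nonneg hH hc x p (WithLp.toLp 2 fun k => M k j)

/-- Superlinear growth is uniform in `x`. -/
theorem HamiltonianBasic.exists_linear_lower_bound (hH : HamiltonianBasic H) {K : ℝ} (hK : 0 ≤ K) :
    ∃ C : ℝ, ∀ x p, K * ‖p‖ - C ≤ H x p := by
  have hHc : Continuous fun z : E d × E d => H z.1 z.2 := hH.smooth.continuous
  obtain ⟨C, hC⟩ : ∃ C : ℝ, ∀ x ∈ closure (unitCube d), ∀ p, K * ‖p‖ - C ≤ H x p := by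
    refine isCompact_closure_unitCube.induction_on
      (p := fun s => ∃ C : ℝ, ∀ x ∈ s, ∀ p, K * ‖p‖ - C ≤ H x p) ⟨0, by simp⟩ ?_ ?_ ?_
    · rintro s t hst ⟨C, hC⟩
      exact ⟨C, fun x hx => hC x (hst hx)⟩
    · rintro s t ⟨C, hC⟩ ⟨C', hC'⟩
      refine ⟨max C C', fun x hx p => ?_⟩
      rcases hx with hx | hx
      · linarith [hC x hx p, le_max_left C C']
      · linarith [hC' x hx p, le_max_right C C']
    · intro x₀ _
      -- Coercivity is only pointwise in x. This slope yields a strict gap H(x₀,p) - H(x₀,0) > K S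
      -- on a sphere of radius S ≥ 1, which persists for x near x₀ because the sphere is compact.
      have h1 := (hH.coercive x₀).eventually_ge_atTop (K + 1 + |H x₀ 0|)
      rw [← comap_norm_atTop, eventually_comap] at h1
      obtain ⟨R, hR⟩ := eventually_atTop.1 h1
      set S := max R 1
      have hS : 0 < S := lt_of_lt_of_le one_pos (le_max_right _ _)
      have h2 : ∀ p ∈ Metric.sphere (0 : E d) S, K * S < H x₀ p - H x₀ 0 := fun p hp => by
        rw [mem_sphere_zero_iff_norm] at hp
        have := hR S (le_max_left _ _) p hp
        rw [hp, le_div_iff₀ hS] at this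
        have h1S : 1 ≤ S := le_max_right _ _
        nlinarith [le_abs_self (H x₀ 0), abs_nonneg (H x₀ 0),
          mul_le_mul_of_nonneg_left h1S (abs_nonneg (H x₀ 0))]
      have h3 : ∀ᶠ x in 𝓝 x₀, ∀ p ∈ Metric.sphere (0 : E d) S, K * S < H x p - H x 0 := by
        refine (isCompact_sphere (0 : E d) S).eventually_forall_of_forall_eventually fun p hp => ?_
        have hc : Continuous fun z : E d × E d => H z.1 z.2 - H z.1 0 :=
          hHc.sub (hHc.comp (continuous_fst.prodMk continuous_const))
        exact hc.continuousAt.eventually (lt_mem_nhds (h2 p hp))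
      refine ⟨_, mem_nhdsWithin_of_mem_nhds h3, K * S, fun x hx p => ?_⟩
      have hx' : ∀ p ∈ Metric.sphere (0 : E d) S, K * S < H x p - H x 0 := hx
      rcases lt_or_ge ‖p‖ S with hp | hp
      · nlinarith [hH.one_le x p]
      · have hp0 : 0 < ‖p‖ := hS.trans_le hp
        have hq := hx' ((S / ‖p‖) • p) (by
          rw [mem_sphere_zero_iff_norm, norm_smul, Real.norm_of_nonneg (by positivity)]
          field_simp)
        have hle : S / ‖p‖ ≤ 1 := (div_le_one hp0).2 hp
        -- Convexity along the ray from 0 through p carries the gap from the sphere to every |p| ≥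
        -- S, with slope at least K.
        have hconv := (hH.strictConvex x).convexOn.2 (mem_univ p) (mem_univ 0)
          (div_nonneg hS.le hp0.le) (sub_nonneg.2 hle)
          (add_sub_cancel (S / ‖p‖) 1)
        simp only [smul_zero, add_zero, smul_eq_mul] at hconv
        have h4 : K * S < S / ‖p‖ * (H x p - H x 0) := by linarith
        rw [div_mul_eq_mul_div, lt_div_iff₀ hp0] at h4
        have h5 : K * ‖p‖ < H x p - H x 0 := by
          refine lt_of_mul_lt_mul_left ?_ hS.le
          linarith
        nlinarith [hH.one_le x 0]
  refine ⟨C, fun x p => ?_⟩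
  have hper : IsPeriodic fun x => H x := fun x i => funext fun p => hH.periodic p x i
  obtain ⟨y, hy, _, _, _, hxy⟩ := hper.exists_mem_unitCube x
  rw [← hxy]
  exact hC y (subset_closure hy) p

end Hamiltonian

end MFG

namespace MFG

/-! ### Basic properties of solutions -/

section Solution

variable {d : ℕ} {T α ε : ℝ} {H : E d → E d → ℝ} {g : ℝ → ℝ} {uT m0 η : E d → ℝ}
  {u m : ℝ → E d → ℝ}

/-- The standing assumptions used for the a priori estimates. -/
structure Standing (T α : ℝ) (H : E d → E d → ℝ) (g : ℝ → ℝ) (uT m0 η : E d → ℝ) : Prop where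
  T_pos : 0 < T
  mollifier : IsMollifier η
  ham : HamiltonianBasic H
  data : DataBasic g uT m0
  lag : LagrangianBound H
  power : PowerNonlinearity g α
  init : InitialLowerBound m0

theorem pd_const_mul_add {f : E d → ℝ} (hf : ContDiff ℝ ∞ f) (a c : ℝ) (i : Fin d) :
    pd i (fun y => a * f y + c) = fun x => a * pd i f x := funext fun x => by
  have h : HasDerivAt (fun z : ℝ => a * z + c) a (f x) := by
    simpa using ((hasDerivAt_id (f x)).const_mul a).add_const c
  exact pd_comp i h (hf.differentiable (by simp)).differentiableAt

/-- Space-time minimum of `e^{λ t} f + δ t`. -/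
theorem exists_slab_min_exp (hT : 0 < T) {f : ℝ → E d → ℝ} (hf : SlabSmooth T f)
    (hp : ∀ t ∈ Icc 0 T, IsPeriodic (f t)) (l δ : ℝ) :
    ∃ t ∈ Icc 0 T, ∃ x,
      (∀ s ∈ Icc 0 T, ∀ y, Real.exp (l * t) * f t x + δ * t ≤ Real.exp (l * s) * f s y + δ * s) ∧
      (∀ i, pd i (f t) x = 0) ∧ (∀ i, 0 ≤ pd i (pd i (f t)) x) ∧
      (0 < t → Real.exp (l * t) * (dtW T f t x + l * f t x) + δ ≤ 0) ∧
      (t < T → 0 ≤ Real.exp (l * t) * (dtW T f t x + l * f t x) + δ) := by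
  have hw : SlabSmooth T fun t x => Real.exp (l * t) * f t x + δ * t :=
    ((slabSmooth_of_time (by fun_prop)).mul hf).add (slabSmooth_of_time (by fun_prop))
  obtain ⟨t, ht, x, h1, h2, h3, h4, h5⟩ := exists_slab_min hT hw fun t ht =>
    ((hp t ht).comp fun z => Real.exp (l * t) * z + δ * t)
  have e1 : ∀ i, pd i (fun y => Real.exp (l * t) * f t y + δ * t) =
      fun y => Real.exp (l * t) * pd i (f t) y + 0 := fun i => by
    simpa using pd_const_mul_add (hf.slice ht) _ _ i
  have e2 : ∀ i, pd i (pd i (fun y => Real.exp (l * t) * f t y + δ * t)) x =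
      Real.exp (l * t) * pd i (pd i (f t)) x := fun i => by
    rw [e1, pd_const_mul_add (contDiff_pd (hf.slice ht) i)]
  have e3 : dtW T (fun t x => Real.exp (l * t) * f t x + δ * t) t x =
      Real.exp (l * t) * (dtW T f t x + l * f t x) + δ := by
    have ha : HasDerivAt (fun s : ℝ => Real.exp (l * s)) (Real.exp (l * t) * l) t := by
      simpa using ((hasDerivAt_id t).const_mul l).exp
    have hb : HasDerivAt (fun s : ℝ => δ * s) δ t := by
      simpa using (hasDerivAt_id t).const_mul δ
    have := ((ha.hasDerivWithinAt.mul (hf.hasDerivWithinAt hT ht x)).add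
      hb.hasDerivWithinAt).derivWithin (uniqueDiffOn_Icc hT t ht)
    refine Eq.trans this ?_
    ring
  rw [e3] at h4 h5
  have hexp := Real.exp_pos (l * t)
  refine ⟨t, ht, x, h1, fun i => ?_, fun i => ?_, h4, h5⟩
  · have := h2 i
    rw [e1] at this
    simpa [hexp.ne'] using this
  · have := h3 i
    rw [e2] at this
    exact nonneg_of_mul_nonneg_right this hexp

theorem slabSmooth_DpH (hH : HamiltonianBasic H) (hT : 0 < T) {u : ℝ → E d → ℝ}
    (hu : SlabSmooth T u) (i : Fin d) :
    SlabSmooth T fun t x => DpH H x (gradient (u t) x) i := by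
  simp only [DpH_apply]
  exact (JointSmooth.pd_right hH.smooth i).slabSmooth_comp (hu.gradient hT)

theorem isPeriodic_DpH (hH : HamiltonianBasic H) {u : E d → ℝ} (hu : IsPeriodic u) (i : Fin d) :
    IsPeriodic fun x => DpH H x (gradient u x) i := by
  simp only [DpH_apply]
  exact isPeriodic_comp_joint (Φ := fun x p => pd i (fun q => H x q) p)
    (isPeriodic_pd_right hH.periodic i) (isPeriodic_gradient hu)

theorem slabSmooth_sum_pd_pd (hT : 0 < T) {f : ℝ → E d → ℝ} (hf : SlabSmooth T f) :
    SlabSmooth T fun t x => ∑ i, pd i (pd i (f t)) x :=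
  SlabSmooth.sum fun i _ => (hf.pd hT i).pd hT i

theorem isPeriodic_sum_pd_pd {f : E d → ℝ} (hf : IsPeriodic f) :
    IsPeriodic fun x => ∑ i, pd i (pd i f) x :=
  IsPeriodic.sum fun i _ => (hf.pd i).pd i

/-- `-u_t + H(x, Du) - Δu`, which is the coupling term. -/
noncomputable def coupling (T : ℝ) (H : E d → E d → ℝ) (u : ℝ → E d → ℝ) (t : ℝ) (x : E d) : ℝ :=
  H x (gradient (u t) x) - dtW T u t x - ∑ i, pd i (pd i (u t)) x

namespace IsSolution

variable (S : Standing T α H g uT m0 η) (hε : 0 ≤ ε) (sol : IsSolution T H g uT m0 η ε u m)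

include S sol

theorem slab_H : SlabSmooth T fun t x => H x (gradient (u t) x) :=
  JointSmooth.slabSmooth_comp S.ham.smooth (SlabSmooth.gradient S.T_pos sol.u_smooth)

/-- Writing the coupling through u makes it smooth up to t = 0 and t = T at once, without studying
how the mollified density depends on time. -/
theorem slab_coupling : SlabSmooth T (coupling T H u) :=
  ((slab_H S sol).sub (SlabSmooth.dtW S.T_pos sol.u_smooth)).sub
    (slabSmooth_sum_pd_pd S.T_pos sol.u_smooth)

theorem slab_b (i : Fin d) : SlabSmooth T fun t x => DpH H x (gradient (u t) x) i :=
  slabSmooth_DpH S.ham S.T_pos sol.u_smooth i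

theorem coupling_eq {t : ℝ} (ht : t ∈ Ioo 0 T) (x : E d) :
    coupling T H u t x = gEps η g ε (m t) x := by
  have ht' := Ioo_subset_Icc_self ht
  have h := sol.hamiltonJacobi t ht x
  rw [laplacian_eq_sum (SlabSmooth.slice sol.u_smooth ht'),
    (SlabSmooth.hasDerivAt S.T_pos sol.u_smooth ht x).deriv] at h
  rw [coupling]
  linarith

theorem dt_m {t : ℝ} (ht : t ∈ Icc 0 T) (x : E d) :
    dtW T m t x = ∑ i, pd i (pd i (m t)) x +
      ∑ i, pd i (fun y => m t y * DpH H y (gradient (u t) y) i) x := by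
  have hm : SlabSmooth T m := sol.m_smooth
  have h1 : SlabSmooth T fun t x => ∑ i, pd i (pd i (m t)) x +
      ∑ i, pd i (fun y => m t y * DpH H y (gradient (u t) y) i) x :=
    (slabSmooth_sum_pd_pd S.T_pos hm).add
      (SlabSmooth.sum fun i _ => (hm.mul (slab_b S sol i)).pd S.T_pos i)
  refine (hm.dtW S.T_pos).slabContinuous.eq_of_eq S.T_pos h1.slabContinuous (fun t ht x => ?_) t ht x
  have h := sol.fokkerPlanck t ht x
  rw [laplacian_eq_sum (hm.slice (Ioo_subset_Icc_self ht)),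
    (hm.hasDerivAt S.T_pos ht x).deriv] at h
  simp only [divergence, PiLp.smul_apply, smul_eq_mul] at h
  linarith

/-- Minimum principle, in two passes. The bound κ depends on the solution, through the supremum of
|div b|, so it must not enter the final constants; it serves only to make powers of m smooth and the
formula for g applicable. -/
theorem exists_m_lower_bound : ∃ κ > 0, ∀ t ∈ Icc 0 T, ∀ x, κ ≤ m t x := by
  have hT := S.T_pos
  have hm : SlabSmooth T m := sol.m_smooth
  have hdiv : SlabSmooth T fun t x => ∑ i, pd i (fun y => DpH H y (gradient (u t) y) i) x :=
    SlabSmooth.sum fun i _ => (slab_b S sol i).pd hT i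
  obtain ⟨L, hL0, hL⟩ := hdiv.slabContinuous.exists_bound fun t ht =>
    IsPeriodic.sum fun i _ => (isPeriodic_DpH S.ham (sol.u_periodic t ht) i).pd i
  obtain ⟨κ₀, hκ₀, hκ⟩ := S.init
  have hdt : ∀ t ∈ Icc 0 T, ∀ x, (∀ i, pd i (m t) x = 0) → (∀ i, 0 ≤ pd i (pd i (m t)) x) →
      m t x * ∑ i, pd i (fun y => DpH H y (gradient (u t) y) i) x ≤ dtW T m t x :=
      fun t ht x h1 h2 => by
    rw [dt_m S sol ht x]
    have e : ∀ i, pd i (fun y => m t y * DpH H y (gradient (u t) y) i) x =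
        m t x * pd i (fun y => DpH H y (gradient (u t) y) i) x := fun i => by
      rw [pd_mul i ((hm.slice ht).differentiable (by simp)).differentiableAt
        (((slab_b S sol i).slice ht).differentiable (by simp)).differentiableAt, h1 i]
      ring
    simp only [e, ← Finset.mul_sum]
    linarith [Finset.sum_nonneg fun i (_ : i ∈ Finset.univ) => h2 i]
  have hnn : ∀ t ∈ Icc 0 T, ∀ x, 0 ≤ m t x := by
    -- First pass, non-negativity. At a weighted minimum with t > 0 one has m div b ≤ m_t ≤ (L+1) m,
    -- impossible for m < 0 since div b ≤ L.
    obtain ⟨t, ht, x, h1, h2, h3, h4, _⟩ := exists_slab_min_exp hT hm sol.m_periodic (-(L + 1)) 0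
    have hmin : 0 ≤ m t x := by
      rcases ht.1.eq_or_lt with h0 | h0
      · rw [← h0, sol.initial]; exact hκ₀.le.trans (hκ x)
      · have h4' := h4 h0
        rw [add_zero] at h4'
        have h5 := nonpos_of_mul_nonpos_right h4' (Real.exp_pos _)
        have h6 := hdt t ht x h2 h3
        have h7 := (abs_le.1 (hL t ht x)).2
        by_contra hneg
        push Not at hneg
        nlinarith
    intro s hs y
    have h := h1 s hs y
    simp only [zero_mul, add_zero] at h
    exact nonneg_of_mul_nonneg_right ((mul_nonneg (Real.exp_pos _).le hmin).trans h)
      (Real.exp_pos _)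
  -- Second pass. As m ≥ 0, at a spatial minimum m_t + L m ≥ 0, so the added slope κ₀/(2T) forces
  -- the minimum to t = 0; it costs at most κ₀/2 over [0,T].
  obtain ⟨t, ht, x, h1, h2, h3, h4, _⟩ :=
    exists_slab_min_exp hT hm sol.m_periodic L (κ₀ / (2 * T))
  have ht0 : t = 0 := by
    by_contra hne
    have h4' := h4 (lt_of_le_of_ne ht.1 (Ne.symm hne))
    have h6 := hdt t ht x h2 h3
    have h7 := (abs_le.1 (hL t ht x)).1
    have h8 : 0 ≤ dtW T m t x + L * m t x := by nlinarith [hnn t ht x]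
    have h9 : 0 < κ₀ / (2 * T) := by positivity
    nlinarith [mul_nonneg (Real.exp_pos (L * t)).le h8]
  refine ⟨κ₀ / 2 * Real.exp (-(L * T)), by positivity, fun s hs y => ?_⟩
  have h := h1 s hs y
  rw [ht0, sol.initial] at h
  simp only [mul_zero, Real.exp_zero, one_mul, add_zero] at h
  have h5 : κ₀ / (2 * T) * s ≤ κ₀ / 2 := by
    rw [div_mul_eq_mul_div, div_le_div_iff₀ (by positivity) (by positivity)]
    nlinarith [hs.2]
  have h6 : κ₀ / 2 ≤ Real.exp (L * s) * m s y := by linarith [hκ x]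
  rw [Real.exp_neg, ← div_eq_mul_inv, div_le_iff₀ (Real.exp_pos _), mul_comm]
  exact h6.trans (mul_le_mul_of_nonneg_right (Real.exp_le_exp.2
    (mul_le_mul_of_nonneg_left hs.2 hL0)) (hnn s hs y))

theorem m_pos {t : ℝ} (ht : t ∈ Icc 0 T) (x : E d) : 0 < m t x := by
  obtain ⟨κ, hκ, h⟩ := exists_m_lower_bound S sol
  exact hκ.trans_le (h t ht x)

/-- Testing the Fokker–Planck equation with a smooth function. -/
theorem integral_mul_dt {ψ : E d → ℝ} (hψ : ContDiff ℝ ∞ ψ) (pψ : IsPeriodic ψ) {t : ℝ}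
    (ht : t ∈ Icc 0 T) :
    ∫ x, ψ x * dtW T m t x ∂(torusMeasure d) =
      ∫ x, (∑ i, pd i (pd i ψ) x - ∑ i, DpH H x (gradient (u t) x) i * pd i ψ x) * m t x
        ∂(torusMeasure d) := by
  have hm := SlabSmooth.slice sol.m_smooth ht
  have pm := sol.m_periodic t ht
  have hb := fun i => (slab_b S sol i).slice ht
  have pb := isPeriodic_DpH S.ham (sol.u_periodic t ht)
  have hmb := fun i => hm.mul (hb i)
  have pmb := fun i => pm.mul (pb i)
  have h1 : ∀ x, ψ x * dtW T m t x = ∑ i, ψ x * pd i (pd i (m t)) x +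
      ∑ i, ψ x * pd i (fun y => m t y * DpH H y (gradient (u t) y) i) x := fun x => by
    rw [dt_m S sol ht x, mul_add, Finset.mul_sum, Finset.mul_sum]
  have h2 : ∀ x, (∑ i, pd i (pd i ψ) x - ∑ i, DpH H x (gradient (u t) x) i * pd i ψ x) * m t x =
      ∑ i, pd i (pd i ψ) x * m t x -
        ∑ i, pd i ψ x * (m t x * DpH H x (gradient (u t) x) i) := fun x => by
    rw [sub_mul, Finset.sum_mul, Finset.sum_mul]
    congr 1
    exact Finset.sum_congr rfl fun i _ => by ring
  have hψi := fun i => contDiff_pd hψ i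
  have hψii := fun i => contDiff_pd (hψi i) i
  have i1 : ∀ i ∈ Finset.univ, Integrable (fun x => ψ x * pd i (pd i (m t)) x) (torusMeasure d) :=
    fun i _ => integrable_torus (hψ.continuous.mul (contDiff_pd (contDiff_pd hm i) i).continuous)
  have i2 : ∀ i ∈ Finset.univ, Integrable (fun x => ψ x *
      pd i (fun y => m t y * DpH H y (gradient (u t) y) i) x) (torusMeasure d) :=
    fun i _ => integrable_torus (hψ.continuous.mul (contDiff_pd (hmb i) i).continuous)
  have i3 : ∀ i ∈ Finset.univ, Integrable (fun x => pd i (pd i ψ) x * m t x) (torusMeasure d) :=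
    fun i _ => integrable_torus ((hψii i).continuous.mul hm.continuous)
  have i4 : ∀ i ∈ Finset.univ, Integrable (fun x => pd i ψ x *
      (m t x * DpH H x (gradient (u t) x) i)) (torusMeasure d) :=
    fun i _ => integrable_torus ((hψi i).continuous.mul (hmb i).continuous)
  simp only [h1, h2]
  rw [integral_add (integrable_finsetSum _ i1) (integrable_finsetSum _ i2),
    integral_sub (integrable_finsetSum _ i3) (integrable_finsetSum _ i4),
    integral_finsetSum _ i1, integral_finsetSum _ i2, integral_finsetSum _ i3,
    integral_finsetSum _ i4, sub_eq_add_neg, ← Finset.sum_neg_distrib]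
  congr 1
  · exact Finset.sum_congr rfl fun i _ => integral_mul_pd_pd hψ hm pψ pm i
  · exact Finset.sum_congr rfl fun i _ => integral_mul_pd hψ (hmb i) pψ (pmb i) i

theorem integral_m {t : ℝ} (ht : t ∈ Icc 0 T) : ∫ x, m t x ∂(torusMeasure d) = 1 := by
  have h := SlabSmooth.integral_sub S.T_pos sol.m_smooth ht
  have hz : ∀ s ∈ uIcc 0 t, ∫ x, dtW T m s x ∂(torusMeasure d) = 0 := fun s hs => by
    rw [uIcc_of_le ht.1] at hs
    have := integral_mul_dt S sol (contDiff_const (c := (1 : ℝ))) (isPeriodic_const 1)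
      (⟨hs.1, hs.2.trans ht.2⟩ : s ∈ Icc 0 T)
    have e : ∀ i : Fin d, pd i (fun _ : E d => (1 : ℝ)) = fun _ => 0 := fun i => by
      ext; simp [pd]
    have e' : ∀ i : Fin d, pd i (fun _ : E d => (0 : ℝ)) = fun _ => 0 := fun i => by
      ext; simp [pd]
    simpa [e, e'] using this
  rw [intervalIntegral.integral_congr hz] at h
  have h0 : ∫ x, m 0 x ∂(torusMeasure d) = 1 := by
    simp only [sol.initial]; exact S.data.m0_mass
  simp only [intervalIntegral.integral_zero] at h
  linarith

theorem coupling_nonneg {t : ℝ} (ht : t ∈ Icc 0 T) (x : E d) (hε : 0 ≤ ε) :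
    0 ≤ coupling T H u t x := by
  obtain ⟨κ, hκ, h⟩ := exists_m_lower_bound S sol
  refine (slabContinuous_const (0 : ℝ)).le_of_le S.T_pos (slab_coupling S sol).slabContinuous
    (fun t ht x => ?_) t ht x
  have ht' := Ioo_subset_Icc_self ht
  rw [coupling_eq S sol ht]
  exact gEps_nonneg S.mollifier hε S.power (SlabSmooth.slice sol.m_smooth ht').continuous hκ
    (h t ht') x

omit sol in
-- At a spatial minimum Du = 0 and Δu ≥ 0, so a non-negative coupling gives u_t ≤ H(x,0) ≤ K.
-- Subtracting (K+1)t therefore pushes the space-time minimum to t = T, where u is the given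
-- terminal value.
theorem exists_u_lower_bound : ∃ C : ℝ, 0 ≤ C ∧ ∀ ε, 0 ≤ ε → ∀ u m : ℝ → E d → ℝ,
    IsSolution T H g uT m0 η ε u m → ∀ t ∈ Icc 0 T, ∀ x, -C ≤ u t x := by
  have hT := S.T_pos
  obtain ⟨K, hK0, hK⟩ := (S.ham.periodic 0).exists_bound
    ((JointSmooth.slice_left S.ham.smooth 0).continuous)
  obtain ⟨A, hA0, hA⟩ := S.data.uT_periodic.exists_bound S.data.uT_smooth.continuous
  refine ⟨A + (K + 1) * T, by positivity, fun ε hε u m sol => ?_⟩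
  obtain ⟨t, ht, x, h1, h2, h3, _, h5⟩ := exists_slab_min_exp hT sol.u_smooth sol.u_periodic 0
    (-(K + 1))
  have htT : t = T := by
    by_contra hne
    have h5' := h5 (lt_of_le_of_ne ht.2 hne)
    simp only [zero_mul, Real.exp_zero, one_mul, add_zero] at h5'
    have hG := coupling_nonneg S sol ht x hε
    have hgrad : gradient (u t) x = 0 := by
      ext i; rw [gradient_apply, h2 i]; rfl
    rw [coupling, hgrad] at hG
    have := (abs_le.1 (hK x)).2
    linarith [Finset.sum_nonneg fun i (_ : i ∈ Finset.univ) => h3 i]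
  intro s hs y
  have h := h1 s hs y
  rw [htT, sol.terminal] at h
  simp only [zero_mul, Real.exp_zero, one_mul] at h
  have := (abs_le.1 (hA x)).1
  nlinarith [hs.1, hs.2]

end IsSolution

end Solution

end MFG

namespace MFG

/-! ### First- and second-order a priori estimates -/

section Estimates

variable {d : ℕ} {T α ε : ℝ} {H : E d → E d → ℝ} {g : ℝ → ℝ} {uT m0 η : E d → ℝ}
  {u m : ℝ → E d → ℝ}

theorem integrable_torus_mul {f g : E d → ℝ} (hf : Continuous f) (hg : Continuous g) :
    Integrable (fun x => f x * g x) (torusMeasure d) := integrable_torus (hf.mul hg)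

theorem SlabSmooth.dtW_mul (hT : 0 < T) {f g : ℝ → E d → ℝ} (hf : SlabSmooth T f)
    (hg : SlabSmooth T g) {t : ℝ} (ht : t ∈ Icc 0 T) (x : E d) :
    MFG.dtW T (fun t x => f t x * g t x) t x =
      MFG.dtW T f t x * g t x + f t x * MFG.dtW T g t x :=
  ((hf.hasDerivWithinAt hT ht x).mul (hg.hasDerivWithinAt hT ht x)).derivWithin
    (uniqueDiffOn_Icc hT t ht)

/-- Symmetry of the second derivative within the slab. It holds at t = 0 and t = T too, because
these points are limits of interior points. -/
theorem SlabSmooth.dtW_pd (hT : 0 < T) {f : ℝ → E d → ℝ} (hf : SlabSmooth T f) {t : ℝ}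
    (ht : t ∈ Icc 0 T) (i : Fin d) (x : E d) :
    MFG.dtW T (fun t x => MFG.pd i (f t) x) t x = MFG.pd i (MFG.dtW T f t) x := by
  have hU := uniqueDiffOn_slab (d := d) hT
  have hz : (t, x) ∈ Icc 0 T ×ˢ (univ : Set (E d)) := ⟨ht, mem_univ _⟩
  set F : ℝ × E d → ℝ := fun z => f z.1 z.2
  have hs : IsSymmSndFDerivWithinAt ℝ F (Icc 0 T ×ˢ univ) (t, x) := by
    refine ContDiffWithinAt.isSymmSndFDerivWithinAt (n := 2)
      ((hf (t, x) hz).of_le (WithTop.coe_le_coe.2 le_top)) (by simp) hU ?_ hz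
    rw [interior_prod_eq, interior_Icc, interior_univ, closure_prod_eq, closure_Ioo hT.ne]
    exact ⟨ht, by simp⟩
  have hd : DifferentiableWithinAt ℝ (fderivWithin ℝ F (Icc 0 T ×ˢ univ)) (Icc 0 T ×ˢ univ) (t, x) :=
    ((ContDiffOn.fderivWithin (m := ∞) hf hU (by simp)).differentiableOn (by simp)) _ hz
  have key : ∀ v w : ℝ × E d, fderivWithin ℝ (fun z => fderivWithin ℝ F (Icc 0 T ×ˢ univ) z v)
      (Icc 0 T ×ˢ univ) (t, x) w =
      fderivWithin ℝ (fderivWithin ℝ F (Icc 0 T ×ˢ univ)) (Icc 0 T ×ˢ univ) (t, x) w v :=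
    fun v w => by
      rw [(hd.hasFDerivWithinAt.clm_apply (hasFDerivWithinAt_const v _ _)).fderivWithin (hU _ hz)]
      simp
  rw [(hf.pd hT i).dtW_eq hT ht, (hf.dtW hT).pd_eq ht]
  rw [fderivWithin_congr (f₁ := fun z : ℝ × E d => MFG.pd i (f z.1) z.2)
    (f := fun z => fderivWithin ℝ F (Icc 0 T ×ˢ univ) z (0, ev i))
    (fun z hz => hf.pd_eq hz.1 z.2 i) (hf.pd_eq ht x i)]
  rw [fderivWithin_congr (f₁ := fun z : ℝ × E d => MFG.dtW T f z.1 z.2)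
    (f := fun z => fderivWithin ℝ F (Icc 0 T ×ˢ univ) z (1, 0))
    (fun z hz => hf.dtW_eq hT hz.1 z.2) (hf.dtW_eq hT ht x)]
  rw [key, key]
  exact hs _ _

theorem SlabSmooth.dtW_pd_pd (hT : 0 < T) {f : ℝ → E d → ℝ} (hf : SlabSmooth T f) {t : ℝ}
    (ht : t ∈ Icc 0 T) (i : Fin d) (x : E d) :
    MFG.dtW T (fun t x => MFG.pd i (MFG.pd i (f t)) x) t x =
      MFG.pd i (MFG.pd i (MFG.dtW T f t)) x := by
  rw [(hf.pd hT i).dtW_pd hT ht i x]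
  congr 1
  exact funext fun y => hf.dtW_pd hT ht i y

theorem SlabSmooth.dtW_sum {ι : Type*} (s : Finset ι) (hT : 0 < T) {f : ι → ℝ → E d → ℝ}
    (hf : ∀ i ∈ s, SlabSmooth T (f i)) {t : ℝ} (ht : t ∈ Icc 0 T) (x : E d) :
    MFG.dtW T (fun t x => ∑ i ∈ s, f i t x) t x = ∑ i ∈ s, MFG.dtW T (f i) t x :=
  (HasDerivWithinAt.fun_sum fun i hi => (hf i hi).hasDerivWithinAt hT ht x).derivWithin
    (uniqueDiffOn_Icc hT t ht)

theorem integral_mul_sum_pd_pd {f g : E d → ℝ} (hf : ContDiff ℝ ∞ f) (hg : ContDiff ℝ ∞ g)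
    (pf : IsPeriodic f) (pg : IsPeriodic g) :
    ∫ x, f x * ∑ i, pd i (pd i g) x ∂(torusMeasure d) =
      ∫ x, (∑ i, pd i (pd i f) x) * g x ∂(torusMeasure d) := by
  simp only [Finset.mul_sum, Finset.sum_mul]
  rw [integral_finsetSum _ fun i _ => integrable_torus_mul
      hf.continuous (contDiff_pd (contDiff_pd hg i) i).continuous,
    integral_finsetSum _ fun i _ => integrable_torus_mul
      (contDiff_pd (contDiff_pd hf i) i).continuous hg.continuous]
  exact Finset.sum_congr rfl fun i _ => integral_mul_pd_pd hf hg pf pg i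

theorem contDiff_sum_pd_pd {f : E d → ℝ} (hf : ContDiff ℝ ∞ f) :
    ContDiff ℝ ∞ fun x => ∑ i, pd i (pd i f) x :=
  ContDiff.sum fun i _ => contDiff_pd (contDiff_pd hf i) i

theorem Lhat_gradient (u : E d → ℝ) (x : E d) :
    Lhat H x (gradient u x) = ∑ i, DpH H x (gradient u x) i * pd i u x - H x (gradient u x) := by
  rw [Lhat, PiLp.inner_apply]
  congr 1
  refine Finset.sum_congr rfl fun i _ => ?_
  rw [gradient_apply]
  simp [mul_comm]

namespace IsSolution

variable (S : Standing T α H g uT m0 η)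

include S

/-- Test the Fokker–Planck equation with u and insert u_t from the Hamilton–Jacobi equation: the
Laplacians cancel, and H - b · Du is the negative of the Lagrangian. -/
theorem integral_dt_mul (sol : IsSolution T H g uT m0 η ε u m) {t : ℝ} (ht : t ∈ Icc 0 T) :
    ∫ x, dtW T (fun t x => u t x * m t x) t x ∂(torusMeasure d) =
      -∫ x, (Lhat H x (gradient (u t) x) + coupling T H u t x) * m t x ∂(torusMeasure d) := by
  have hu : SlabSmooth T u := sol.u_smooth
  have hm : SlabSmooth T m := sol.m_smooth
  have hut := hu.slice ht
  have hmt := hm.slice ht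
  have hb := fun i => (slab_b S sol i).slice ht
  have h1 := integral_mul_dt S sol hut (sol.u_periodic t ht) ht
  simp only [hu.dtW_mul S.T_pos hm ht]
  rw [integral_add (integrable_torus_mul (((hu.dtW S.T_pos).slice ht).continuous) hmt.continuous)
    (integrable_torus_mul hut.continuous ((hm.dtW S.T_pos).slice ht).continuous), h1,
    ← integral_add (integrable_torus_mul (((hu.dtW S.T_pos).slice ht).continuous) hmt.continuous)
    (integrable_torus_mul (((contDiff_sum_pd_pd hut).sub (ContDiff.sum fun i _ =>
      (hb i).mul (contDiff_pd hut i))).continuous) hmt.continuous), ← integral_neg]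
  congr 1 with x
  rw [Lhat_gradient, coupling]
  ring

/-- Testing the Hamilton–Jacobi equation with the initial density. -/
theorem exists_integral_dt_mul_initial : ∃ C : ℝ, 0 ≤ C ∧ ∀ ε, 0 ≤ ε → ∀ u m : ℝ → E d → ℝ,
    IsSolution T H g uT m0 η ε u m → ∀ t ∈ Ioo 0 T,
      -C - (1 / 2) * ∫ x, coupling T H u t x * m t x ∂(torusMeasure d) ≤
        ∫ x, dtW T u t x * m0 x ∂(torusMeasure d) := by
  have hT := S.T_pos
  have hm0 := S.data.m0_smooth
  have pm0 := S.data.m0_periodic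
  obtain ⟨κ₀, hκ₀, hκ⟩ := S.init
  obtain ⟨M, hM0, hM⟩ := pm0.exists_bound hm0.continuous
  obtain ⟨L, hL0, hL⟩ := ((isPeriodic_gradient pm0).comp fun v => ‖v‖).exists_bound
    (contDiff_gradient hm0).continuous.norm
  -- The slope L/κ₀ lets κ₀ H dominate L|Du|, hence |Dm0 · Du|.
  obtain ⟨CK, hCK⟩ := S.ham.exists_linear_lower_bound (K := L / κ₀) (by positivity)
  refine ⟨κ₀ * |CK| + M * (2 * M) ^ α, by positivity, fun ε hε u m sol t ht => ?_⟩
  have ht' := Ioo_subset_Icc_self ht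
  obtain ⟨κ, hκpos, hκm⟩ := exists_m_lower_bound S sol
  have hut := SlabSmooth.slice sol.u_smooth ht'
  have hmt := SlabSmooth.slice sol.m_smooth ht'
  have pu := sol.u_periodic t ht'
  have pm := sol.m_periodic t ht'
  have hG := (slab_coupling S sol).slice ht'
  have hHs := (slab_H S sol).slice ht'
  have hGeq : coupling T H u t = gEps η g ε (m t) := funext fun x => coupling_eq S sol ht x
  -- the coupling against the initial density
  have h1 : ∫ x, coupling T H u t x * m0 x ∂(torusMeasure d) ≤
      M * (2 * M) ^ α + (1 / 2) * ∫ x, coupling T H u t x * m t x ∂(torusMeasure d) := by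
    rw [hGeq, integral_gEps_mul S.mollifier hε S.power hmt.continuous pm hκpos (hκm t ht')
      hm0.continuous pm0, integral_gEps_mul S.mollifier hε S.power hmt.continuous pm hκpos
      (hκm t ht') hmt.continuous pm, ← integral_const_mul]
    have hv := S.mollifier.mollify_pos hε hmt.continuous hκpos (hκm t ht')
    have hvc := S.mollifier.continuous_mollify hε hmt.continuous
    have hvα := continuous_mollify_rpow S.mollifier hε hmt.continuous hκpos (hκm t ht') α
    have hc0 := S.mollifier.continuous_mollify hε hm0.continuous
    have hconst : M * (2 * M) ^ α = ∫ _x : E d, M * (2 * M) ^ α ∂(torusMeasure d) := by simp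
    rw [hconst, ← integral_add (integrable_const _) (integrable_torus
      (continuous_const.fun_mul (hvα.fun_mul hvc)))]
    refine integral_torus_mono (hvα.mul hc0) (continuous_const.add
      (continuous_const.mul (hvα.mul hvc))) fun x => ?_
    have hle : mollify η ε m0 x ≤ M := (S.mollifier.mollify_mono hε hm0.continuous
      continuous_const (fun y => (abs_le.1 (hM y)).2) x).trans_eq (S.mollifier.mollify_const hε M x)
    have hvx := hv x
    have hp := Real.rpow_nonneg hvx.le α
    refine (mul_le_mul_of_nonneg_left hle hp).trans ?_
    -- With v = η_ε * m, the product M v^α is at most v^{α+1}/2 when v ≥ 2M and at most M(2M)^α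
    -- otherwise. The factor 1/2 leaves half of ∫∫ g_ε(m) m available later.
    rcases le_total (2 * M) (mollify η ε (m t) x) with hc | hc
    · have : 0 ≤ M * (2 * M) ^ α := by positivity
      nlinarith
    · have h2 := Real.rpow_le_rpow hvx.le hc S.power.pos.le
      nlinarith [mul_nonneg hp hvx.le]
  -- the remaining part
  have h2 : -(κ₀ * |CK|) ≤ ∫ x, (H x (gradient (u t) x) * m0 x +
      ∑ i, pd i (u t) x * pd i m0 x) ∂(torusMeasure d) := by
    have hconst : -(κ₀ * |CK|) = ∫ _x : E d, -(κ₀ * |CK|) ∂(torusMeasure d) := by simp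
    rw [hconst]
    refine integral_torus_mono continuous_const ((hHs.continuous.mul hm0.continuous).add
      (continuous_finsetSum _ fun i _ => (contDiff_pd hut i).continuous.mul
        (contDiff_pd hm0 i).continuous)) fun x => ?_
    have hin : ∑ i, pd i (u t) x * pd i m0 x = inner ℝ (gradient (u t) x) (gradient m0 x) := by
      rw [PiLp.inner_apply]
      refine Finset.sum_congr rfl fun i _ => ?_
      rw [gradient_apply, gradient_apply]
      simp [mul_comm]
    have h3 := (abs_le.1 (abs_real_inner_le_norm (gradient (u t) x) (gradient m0 x))).1
    have h4 := (le_abs_self _).trans (hL x)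
    have h5 := hCK x (gradient (u t) x)
    have h6 := hκ x
    have h7 := S.ham.one_le x (gradient (u t) x)
    have h8 : L * ‖gradient (u t) x‖ - κ₀ * CK ≤ κ₀ * H x (gradient (u t) x) := by
      have := mul_le_mul_of_nonneg_left h5 hκ₀.le
      refine le_trans (le_of_eq ?_) this
      field_simp
    have h9 := le_abs_self CK
    rw [hin]
    nlinarith [mul_le_mul_of_nonneg_left h4 (norm_nonneg (gradient (u t) x)),
      mul_le_mul_of_nonneg_left h9 hκ₀.le]
  have hcont2 : Continuous fun x => ∑ i, pd i (u t) x * pd i m0 x :=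
    continuous_finsetSum _ fun i _ => (contDiff_pd hut i).continuous.mul
      (contDiff_pd hm0 i).continuous
  have h3 : ∫ x, ∑ i, pd i (u t) x * pd i m0 x ∂(torusMeasure d) =
      -∫ x, (∑ i, pd i (pd i (u t)) x) * m0 x ∂(torusMeasure d) := by
    simp only [Finset.sum_mul]
    rw [integral_finsetSum _ fun i _ => integrable_torus_mul (contDiff_pd hut i).continuous
        (contDiff_pd hm0 i).continuous,
      integral_finsetSum _ fun i _ => integrable_torus_mul
        (contDiff_pd (contDiff_pd hut i) i).continuous hm0.continuous,
      ← Finset.sum_neg_distrib]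
    exact Finset.sum_congr rfl fun i _ => integral_mul_pd (contDiff_pd hut i) hm0 (pu.pd i) pm0 i
  have hi1 := integrable_torus_mul hHs.continuous hm0.continuous
  have hi2 := integrable_torus_mul ((contDiff_sum_pd_pd hut).continuous) hm0.continuous
  have hi3 := integrable_torus_mul hG.continuous hm0.continuous
  rw [integral_add hi1 (integrable_torus hcont2), h3] at h2
  have h4 : ∫ x, dtW T u t x * m0 x ∂(torusMeasure d) =
      ∫ x, H x (gradient (u t) x) * m0 x ∂(torusMeasure d) -
      ∫ x, (∑ i, pd i (pd i (u t)) x) * m0 x ∂(torusMeasure d) -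
      ∫ x, coupling T H u t x * m0 x ∂(torusMeasure d) := by
    rw [← integral_sub hi1 hi2, ← integral_sub (hi1.sub' hi2) hi3]
    congr 1 with x
    simp only [coupling]
    ring
  rw [h4]
  linarith

/-- First-order a priori estimate. -/
theorem exists_first_order_bound : ∃ C : ℝ, 0 ≤ C ∧ ∀ ε, 0 ≤ ε → ∀ u m : ℝ → E d → ℝ,
    IsSolution T H g uT m0 η ε u m →
      ∫ s in (0 : ℝ)..T, ∫ x, H x (gradient (u s) x) * m s x ∂(torusMeasure d) ≤ C ∧
      ∫ x, |u 0 x| ∂(torusMeasure d) ≤ C := by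
  have hT := S.T_pos
  have hm0 := S.data.m0_smooth
  obtain ⟨c, hc, C0, hC0, hlag⟩ := S.lag
  obtain ⟨C1, hC10, hC1⟩ := exists_integral_dt_mul_initial S
  obtain ⟨Cu, hCu0, hCu⟩ := exists_u_lower_bound S
  obtain ⟨A, hA0, hA⟩ := S.data.uT_periodic.exists_bound S.data.uT_smooth.continuous
  obtain ⟨κ₀, hκ₀, hκ⟩ := S.init
  set B : ℝ := 2 * A + T * (C0 + C1) with hB
  refine ⟨B / c + (A + T * C1 + B + 2 * Cu) / κ₀, by positivity, fun ε hε u m sol => ?_⟩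
  have hu : SlabSmooth T u := sol.u_smooth
  have hm : SlabSmooth T m := sol.m_smooth
  have hTm : T ∈ Icc 0 T := ⟨hT.le, le_rfl⟩
  have h0m : (0 : ℝ) ∈ Icc 0 T := ⟨le_rfl, hT.le⟩
  have hG := slab_coupling S sol
  have hHs := slab_H S sol
  have hum := hu.mul hm
  have hum0 := hu.mul (slabSmooth_of_contDiff (T := T) hm0)
  have hGm := (hG.mul hm).slabContinuous
  have hHm := (hHs.mul hm).slabContinuous
  have hdt0 : ∀ s ∈ Icc 0 T, ∀ x, dtW T (fun t x => u t x * m0 x) s x = dtW T u s x * m0 x :=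
    fun s hs x => by
      rw [hu.dtW_mul hT (slabSmooth_of_contDiff hm0) hs]
      have : dtW T (fun _ => m0) s x = 0 := by simp [dtW]
      rw [this, mul_zero, add_zero]
  have hE1 := hum.integral_sub hT hTm
  have hE2 := hum0.integral_sub hT hTm
  simp only [sol.initial, sol.terminal] at hE1 hE2
  -- bounds for the boundary terms
  have hbd : ∀ f : E d → ℝ, Continuous f → (∀ x, 0 ≤ f x) → ∫ x, f x ∂(torusMeasure d) = 1 →
      |∫ x, uT x * f x ∂(torusMeasure d)| ≤ A := fun f hf f0 hf1 => by
    refine (norm_integral_le_integral_norm (μ := torusMeasure d) fun x => uT x * f x).trans ?_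
    have : ∫ x, A * f x ∂(torusMeasure d) = A := by rw [integral_const_mul, hf1, mul_one]
    rw [← this]
    refine integral_torus_mono (S.data.uT_smooth.continuous.mul hf).norm
      (continuous_const.mul hf) fun x => ?_
    rw [norm_mul, Real.norm_of_nonneg (f0 x)]
    exact mul_le_mul_of_nonneg_right (hA x) (f0 x)
  have hb1 := abs_le.1 (hbd (m T) (hm.slice hTm).continuous (fun x => (m_pos S sol hTm x).le)
    (integral_m S sol hTm))
  have hb2 := abs_le.1 (hbd m0 hm0.continuous S.data.m0_nonneg S.data.m0_mass)
  -- the key inequality at a fixed time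
  have hkey : ∀ s ∈ Ioo 0 T, ∫ x, (c * (H x (gradient (u s) x) * m s x) +
      (1 / 2) * (coupling T H u s x * m s x)) ∂(torusMeasure d) ≤
      ∫ x, (dtW T (fun t x => u t x * m0 x) s x - dtW T (fun t x => u t x * m t x) s x +
        (C0 + C1)) ∂(torusMeasure d) := fun s hs => by
    have hs' := Ioo_subset_Icc_self hs
    have i1 := integrable_torus (hHm.slice hs')
    have i2 := integrable_torus (hGm.slice hs')
    have i3 := integrable_torus ((hum0.dtW hT).slice hs').continuous
    have i4 := integrable_torus ((hum.dtW hT).slice hs').continuous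
    rw [integral_add (i1.const_mul c) (i2.const_mul _), integral_const_mul, integral_const_mul,
      integral_add (i3.sub' i4) (integrable_const _), integral_sub i3 i4,
      integral_dt_mul S sol hs']
    simp only [hdt0 s hs', integral_const, probReal_univ, one_smul]
    have h1 := hC1 ε hε u m sol s hs
    have h2 : ∫ x, (c * (H x (gradient (u s) x) * m s x) + coupling T H u s x * m s x -
        C0 * m s x) ∂(torusMeasure d) ≤
        ∫ x, (Lhat H x (gradient (u s) x) + coupling T H u s x) * m s x ∂(torusMeasure d) := by
      have hLc : Continuous fun x => Lhat H x (gradient (u s) x) := by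
        simp only [Lhat_gradient]
        exact (continuous_finsetSum _ fun i _ => ((slab_b S sol i).slice hs').continuous.mul
          (contDiff_pd (hu.slice hs') i).continuous).sub (hHs.slice hs').continuous
      refine integral_torus_mono (((continuous_const.mul (hHm.slice hs')).add
        (hGm.slice hs')).sub (continuous_const.mul (hm.slice hs').continuous))
        ((hLc.add (hG.slice hs').continuous).mul (hm.slice hs').continuous) fun x => ?_
      have := mul_le_mul_of_nonneg_right (hlag x (gradient (u s) x)) (m_pos S sol hs' x).le
      nlinarith
    rw [integral_sub ((i1.const_mul c).fun_add i2) ((integrable_torus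
      (hm.slice hs').continuous).const_mul _), integral_add (i1.const_mul c) i2,
      integral_const_mul, integral_const_mul, integral_m S sol hs'] at h2
    linarith
  have hci1 : SlabContinuous T fun s x => c * (H x (gradient (u s) x) * m s x) +
      (1 / 2) * (coupling T H u s x * m s x) :=
    ((slabContinuous_const c).mul hHm).add ((slabContinuous_const _).mul hGm)
  have hci2 : SlabContinuous T fun s x => dtW T (fun t x => u t x * m0 x) s x -
      dtW T (fun t x => u t x * m t x) s x + (C0 + C1) :=
    ((hum0.dtW hT).slabContinuous.sub (hum.dtW hT).slabContinuous).add (slabContinuous_const _)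
  have hint := hci1.integral_integral_mono hci2 hTm hkey
  have hI1 := hHm.intervalIntegrable_integral hTm
  have hI2 := hGm.intervalIntegrable_integral hTm
  have hI3 := (hum0.dtW hT).slabContinuous.intervalIntegrable_integral hTm
  have hI4 := (hum.dtW hT).slabContinuous.intervalIntegrable_integral hTm
  have e1 : ∫ s in (0 : ℝ)..T, ∫ x, (c * (H x (gradient (u s) x) * m s x) +
      (1 / 2) * (coupling T H u s x * m s x)) ∂(torusMeasure d) =
      c * (∫ s in (0 : ℝ)..T, ∫ x, H x (gradient (u s) x) * m s x ∂(torusMeasure d)) +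
      (1 / 2) * ∫ s in (0 : ℝ)..T, ∫ x, coupling T H u s x * m s x ∂(torusMeasure d) := by
    rw [← intervalIntegral.integral_const_mul, ← intervalIntegral.integral_const_mul,
      ← intervalIntegral.integral_add (hI1.const_mul c) (hI2.const_mul _)]
    refine intervalIntegral.integral_congr fun s hs => ?_
    rw [uIcc_of_le hT.le] at hs
    have i1 := integrable_torus (hHm.slice hs)
    have i2 := integrable_torus (hGm.slice hs)
    rw [integral_add (i1.const_mul c) (i2.const_mul _), integral_const_mul, integral_const_mul]
  have e2 : ∫ s in (0 : ℝ)..T, ∫ x, (dtW T (fun t x => u t x * m0 x) s x -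
      dtW T (fun t x => u t x * m t x) s x + (C0 + C1)) ∂(torusMeasure d) =
      (∫ s in (0 : ℝ)..T, ∫ x, dtW T (fun t x => u t x * m0 x) s x ∂(torusMeasure d)) -
      (∫ s in (0 : ℝ)..T, ∫ x, dtW T (fun t x => u t x * m t x) s x ∂(torusMeasure d)) +
      T * (C0 + C1) := by
    rw [← intervalIntegral.integral_sub hI3 hI4]
    have : T * (C0 + C1) = ∫ _s in (0 : ℝ)..T, (C0 + C1) := by
      rw [intervalIntegral.integral_const, sub_zero, smul_eq_mul]
    rw [this, ← intervalIntegral.integral_add (hI3.sub hI4) intervalIntegrable_const]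
    refine intervalIntegral.integral_congr fun s hs => ?_
    rw [uIcc_of_le hT.le] at hs
    have i3 := integrable_torus ((hum0.dtW hT).slice hs).continuous
    have i4 := integrable_torus ((hum.dtW hT).slice hs).continuous
    rw [integral_add (i3.sub' i4) (integrable_const _), integral_sub i3 i4]
    simp
  -- Since m(0) = m0, the unknown terms ∫ u(0) m0 of the two identities cancel; only pairings of uT
  -- with unit-mass densities remain.
  rw [e1, e2, ← hE1, ← hE2] at hint
  have hHpos : 0 ≤ ∫ s in (0 : ℝ)..T, ∫ x, H x (gradient (u s) x) * m s x ∂(torusMeasure d) :=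
    intervalIntegral.integral_nonneg hT.le fun s hs => integral_torus_nonneg fun x =>
      mul_nonneg (zero_le_one.trans (S.ham.one_le _ _)) (m_pos S sol hs x).le
  have hGpos : 0 ≤ ∫ s in (0 : ℝ)..T, ∫ x, coupling T H u s x * m s x ∂(torusMeasure d) :=
    intervalIntegral.integral_nonneg hT.le fun s hs => integral_torus_nonneg fun x =>
      mul_nonneg (coupling_nonneg S sol hs x hε) (m_pos S sol hs x).le
  have hBnd : c * (∫ s in (0 : ℝ)..T, ∫ x, H x (gradient (u s) x) * m s x ∂(torusMeasure d)) +
      (1 / 2) * (∫ s in (0 : ℝ)..T, ∫ x, coupling T H u s x * m s x ∂(torusMeasure d)) ≤ B := by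
    linarith [hb1.1, hb2.2]
  have hBc : 0 ≤ B / c := by positivity
  have hR : 0 ≤ (A + T * C1 + B + 2 * Cu) / κ₀ := by positivity
  constructor
  · have : (∫ s in (0 : ℝ)..T, ∫ x, H x (gradient (u s) x) * m s x ∂(torusMeasure d)) ≤ B / c := by
      rw [le_div_iff₀ hc]; linarith
    linarith
  · have h1 : ∫ x, u 0 x * m0 x ∂(torusMeasure d) ≤ A + T * C1 + B := by
      have hci3 : SlabContinuous T fun s x => -C1 - (1 / 2) * (coupling T H u s x * m s x) :=
        (slabContinuous_const _).sub ((slabContinuous_const _).mul hGm)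
      have hmono := hci3.integral_integral_mono (hum0.dtW hT).slabContinuous hTm fun s hs => by
        have hs' := Ioo_subset_Icc_self hs
        have i2 := integrable_torus (hGm.slice hs')
        rw [integral_sub (integrable_const _) (i2.const_mul _), integral_const_mul]
        simp only [hdt0 s hs', integral_const, probReal_univ, one_smul]
        exact hC1 ε hε u m sol s hs
      have e3 : ∫ s in (0 : ℝ)..T, ∫ x, (-C1 - (1 / 2) * (coupling T H u s x * m s x))
          ∂(torusMeasure d) = -(T * C1) -
          (1 / 2) * ∫ s in (0 : ℝ)..T, ∫ x, coupling T H u s x * m s x ∂(torusMeasure d) := by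
        have : -(T * C1) = ∫ _s in (0 : ℝ)..T, -C1 := by simp
        rw [this, ← intervalIntegral.integral_const_mul,
          ← intervalIntegral.integral_sub intervalIntegrable_const (hI2.const_mul _)]
        refine intervalIntegral.integral_congr fun s hs => ?_
        rw [uIcc_of_le hT.le] at hs
        have i2 := integrable_torus (hGm.slice hs)
        rw [integral_sub (integrable_const _) (i2.const_mul _), integral_const_mul]
        simp
      rw [e3, ← hE2] at hmono
      nlinarith [hb2.2]
    have h2 : κ₀ * ∫ x, |u 0 x| ∂(torusMeasure d) ≤ A + T * C1 + B + 2 * Cu := by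
      have hu0 := (hu.slice h0m).continuous
      have h3 : ∫ x, κ₀ * |u 0 x| ∂(torusMeasure d) ≤
          ∫ x, (u 0 x * m0 x + 2 * Cu * m0 x) ∂(torusMeasure d) := by
        refine integral_torus_mono (continuous_const.mul hu0.abs) ((hu0.mul hm0.continuous).add
          (continuous_const.mul hm0.continuous)) fun x => ?_
        have hlow := hCu ε hε u m sol 0 h0m x
        -- The lower bound on u turns the one-sided control of ∫ u(0) m0 into an L¹ bound, using m0
        -- ≥ κ₀.
        have habs : |u 0 x| ≤ u 0 x + 2 * Cu := abs_le.2 ⟨by linarith, by linarith⟩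
        have h0 : 0 ≤ u 0 x + 2 * Cu := (abs_nonneg _).trans habs
        nlinarith [hκ x, mul_le_mul_of_nonneg_left habs hκ₀.le,
          mul_le_mul_of_nonneg_right (hκ x) h0]
      rw [integral_const_mul, integral_add (integrable_torus_mul hu0 hm0.continuous)
        (integrable_torus_mul continuous_const hm0.continuous), integral_const_mul,
        S.data.m0_mass] at h3
      linarith
    have : ∫ x, |u 0 x| ∂(torusMeasure d) ≤ (A + T * C1 + B + 2 * Cu) / κ₀ := by
      rw [le_div_iff₀ hκ₀]; linarith
    linarith

end IsSolution

end Estimates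

end MFG

/-! ### Second-order energy estimate -/

namespace MFG

section SecondOrder

variable {d : ℕ} {T α ε : ℝ} {H : E d → E d → ℝ} {g : ℝ → ℝ} {uT m0 η : E d → ℝ}
  {u m : ℝ → E d → ℝ}

theorem trace_sq_le (A : Matrix (Fin d) (Fin d) ℝ) : A.trace ^ 2 ≤ d * sqNorm A := by
  have h1 : A.trace ^ 2 ≤ d * ∑ i, A i i ^ 2 := by
    have := sq_sum_le_card_mul_sum_sq (s := (Finset.univ : Finset (Fin d))) (f := fun i => A i i)
    simpa [Matrix.trace] using this
  refine h1.trans (mul_le_mul_of_nonneg_left ?_ (Nat.cast_nonneg d))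
  exact Finset.sum_le_sum fun i _ => Finset.single_le_sum (f := fun j => A i j ^ 2)
    (fun j _ => sq_nonneg _) (Finset.mem_univ i)

theorem abs_trace_le (A : Matrix (Fin d) (Fin d) ℝ) : |A.trace| ≤ √d * √(sqNorm A) := by
  rw [← Real.sqrt_mul (Nat.cast_nonneg d), ← Real.sqrt_sq_eq_abs]
  exact Real.sqrt_le_sqrt (trace_sq_le A)

/-- `tr(D²_pp H (D²u)²)` along a solution. -/
noncomputable def hessTrace (H : E d → E d → ℝ) (u : E d → ℝ) (x : E d) : ℝ :=
  (D2ppH H x (gradient u x) * hess u x ^ 2).trace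

theorem hessTrace_nonneg (hH : HamiltonianBasic H) {u : E d → ℝ} (hu : ContDiff ℝ ∞ u) (x : E d) :
    0 ≤ hessTrace H u x :=
  trace_D2ppH_mul_sq_nonneg hH.smooth (fun x => (hH.strictConvex x).convexOn) x _ (hess_isSymm hu x)

/-- Pointwise lower bound for the second-order terms. -/
theorem exists_second_order_pointwise (hH : HamiltonianBasic H) (hA5 : SpaceDerivativeBounds H) :
    ∃ C : ℝ, 0 ≤ C ∧ ∀ x p, ∀ M : Matrix (Fin d) (Fin d) ℝ, M.IsSymm →
      (1 / 2) * (D2ppH H x p * M ^ 2).trace - C * H x p ≤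
        (D2xxH H x p).trace + 2 * (D2pxH H x p * M).trace + (D2ppH H x p * M ^ 2).trace := by
  obtain ⟨C1, hC1⟩ := hA5.dxx
  -- The mixed term carries a factor 2, so δ = 1/4 uses up exactly half of the positive trace. The
  -- assumption bounds the mixed term from above; applied to -M below, it gives the required lower
  -- bound.
  obtain ⟨C2, hC2⟩ := hA5.dpx (1 / 4) (by norm_num)
  refine ⟨√d * (2 * |C1|) + 2 * |C2|, by positivity, fun x p M hM => ?_⟩
  have hH1 := hH.one_le x p
  have h1 := (abs_le.1 (abs_trace_le (D2xxH H x p))).1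
  have h2 : √(sqNorm (D2xxH H x p)) ≤ 2 * |C1| * H x p := by
    refine (hC1 x p).trans ?_
    nlinarith [le_abs_self C1, abs_nonneg C1]
  have h3 := mul_le_mul_of_nonneg_left h2 (Real.sqrt_nonneg (d : ℝ))
  have h4 := hC2 x p (-M) hM.neg
  rw [mul_neg, Matrix.trace_neg, neg_sq] at h4
  have h5 : C2 * H x p ≤ |C2| * H x p :=
    mul_le_mul_of_nonneg_right (le_abs_self C2) (by linarith)
  linarith

theorem slabSmooth_hessTrace (hH : HamiltonianBasic H) (hT : 0 < T) {u : ℝ → E d → ℝ}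
    (hu : SlabSmooth T u) : SlabSmooth T fun t x => hessTrace H (u t) x := by
  have h1 : ∀ i j, SlabSmooth T fun t x => D2ppH H x (gradient (u t) x) i j := fun i j =>
    (((JointSmooth.pd_right hH.smooth j).pd_right i).slabSmooth_comp (hu.gradient hT))
  have h2 : ∀ i j, SlabSmooth T fun t x => hess (u t) x i j := fun i j => (hu.pd hT j).pd hT i
  simp only [hessTrace, Matrix.trace, Matrix.diag, Matrix.mul_apply, sq]
  exact SlabSmooth.sum fun i _ => SlabSmooth.sum fun j _ => (h1 i j).mul
    (SlabSmooth.sum fun k _ => (h2 j k).mul (h2 k i))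

namespace IsSolution

variable (S : Standing T α H g uT m0 η)

include S

/-- Green's formula puts all Laplacians on u and on H(x, Du). Testing the Fokker–Planck equation
with Δu then cancels Δ²u and the term b · DΔu contained in Δ(H(x, Du)), leaving only second
derivatives of H and the coupling. -/
theorem integral_dt_mul_laplacian (sol : IsSolution T H g uT m0 η ε u m) {t : ℝ}
    (ht : t ∈ Icc 0 T) :
    ∫ x, dtW T (fun t x => u t x * ∑ i, pd i (pd i (m t)) x) t x ∂(torusMeasure d) =
      ∫ x, ((D2xxH H x (gradient (u t) x)).trace +
        2 * (D2pxH H x (gradient (u t) x) * hess (u t) x).trace + hessTrace H (u t) x) * m t x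
        ∂(torusMeasure d) -
      ∫ x, coupling T H u t x * ∑ i, pd i (pd i (m t)) x ∂(torusMeasure d) := by
  have hT := S.T_pos
  have hu : SlabSmooth T u := sol.u_smooth
  have hm : SlabSmooth T m := sol.m_smooth
  have hut := hu.slice ht
  have hmt := hm.slice ht
  have pu := sol.u_periodic t ht
  have pm := sol.m_periodic t ht
  have hb := fun i => (slab_b S sol i).slice ht
  have hG := (slab_coupling S sol).slice ht
  have hHs := (slab_H S sol).slice ht
  have pHs : IsPeriodic fun x => H x (gradient (u t) x) :=
    isPeriodic_comp_joint S.ham.periodic (isPeriodic_gradient pu)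
  have hΔu := contDiff_sum_pd_pd hut
  have hΔm := contDiff_sum_pd_pd hmt
  have pΔu := isPeriodic_sum_pd_pd pu
  have hdm := (hm.dtW hT).slice ht
  have pdm := isPeriodic_dtW sol.m_periodic ht
  have hΔΔu := contDiff_sum_pd_pd hΔu
  have hΔH := contDiff_sum_pd_pd hHs
  have hbu : ContDiff ℝ ∞ fun x => ∑ i, DpH H x (gradient (u t) x) i *
      pd i (fun x => ∑ j, pd j (pd j (u t)) x) x :=
    ContDiff.sum fun i _ => (hb i).mul (contDiff_pd hΔu i)
  have e1 : ∀ x, dtW T (fun t x => u t x * ∑ i, pd i (pd i (m t)) x) t x =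
      H x (gradient (u t) x) * ∑ i, pd i (pd i (m t)) x -
      (∑ i, pd i (pd i (u t)) x) * (∑ i, pd i (pd i (m t)) x) -
      coupling T H u t x * (∑ i, pd i (pd i (m t)) x) +
      u t x * ∑ i, pd i (pd i (dtW T m t)) x := fun x => by
    rw [hu.dtW_mul hT (slabSmooth_sum_pd_pd hT hm) ht,
      SlabSmooth.dtW_sum _ hT (fun i _ => (hm.pd hT i).pd hT i) ht]
    simp only [hm.dtW_pd_pd hT ht, coupling]
    ring
  have i1 := integrable_torus_mul hHs.continuous hΔm.continuous
  have i2 := integrable_torus_mul hΔu.continuous hΔm.continuous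
  have i3 := integrable_torus_mul hG.continuous hΔm.continuous
  have i4 := integrable_torus_mul hut.continuous (contDiff_sum_pd_pd hdm).continuous
  simp only [e1]
  rw [integral_add ((i1.sub' i2).sub' i3) i4, integral_sub (i1.sub' i2) i3, integral_sub i1 i2,
    integral_mul_sum_pd_pd hHs hmt pHs pm, integral_mul_sum_pd_pd hΔu hmt pΔu pm,
    integral_mul_sum_pd_pd hut hdm pu pdm, integral_mul_dt S sol hΔu pΔu ht]
  have i5 := integrable_torus_mul hΔH.continuous hmt.continuous
  have i6 := integrable_torus_mul hΔΔu.continuous hmt.continuous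
  have i7 := integrable_torus_mul (hΔΔu.sub hbu).continuous hmt.continuous
  have h := integral_add (i5.sub' i6) i7
  rw [integral_sub i5 i6] at h
  have h' : ∫ x, ((D2xxH H x (gradient (u t) x)).trace +
      2 * (D2pxH H x (gradient (u t) x) * hess (u t) x).trace + hessTrace H (u t) x) * m t x
      ∂(torusMeasure d) = _ := Eq.trans (integral_congr_ae (Eventually.of_forall fun x => by
        simp only [sum_pd_pd_hamiltonian S.ham.smooth hut x, hessTrace]
        ring)) h
  rw [h']
  ring

/-- Second-order a priori estimate. -/
theorem exists_second_order_bound (hA5 : SpaceDerivativeBounds H) :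
    ∃ C : ℝ, 0 ≤ C ∧ ∀ ε, 0 ≤ ε → ∀ u m : ℝ → E d → ℝ, IsSolution T H g uT m0 η ε u m →
      ∫ s in (0 : ℝ)..T, ∫ x, (H x (gradient (u s) x) + hessTrace H (u s) x) * m s x
        ∂(torusMeasure d) ≤ C := by
  have hT := S.T_pos
  have hm0 := S.data.m0_smooth
  obtain ⟨C1, hC10, hC1⟩ := exists_first_order_bound S
  obtain ⟨C2, hC20, hC2⟩ := exists_second_order_pointwise S.ham hA5
  obtain ⟨A, hA0, hA⟩ := (isPeriodic_sum_pd_pd S.data.uT_periodic).exists_bound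
    (contDiff_sum_pd_pd S.data.uT_smooth).continuous
  obtain ⟨B, hB0, hB⟩ := (isPeriodic_sum_pd_pd S.data.m0_periodic).exists_bound
    (contDiff_sum_pd_pd hm0).continuous
  refine ⟨C1 + 2 * (A + B * C1 + C2 * C1), by positivity, fun ε hε u m sol => ?_⟩
  obtain ⟨hH1, hu1⟩ := hC1 ε hε u m sol
  have hu : SlabSmooth T u := sol.u_smooth
  have hm : SlabSmooth T m := sol.m_smooth
  have hTm : T ∈ Icc 0 T := ⟨hT.le, le_rfl⟩
  have h0m : (0 : ℝ) ∈ Icc 0 T := ⟨le_rfl, hT.le⟩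
  have hHm := ((slab_H S sol).mul hm).slabContinuous
  have htr := slabSmooth_hessTrace S.ham hT hu
  have htm := (htr.mul hm).slabContinuous
  have hJ := hu.mul (slabSmooth_sum_pd_pd hT hm)
  obtain ⟨κ, hκ, hκm⟩ := exists_m_lower_bound S sol
  have hE := hJ.integral_sub hT hTm
  have hm_init : m 0 = m0 := funext sol.initial
  have hu_term : u T = uT := funext sol.terminal
  -- boundary terms
  have hb1 : ∫ x, u T x * ∑ i, pd i (pd i (m T)) x ∂(torusMeasure d) ≤ A := by
    rw [integral_mul_sum_pd_pd (hu.slice hTm) (hm.slice hTm) (sol.u_periodic T hTm)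
      (sol.m_periodic T hTm), hu_term]
    have : A = ∫ x, A * m T x ∂(torusMeasure d) := by
      rw [integral_const_mul, integral_m S sol hTm, mul_one]
    rw [this]
    exact integral_torus_mono ((contDiff_sum_pd_pd S.data.uT_smooth).continuous.fun_mul
      (hm.slice hTm).continuous) (continuous_const.fun_mul (hm.slice hTm).continuous) fun x =>
      mul_le_mul_of_nonneg_right (abs_le.1 (hA x)).2 (m_pos S sol hTm x).le
  -- At t = 0 the Laplacian stays on the smooth datum m0, so the L¹ bound on u(0) suffices.
  have hb2 : -(B * C1) ≤ ∫ x, u 0 x * ∑ i, pd i (pd i (m 0)) x ∂(torusMeasure d) := by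
    rw [hm_init]
    have h1 : ∫ x, -(B * |u 0 x|) ∂(torusMeasure d) ≤
        ∫ x, u 0 x * ∑ i, pd i (pd i m0) x ∂(torusMeasure d) := by
      refine integral_torus_mono (continuous_const.fun_mul (hu.slice h0m).continuous.abs).neg
        ((hu.slice h0m).continuous.fun_mul (contDiff_sum_pd_pd hm0).continuous) fun x => ?_
      have h2 : |u 0 x * ∑ i, pd i (pd i m0) x| ≤ B * |u 0 x| := by
        rw [abs_mul, mul_comm]
        exact mul_le_mul_of_nonneg_right (hB x) (abs_nonneg _)
      exact (abs_le.1 h2).1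
    rw [integral_neg, integral_const_mul] at h1
    nlinarith [mul_le_mul_of_nonneg_left hu1 hB0]
  -- inequality at a fixed time
  have hkey : ∀ s ∈ Ioo 0 T, ∫ x, ((1 / 2) * (hessTrace H (u s) x * m s x) -
      C2 * (H x (gradient (u s) x) * m s x)) ∂(torusMeasure d) ≤
      ∫ x, dtW T (fun t x => u t x * ∑ i, pd i (pd i (m t)) x) s x ∂(torusMeasure d) :=
      fun s hs => by
    have hs' := Ioo_subset_Icc_self hs
    have hmt := hm.slice hs'
    have hut := hu.slice hs'
    rw [integral_dt_mul_laplacian S sol hs']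
    have hG0 : ∫ x, coupling T H u s x * ∑ i, pd i (pd i (m s)) x ∂(torusMeasure d) ≤ 0 := by
      have hGeq : coupling T H u s = gEps η g ε (m s) :=
        funext fun x => coupling_eq S sol hs x
      rw [hGeq]
      simp only [Finset.mul_sum]
      rw [integral_finsetSum _ fun i _ => integrable_torus_mul
        (continuous_gEps S.mollifier hε S.power hmt.continuous hκ (hκm s hs'))
        (contDiff_pd (contDiff_pd hmt i) i).continuous]
      exact Finset.sum_nonpos fun i _ => integral_gEps_mul_pd_pd_nonpos S.mollifier hε S.power hmt
        (sol.m_periodic s hs') hκ (hκm s hs') i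
    refine le_trans ?_ (le_sub_self_iff _ |>.2 hG0)
    have e : ∀ x, (D2xxH H x (gradient (u s) x)).trace +
        2 * (D2pxH H x (gradient (u s) x) * hess (u s) x).trace + hessTrace H (u s) x =
        ∑ j, pd j (pd j (fun y => H y (gradient (u s) y))) x -
        ∑ k, DpH H x (gradient (u s) x) k * pd k (fun y => ∑ j, pd j (pd j (u s)) y) x :=
      fun x => by
        rw [sum_pd_pd_hamiltonian S.ham.smooth hut x, hessTrace, add_sub_cancel_right]
    have hc : Continuous fun x => (D2xxH H x (gradient (u s) x)).trace +
        2 * (D2pxH H x (gradient (u s) x) * hess (u s) x).trace + hessTrace H (u s) x := by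
      simp only [e]
      exact (contDiff_sum_pd_pd ((slab_H S sol).slice hs')).continuous.sub
        (continuous_finsetSum _ fun i _ => ((slab_b S sol i).slice hs').continuous.mul
          (contDiff_pd (contDiff_sum_pd_pd hut) i).continuous)
    refine integral_torus_mono ((continuous_const.fun_mul (htm.slice hs')).sub
      (continuous_const.fun_mul (hHm.slice hs'))) (hc.fun_mul hmt.continuous) fun x => ?_
    have h1 := mul_le_mul_of_nonneg_right (hC2 x (gradient (u s) x) (hess (u s) x)
      (hess_isSymm hut x)) (m_pos S sol hs' x).le
    refine le_trans (le_of_eq ?_) h1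
    rw [hessTrace]
    ring
  have hci : SlabContinuous T fun s x => (1 / 2) * (hessTrace H (u s) x * m s x) -
      C2 * (H x (gradient (u s) x) * m s x) :=
    ((slabContinuous_const _).mul htm).sub ((slabContinuous_const _).mul hHm)
  have hint := hci.integral_integral_mono (hJ.dtW hT).slabContinuous hTm hkey
  have hI1 := hHm.intervalIntegrable_integral hTm
  have hI2 := htm.intervalIntegrable_integral hTm
  have e1 : ∫ s in (0 : ℝ)..T, ∫ x, ((1 / 2) * (hessTrace H (u s) x * m s x) -
      C2 * (H x (gradient (u s) x) * m s x)) ∂(torusMeasure d) =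
      (1 / 2) * (∫ s in (0 : ℝ)..T, ∫ x, hessTrace H (u s) x * m s x ∂(torusMeasure d)) -
      C2 * ∫ s in (0 : ℝ)..T, ∫ x, H x (gradient (u s) x) * m s x ∂(torusMeasure d) := by
    rw [← intervalIntegral.integral_const_mul, ← intervalIntegral.integral_const_mul,
      ← intervalIntegral.integral_sub (hI2.const_mul _) (hI1.const_mul _)]
    refine intervalIntegral.integral_congr fun s hs => ?_
    rw [uIcc_of_le hT.le] at hs
    have i1 := integrable_torus (hHm.slice hs)
    have i2 := integrable_torus (htm.slice hs)
    rw [integral_sub (i2.const_mul _) (i1.const_mul _), integral_const_mul, integral_const_mul]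
  have e2 : ∫ s in (0 : ℝ)..T, ∫ x, (H x (gradient (u s) x) + hessTrace H (u s) x) * m s x
      ∂(torusMeasure d) =
      (∫ s in (0 : ℝ)..T, ∫ x, H x (gradient (u s) x) * m s x ∂(torusMeasure d)) +
      ∫ s in (0 : ℝ)..T, ∫ x, hessTrace H (u s) x * m s x ∂(torusMeasure d) := by
    rw [← intervalIntegral.integral_add hI1 hI2]
    refine intervalIntegral.integral_congr fun s hs => ?_
    rw [uIcc_of_le hT.le] at hs
    have i1 := integrable_torus (hHm.slice hs)
    have i2 := integrable_torus (htm.slice hs)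
    rw [← integral_add i1 i2]
    simp only [add_mul]
  rw [e1, ← hE] at hint
  rw [e2]
  nlinarith [mul_le_mul_of_nonneg_left hH1 hC20]

end IsSolution

end SecondOrder

end MFG

namespace MFG

/-! ### Integrability of the density -/

section Density

variable {d : ℕ} {T α ε : ℝ} {H : E d → E d → ℝ} {g : ℝ → ℝ} {uT m0 η : E d → ℝ}
  {u m : ℝ → E d → ℝ}

theorem pd_rpow {f : E d → ℝ} (hf : ContDiff ℝ ∞ f) (pos : ∀ x, 0 < f x) (q : ℝ) (i : Fin d)
    (x : E d) : pd i (fun y => f y ^ q) x = q * f x ^ (q - 1) * pd i f x :=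
  pd_comp (φ := fun z => z ^ q) i (Real.hasDerivAt_rpow_const (Or.inl (pos x).ne'))
    (hf.differentiable (by simp)).differentiableAt

theorem norm_gradient_rpow_sq {f : E d → ℝ} (hf : ContDiff ℝ ∞ f) (pos : ∀ x, 0 < f x) (q : ℝ)
    (x : E d) : ‖gradient (fun y => f y ^ (q / 2)) x‖ ^ 2 =
      (q / 2) ^ 2 * (f x ^ (q - 2) * ∑ i, pd i f x ^ 2) := by
  have h : (f x ^ (q / 2 - 1)) ^ 2 = f x ^ (q - 2) := by
    rw [← Real.rpow_natCast, ← Real.rpow_mul (pos x).le]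
    congr 1
    push_cast
    ring
  rw [norm_gradient_sq]
  simp only [pd_rpow hf pos, mul_pow, h, Finset.mul_sum]
  exact Finset.sum_congr rfl fun i _ => by ring

theorem SlabSmooth.dtW_rpow (hT : 0 < T) {f : ℝ → E d → ℝ} (hf : SlabSmooth T f)
    (pos : ∀ t ∈ Icc 0 T, ∀ x, 0 < f t x) (q : ℝ) {t : ℝ} (ht : t ∈ Icc 0 T) (x : E d) :
    MFG.dtW T (fun t x => f t x ^ q) t x = q * f t x ^ (q - 1) * MFG.dtW T f t x := by
  refine (((hf.hasDerivWithinAt hT ht x).rpow_const (p := q)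
    (Or.inl (pos t ht x).ne')).derivWithin (uniqueDiffOn_Icc hT t ht)).trans ?_
  ring

theorem continuous_rpow {f : E d → ℝ} (hf : Continuous f) (pos : ∀ x, 0 < f x) (q : ℝ) :
    Continuous fun x => f x ^ q := hf.rpow_const fun x => Or.inl (pos x).ne'

namespace IsSolution

variable (S : Standing T α H g uT m0 η)

include S

theorem slabSmooth_rpow (sol : IsSolution T H g uT m0 η ε u m) (q : ℝ) :
    SlabSmooth T fun t x => m t x ^ q :=
  SlabSmooth.rpow sol.m_smooth (fun _ ht x => m_pos S sol ht x) q

theorem slabContinuous_norm_gradient_rpow (sol : IsSolution T H g uT m0 η ε u m) (q : ℝ) :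
    SlabContinuous T fun t x => ‖gradient (fun y => m t y ^ q) x‖ ^ 2 := by
  simp only [norm_gradient_sq]
  simp only [sq]
  exact (SlabSmooth.sum fun i _ => ((slabSmooth_rpow S sol q).pd S.T_pos i).mul
    ((slabSmooth_rpow S sol q).pd S.T_pos i)).slabContinuous

/-- The energy identity for powers of the density. -/
theorem integral_dt_rpow (sol : IsSolution T H g uT m0 η ε u m) (q : ℝ) {t : ℝ}
    (ht : t ∈ Icc 0 T) :
    ∫ x, dtW T (fun t x => m t x ^ q) t x ∂(torusMeasure d) =
      -(q * (q - 1)) * ∫ x, m t x ^ (q - 2) * ∑ i, pd i (m t) x ^ 2 ∂(torusMeasure d) -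
      q * (q - 1) * ∫ x, m t x ^ (q - 1) * ∑ i, DpH H x (gradient (u t) x) i * pd i (m t) x
        ∂(torusMeasure d) := by
  have hT := S.T_pos
  have hm : SlabSmooth T m := sol.m_smooth
  have pos := fun x => m_pos S sol ht x
  have hmt := hm.slice ht
  have pm := sol.m_periodic t ht
  have hb := fun i => (slab_b S sol i).slice ht
  have pb := isPeriodic_DpH S.ham (sol.u_periodic t ht)
  have hψ : ContDiff ℝ ∞ fun x => m t x ^ (q - 1) := hmt.rpow_const_of_ne fun x => (pos x).ne'
  have pψ : IsPeriodic fun x => m t x ^ (q - 1) := pm.comp fun z => z ^ (q - 1)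
  have hdψ : ∀ i x, pd i (fun x => m t x ^ (q - 1)) x = (q - 1) * (m t x ^ (q - 2) * pd i (m t) x) :=
    fun i x => by rw [pd_rpow hmt pos, show q - 1 - 1 = q - 2 by ring, mul_assoc]
  have e : ∀ x, m t x ^ (q - 2) * m t x = m t x ^ (q - 1) := fun x => by
    rw [← Real.rpow_add_one (pos x).ne']; congr 1; ring
  have h1 : ∀ x, dtW T (fun t x => m t x ^ q) t x =
      q * (∑ i, m t x ^ (q - 1) * pd i (pd i (m t)) x +
        ∑ i, m t x ^ (q - 1) * pd i (fun y => m t y * DpH H y (gradient (u t) y) i) x) :=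
    fun x => by
      rw [hm.dtW_rpow hT (fun t ht x => m_pos S sol ht x) q ht, dt_m S sol ht, ← Finset.mul_sum,
        ← Finset.mul_sum]
      ring
  have hmb := fun i => hmt.mul (hb i)
  have i1 : ∀ i ∈ Finset.univ, Integrable (fun x => m t x ^ (q - 1) * pd i (pd i (m t)) x)
      (torusMeasure d) := fun i _ =>
    integrable_torus_mul hψ.continuous (contDiff_pd (contDiff_pd hmt i) i).continuous
  have i2 : ∀ i ∈ Finset.univ, Integrable (fun x => m t x ^ (q - 1) *
      pd i (fun y => m t y * DpH H y (gradient (u t) y) i) x) (torusMeasure d) := fun i _ =>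
    integrable_torus_mul hψ.continuous (contDiff_pd (hmb i) i).continuous
  have hq2 := continuous_rpow hmt.continuous pos (q - 2)
  have i3 : ∀ i ∈ Finset.univ, Integrable (fun x => m t x ^ (q - 2) * pd i (m t) x ^ 2)
      (torusMeasure d) := fun i _ =>
    integrable_torus_mul hq2 ((contDiff_pd hmt i).continuous.pow 2)
  have i4 : ∀ i ∈ Finset.univ, Integrable (fun x => m t x ^ (q - 1) *
      (DpH H x (gradient (u t) x) i * pd i (m t) x)) (torusMeasure d) := fun i _ =>
    integrable_torus_mul hψ.continuous ((hb i).continuous.mul (contDiff_pd hmt i).continuous)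
  have k3 : ∫ x, m t x ^ (q - 2) * ∑ i, pd i (m t) x ^ 2 ∂(torusMeasure d) =
      ∑ i, ∫ x, m t x ^ (q - 2) * pd i (m t) x ^ 2 ∂(torusMeasure d) := by
    simp only [Finset.mul_sum]
    exact integral_finsetSum _ i3
  have k4 : ∫ x, m t x ^ (q - 1) * ∑ i, DpH H x (gradient (u t) x) i * pd i (m t) x
      ∂(torusMeasure d) = ∑ i, ∫ x, m t x ^ (q - 1) *
        (DpH H x (gradient (u t) x) i * pd i (m t) x) ∂(torusMeasure d) := by
    simp only [Finset.mul_sum]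
    exact integral_finsetSum _ i4
  simp only [h1]
  rw [k3, k4, integral_const_mul,
    integral_add (integrable_finsetSum _ i1) (integrable_finsetSum _ i2),
    integral_finsetSum _ i1, integral_finsetSum _ i2]
  have j1 : ∀ i, ∫ x, m t x ^ (q - 1) * pd i (pd i (m t)) x ∂(torusMeasure d) =
      -((q - 1) * ∫ x, m t x ^ (q - 2) * pd i (m t) x ^ 2 ∂(torusMeasure d)) := fun i => by
    rw [integral_mul_pd hψ (contDiff_pd hmt i) pψ (pm.pd i) i, ← integral_const_mul]
    congr 2 with x
    rw [hdψ]; ring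
  have j2 : ∀ i, ∫ x, m t x ^ (q - 1) * pd i (fun y => m t y * DpH H y (gradient (u t) y) i) x
      ∂(torusMeasure d) = -((q - 1) * ∫ x, m t x ^ (q - 1) *
        (DpH H x (gradient (u t) x) i * pd i (m t) x) ∂(torusMeasure d)) := fun i => by
    rw [integral_mul_pd hψ (hmb i) pψ (pm.mul (pb i)) i, ← integral_const_mul]
    congr 2 with x
    rw [hdψ, ← e]; ring
  simp only [j1, j2, Finset.sum_neg_distrib, ← Finset.mul_sum]
  ring

/-- The energy identity with the divergence of the drift. -/
theorem integral_dt_rpow_divergence (sol : IsSolution T H g uT m0 η ε u m) {q : ℝ} (hq : 0 < q)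
    {t : ℝ} (ht : t ∈ Icc 0 T) :
    ∫ x, dtW T (fun t x => m t x ^ q) t x ∂(torusMeasure d) =
      -(4 * (q - 1) / q) * ∫ x, ‖gradient (fun y => m t y ^ (q / 2)) x‖ ^ 2 ∂(torusMeasure d) +
      (q - 1) * ∫ x, m t x ^ q * ∑ i, pd i (fun y => DpH H y (gradient (u t) y) i) x
        ∂(torusMeasure d) := by
  have hm : SlabSmooth T m := sol.m_smooth
  have pos := fun x => m_pos S sol ht x
  have hmt := hm.slice ht
  have pm := sol.m_periodic t ht
  have hb := fun i => (slab_b S sol i).slice ht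
  have pb := isPeriodic_DpH S.ham (sol.u_periodic t ht)
  have hψ : ContDiff ℝ ∞ fun x => m t x ^ q := hmt.rpow_const_of_ne fun x => (pos x).ne'
  have hψ1 := continuous_rpow hmt.continuous pos (q - 1)
  rw [integral_dt_rpow S sol q ht]
  simp only [norm_gradient_rpow_sq hmt pos, integral_const_mul]
  -- Here q m^{q-1} Dm = D(m^q), so one further integration by parts puts the derivative on the
  -- drift.
  have h : q * ∫ x, m t x ^ (q - 1) * ∑ i, DpH H x (gradient (u t) x) i * pd i (m t) x
      ∂(torusMeasure d) = -∫ x, m t x ^ q * ∑ i, pd i (fun y => DpH H y (gradient (u t) y) i) x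
        ∂(torusMeasure d) := by
    simp only [Finset.mul_sum]
    rw [integral_finsetSum _ fun i _ => integrable_torus_mul hψ1
      ((hb i).continuous.fun_mul (contDiff_pd hmt i).continuous),
      integral_finsetSum _ fun i _ => integrable_torus_mul hψ.continuous
        (contDiff_pd (hb i) i).continuous, Finset.mul_sum, ← Finset.sum_neg_distrib]
    refine Finset.sum_congr rfl fun i _ => ?_
    rw [integral_mul_pd hψ (hb i) (pm.comp fun z => z ^ q) (pb i) i, neg_neg,
      ← integral_const_mul]
    congr 1 with x
    rw [pd_rpow hmt pos]
    ring
  have hq' : -(4 * (q - 1) / q) * (q / 2) ^ 2 = -(q * (q - 1)) := by field_simp; ring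
  have h' := congrArg (fun z => (q - 1) * z) h
  simp only at h'
  rw [← mul_assoc (-(4 * (q - 1) / q)), hq']
  linarith

omit S in
/-- A weighted Young inequality. -/
theorem young_absorb {x Z c τ : ℝ} (hx : 0 ≤ x) (hZ : 0 ≤ Z) (hc : 0 < c) (h0 : 0 < τ)
    (h1 : τ < 1) : x * Z ^ τ ≤ c * Z + c ^ (-τ / (1 - τ)) * x ^ (1 / (1 - τ)) := by
  have h1' : 0 < 1 - τ := by linarith
  -- The power of c in the second entry is chosen so that c cancels from the weighted geometric
  -- mean.
  have h := Real.geom_mean_le_arith_mean2_weighted h0.le h1'.le (p₁ := c * Z)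
    (p₂ := c ^ (-τ / (1 - τ)) * x ^ (1 / (1 - τ))) (by positivity) (by positivity) (by ring)
  have e : (c * Z) ^ τ * (c ^ (-τ / (1 - τ)) * x ^ (1 / (1 - τ))) ^ (1 - τ) = x * Z ^ τ := by
    rw [Real.mul_rpow hc.le hZ, Real.mul_rpow (by positivity) (by positivity),
      ← Real.rpow_mul hc.le, ← Real.rpow_mul hx, div_mul_cancel₀ _ h1'.ne',
      div_mul_cancel₀ _ h1'.ne', Real.rpow_one, Real.rpow_neg hc.le]
    have := (Real.rpow_pos_of_pos hc τ).ne'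
    field_simp
  rw [e] at h
  refine h.trans (add_le_add ?_ ?_)
  · exact mul_le_of_le_one_left (by positivity) h1.le
  · exact mul_le_of_le_one_left (by positivity) (by linarith)

omit S in
/-- Interpolated form of the Gagliardo–Nirenberg inequality. -/
theorem exists_integral_sq_le (hd : 2 ≤ d) {θ : ℝ} (hθ : 1 < θ) (C₀ : ℝ) (hC₀ : 0 ≤ C₀) :
    ∃ C : ℝ, 0 ≤ C ∧ ∀ w : E d → ℝ, ContDiff ℝ 1 w → IsPeriodic w → (∀ x, 0 < w x) →
      ∫ x, w x ^ (2 / θ) ∂(torusMeasure d) ≤ C₀ →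
      ∫ x, w x ^ (2 : ℝ) ∂(torusMeasure d) ≤
        C * (∫ x, (‖gradient w x‖ ^ 2 + w x ^ 2) ∂(torusMeasure d)) ^ (1 - 1 / rExp d θ) := by
  have hd' : (2 : ℝ) ≤ d := by exact_mod_cast hd
  have hd0 : (0 : ℝ) < d := by linarith
  have hθ0 : 0 < θ := by linarith
  have hr : 1 < rExp d θ := by
    rw [rExp]; nlinarith [mul_pos hd0 (sub_pos.2 hθ)]
  obtain ⟨C, hC0, hC⟩ := exists_gagliardoNirenberg hd (σ := 2 / θ) (by positivity)
  -- This is the weight placing the exponent 2 between 2/θ and the Gagliardo–Nirenberg exponent 2 +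
  -- 4/(θd).
  set τ : ℝ := 1 - 1 / rExp d θ with hτ
  have hτ0 : 0 ≤ τ := by rw [hτ, sub_nonneg, div_le_one (by linarith)]; exact hr.le
  have hτ1 : τ ≤ 1 := by rw [hτ]; have : 0 < 1 / rExp d θ := by positivity
                         linarith
  refine ⟨C₀ ^ (1 - τ) * (C * C₀ ^ (2 / d : ℝ)) ^ τ, by positivity, fun w hw pw pos hle => ?_⟩
  have hS0 : 0 ≤ ∫ x, w x ^ (2 / θ) ∂(torusMeasure d) :=
    integral_torus_nonneg fun x => Real.rpow_nonneg (pos x).le _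
  have hZ0 : 0 ≤ ∫ x, (‖gradient w x‖ ^ 2 + w x ^ 2) ∂(torusMeasure d) :=
    integral_torus_nonneg fun x => by positivity
  have hX0 : 0 ≤ ∫ x, w x ^ (2 + 2 * (2 / θ) / d) ∂(torusMeasure d) :=
    integral_torus_nonneg fun x => Real.rpow_nonneg (pos x).le _
  have h1 := integral_rpow_interpolate hw.continuous pos (2 / θ) (2 + 2 * (2 / θ) / d) hτ0 hτ1
  have e : (1 - τ) * (2 / θ) + τ * (2 + 2 * (2 / θ) / d) = 2 := by
    have hne : (d : ℝ) * (θ - 1) + 2 ≠ 0 := by nlinarith [mul_pos hd0 (sub_pos.2 hθ)]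
    rw [hτ, rExp]
    field_simp
    ring
  rw [e] at h1
  refine h1.trans ?_
  rw [mul_assoc, ← Real.mul_rpow (by positivity) hZ0]
  refine mul_le_mul (Real.rpow_le_rpow hS0 hle (by linarith)) (Real.rpow_le_rpow hX0 ?_ hτ0)
    (Real.rpow_nonneg hX0 _) (Real.rpow_nonneg hC₀ _)
  refine (hC w hw pw pos).trans (mul_le_mul_of_nonneg_right ?_ hZ0)
  exact mul_le_mul_of_nonneg_left (Real.rpow_le_rpow hS0 hle (by positivity)) hC0.le

/-- The drift term of the energy identity is controlled by the dissipation. -/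
theorem neg_integral_drift_le (sol : IsSolution T H g uT m0 η ε u m) (q : ℝ) {K s : ℝ}
    (hs : s ∈ Icc 0 T)
    (hdr : ∀ᵐ x ∂(torusMeasure d), ‖DpH H x (gradient (u s) x)‖ ^ 2 ≤ K) :
    -∫ x, m s x ^ (q - 1) * ∑ i, DpH H x (gradient (u s) x) i * pd i (m s) x
        ∂(torusMeasure d) ≤ (1 / 2) * (∫ x, m s x ^ (q - 2) * ∑ i, pd i (m s) x ^ 2
          ∂(torusMeasure d)) + K / 2 * ∫ x, m s x ^ q ∂(torusMeasure d) := by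
  have hm : SlabSmooth T m := sol.m_smooth
  have pos := fun x => m_pos S sol hs x
  have hms := hm.slice hs
  have hb := fun i => (slab_b S sol i).slice hs
  have hq2 := continuous_rpow hms.continuous pos (q - 2)
  have hqq := continuous_rpow hms.continuous pos q
  have hsum : Continuous fun x => ∑ i, pd i (m s) x ^ 2 :=
    continuous_finsetSum _ fun i _ => (contDiff_pd hms i).continuous.pow 2
  have hsumb : Continuous fun x => ∑ i, DpH H x (gradient (u s) x) i * pd i (m s) x :=
    continuous_finsetSum _ fun i _ => (hb i).continuous.mul (contDiff_pd hms i).continuous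
  have j1 := integrable_torus_mul hq2 hsum
  have j2 := integrable_torus_mul (continuous_rpow hms.continuous pos (q - 1)) hsumb
  rw [← integral_neg, ← integral_const_mul, ← integral_const_mul,
    ← integral_add (j1.const_mul _) ((integrable_torus hqq).const_mul _)]
  refine integral_mono_ae j2.neg ((j1.const_mul _).fun_add
    ((integrable_torus hqq).const_mul _)) ?_
  filter_upwards [hdr] with x hx
  have e1 : m s x ^ (q - 1) = m s x ^ (q - 2) * m s x := by
    rw [← Real.rpow_add_one (pos x).ne']; congr 1; ring
  have e2 : m s x ^ q = m s x ^ (q - 2) * (m s x * m s x) := by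
    rw [← mul_assoc, ← e1, ← Real.rpow_add_one (pos x).ne']; congr 1; ring
  have hbx : ‖DpH H x (gradient (u s) x)‖ ^ 2 = ∑ i, DpH H x (gradient (u s) x) i ^ 2 := by
    rw [EuclideanSpace.norm_sq_eq]; simp
  -- Completing the square in Dm + m b costs half of the dissipation and K/2 times ∫ m^q.
  have hsq : 0 ≤ ∑ i, (pd i (m s) x + m s x * DpH H x (gradient (u s) x) i) ^ 2 :=
    Finset.sum_nonneg fun i _ => sq_nonneg _
  have hexp : ∑ i, (pd i (m s) x + m s x * DpH H x (gradient (u s) x) i) ^ 2 =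
      ∑ i, pd i (m s) x ^ 2 + 2 * (m s x *
        ∑ i, DpH H x (gradient (u s) x) i * pd i (m s) x) +
      m s x * m s x * ∑ i, DpH H x (gradient (u s) x) i ^ 2 := by
    simp only [Finset.mul_sum, ← Finset.sum_add_distrib]
    exact Finset.sum_congr rfl fun i _ => by ring
  rw [hexp, ← hbx] at hsq
  have hA : 0 ≤ m s x ^ (q - 2) := Real.rpow_nonneg (pos x).le _
  have hmm : 0 ≤ m s x * m s x := mul_self_nonneg _
  have h2 := mul_le_mul_of_nonneg_left hx hmm
  have h3 := mul_nonneg hA (hsq.trans (add_le_add_right h2 _))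
  simp only [e1, e2]
  linarith

/-- The dissipation absorbs the contribution of a bounded drift. -/
theorem exists_integral_dt_rpow_le (hd : 2 ≤ d) {θ β₀ : ℝ} (hθ : 1 < θ) (hβ₀ : 1 ≤ β₀) (C₀ : ℝ)
    (hC₀ : 0 ≤ C₀) : ∃ C : ℝ, 0 ≤ C ∧ ∀ ε, ∀ u m : ℝ → E d → ℝ,
      IsSolution T H g uT m0 η ε u m → ∀ s ∈ Icc 0 T,
      ∫ x, m s x ^ β₀ ∂(torusMeasure d) ≤ C₀ → ∀ K : ℝ, 1 ≤ K →
      (∀ᵐ x ∂(torusMeasure d), ‖DpH H x (gradient (u s) x)‖ ^ 2 ≤ K) →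
      ∫ x, dtW T (fun t x => m t x ^ (θ * β₀)) s x ∂(torusMeasure d) ≤ C * K ^ rExp d θ := by
  have hd0 : (0 : ℝ) < d := by exact_mod_cast (by lia : 0 < d)
  have hr : 1 < rExp d θ := by
    rw [rExp]; nlinarith [mul_pos hd0 (sub_pos.2 hθ)]
  obtain ⟨C2, hC20, hC2⟩ := exists_integral_sq_le hd hθ C₀ hC₀
  set q : ℝ := θ * β₀ with hq
  have hq1 : 1 < q := by rw [hq]; nlinarith
  have hq0 : 0 < q := by linarith
  -- Chosen so that c (q/2)² = q(q-1)/2, the coefficient of the dissipation left after the square is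
  -- completed.
  set c : ℝ := 2 * (q - 1) / q with hc
  have hc0 : 0 < c := div_pos (by linarith) hq0
  set τ : ℝ := 1 - 1 / rExp d θ with hτ
  have h1τ : 1 / (1 - τ) = rExp d θ := by rw [hτ]; simp
  have hτ0 : 0 < τ := by rw [hτ, sub_pos, div_lt_one (by linarith)]; exact hr
  have hτ1 : τ < 1 := by rw [hτ]; have : 0 < 1 / rExp d θ := by positivity
                         linarith
  -- The extra c pays for the zero-order part of the full Sobolev energy; since K ≥ 1, both
  -- contributions fit under k K.
  set k : ℝ := q * (q - 1) / 2 + c with hk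
  have hk0 : 0 < k := by rw [hk]; nlinarith
  set C3 : ℝ := c ^ (-τ / (1 - τ)) * (k * C2) ^ rExp d θ with hC3
  have hC30 : 0 ≤ C3 := by positivity
  refine ⟨C3, hC30, fun ε u m sol s hs hβ K hK hdr => ?_⟩
  have hm : SlabSmooth T m := sol.m_smooth
  have hcross := neg_integral_drift_le S sol q hs hdr
  have pos := fun x => m_pos S sol hs x
  have hms := hm.slice hs
  have hq2 := continuous_rpow hms.continuous pos (q - 2)
  have hqq := continuous_rpow hms.continuous pos q
  have hsum : Continuous fun x => ∑ i, pd i (m s) x ^ 2 :=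
    continuous_finsetSum _ fun i _ => (contDiff_pd hms i).continuous.pow 2
  have j1 := integrable_torus_mul hq2 hsum
  rw [integral_dt_rpow S sol q hs]
  have hZ : ∫ x, (‖gradient (fun y => m s y ^ (q / 2)) x‖ ^ 2 + (m s x ^ (q / 2)) ^ 2)
      ∂(torusMeasure d) = (q / 2) ^ 2 * (∫ x, m s x ^ (q - 2) * ∑ i, pd i (m s) x ^ 2
        ∂(torusMeasure d)) + ∫ x, m s x ^ q ∂(torusMeasure d) := by
    rw [← integral_const_mul, ← integral_add (j1.const_mul _) (integrable_torus hqq)]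
    congr 1 with x
    rw [norm_gradient_rpow_sq hms pos, ← Real.rpow_natCast (m s x ^ (q / 2)),
      ← Real.rpow_mul (pos x).le]
    congr 2
    push_cast
    ring
  have hw : ContDiff ℝ 1 fun x => m s x ^ (q / 2) :=
    (hms.of_le (WithTop.coe_le_coe.2 le_top)).rpow_const_of_ne fun x => (pos x).ne'
  -- With w = m^{q/2} and q = θβ₀, the low-order power w^{2/θ} is m^{β₀}, whose integral is bounded
  -- by hypothesis.
  have hGN := hC2 _ hw ((sol.m_periodic s hs).comp fun z => z ^ (q / 2))
    (fun x => Real.rpow_pos_of_pos (pos x) _) (by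
      refine le_trans (le_of_eq ?_) hβ
      congr 1 with x
      rw [← Real.rpow_mul (pos x).le]
      congr 1
      rw [hq]; field_simp)
  have e3 : ∀ x, (m s x ^ (q / 2)) ^ (2 : ℝ) = m s x ^ q := fun x => by
    rw [← Real.rpow_mul (pos x).le]; congr 1; ring
  simp only [e3] at hGN
  rw [hZ] at hGN
  set D := ∫ x, m s x ^ (q - 2) * ∑ i, pd i (m s) x ^ 2 ∂(torusMeasure d) with hD
  set φ := ∫ x, m s x ^ q ∂(torusMeasure d) with hφ
  have hD0 : 0 ≤ D := integral_torus_nonneg fun x => mul_nonneg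
    (Real.rpow_nonneg (pos x).le _) (Finset.sum_nonneg fun i _ => sq_nonneg _)
  have hφ0 : 0 ≤ φ := integral_torus_nonneg fun x => Real.rpow_nonneg (pos x).le _
  have hZ0 : 0 ≤ (q / 2) ^ 2 * D + φ := by positivity
  have hY := young_absorb (x := k * K * C2) (Z := (q / 2) ^ 2 * D + φ) (c := c) (τ := τ)
    (by positivity) hZ0 hc0 hτ0 hτ1
  rw [h1τ] at hY
  have hkφ : k * K * φ ≤ k * K * C2 * ((q / 2) ^ 2 * D + φ) ^ τ := by
    rw [mul_assoc (k * K)]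
    exact mul_le_mul_of_nonneg_left hGN (by positivity)
  have e4 : c ^ (-τ / (1 - τ)) * (k * K * C2) ^ rExp d θ = C3 * K ^ rExp d θ := by
    rw [hC3, mul_right_comm k K C2, Real.mul_rpow (by positivity) (by positivity), mul_assoc]
  have hkK : q * (q - 1) / 2 * K + c ≤ k * K := by
    rw [hk]; nlinarith
  have hkφ' := mul_le_mul_of_nonneg_right hkK hφ0
  have hcD : c * (q / 2) ^ 2 = q * (q - 1) / 2 := by rw [hc]; field_simp
  have hmul := mul_le_mul_of_nonneg_left hcross (by nlinarith : 0 ≤ q * (q - 1))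
  rw [e4] at hY
  have hcD' : c * ((q / 2) ^ 2 * D) = q * (q - 1) / 2 * D := by rw [← mul_assoc, hcD]
  linarith

/-- Higher integrability of the density in terms of the size of the drift. -/
theorem exists_integral_rpow_le_drift (hd : 2 ≤ d) {θ β₀ : ℝ} (hθ : 1 < θ) (hβ₀ : 1 ≤ β₀) (C₀ : ℝ)
    (hC₀ : 0 ≤ C₀) : ∃ C : ℝ, 0 ≤ C ∧ ∀ ε, ∀ u m : ℝ → E d → ℝ,
      IsSolution T H g uT m0 η ε u m →
      (∀ t ∈ Icc 0 T, ∫ x, m t x ^ β₀ ∂(torusMeasure d) ≤ C₀) → ∀ K : ℝ, 1 ≤ K →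
      (∀ᵐ s ∂(volume.restrict (Ioc 0 T)), ∀ᵐ x ∂(torusMeasure d),
        ‖DpH H x (gradient (u s) x)‖ ^ 2 ≤ K) →
      ∀ t ∈ Icc 0 T, ∫ x, m t x ^ (θ * β₀) ∂(torusMeasure d) ≤ C * K ^ rExp d θ := by
  have hT := S.T_pos
  obtain ⟨C3, hC30, hC3⟩ := exists_integral_dt_rpow_le S hd hθ hβ₀ C₀ hC₀
  have hr : 0 ≤ rExp d θ := by
    rw [rExp]; have := mul_nonneg (Nat.cast_nonneg (α := ℝ) d) (sub_pos.2 hθ).le; linarith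
  set q : ℝ := θ * β₀ with hq
  have hφ0 : 0 ≤ ∫ x, m0 x ^ q ∂(torusMeasure d) :=
    integral_torus_nonneg fun x => Real.rpow_nonneg (S.data.m0_nonneg x) _
  refine ⟨(∫ x, m0 x ^ q ∂(torusMeasure d)) + T * C3, by positivity,
    fun ε u m sol hβ K hK hdrift t ht => ?_⟩
  have hKr : 1 ≤ K ^ rExp d θ := Real.one_le_rpow hK hr
  have hmq := slabSmooth_rpow S sol q
  have hE := hmq.integral_sub hT ht
  have hmono : ∫ s in (0 : ℝ)..t, ∫ x, dtW T (fun t x => m t x ^ q) s x ∂(torusMeasure d) ≤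
      ∫ _s in (0 : ℝ)..t, C3 * K ^ rExp d θ := by
    -- The drift bound comes from essential suprema and holds only for almost every time.
    refine intervalIntegral.integral_mono_ae_restrict ht.1
      ((hmq.dtW hT).slabContinuous.intervalIntegrable_integral ht) intervalIntegrable_const ?_
    have h1 : ∀ᵐ s ∂(volume.restrict (Icc 0 t)), ∀ᵐ x ∂(torusMeasure d),
        ‖DpH H x (gradient (u s) x)‖ ^ 2 ≤ K := by
      rw [← restrict_Ioc_eq_restrict_Icc]
      exact ae_restrict_of_ae_restrict_of_subset (Ioc_subset_Ioc_right ht.2) hdrift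
    filter_upwards [h1, ae_restrict_mem measurableSet_Icc] with s hs hs'
    have hsT : s ∈ Icc 0 T := ⟨hs'.1, hs'.2.trans ht.2⟩
    exact hC3 ε u m sol s hsT (hβ s hsT) K hK hs
  rw [intervalIntegral.integral_const, sub_zero, smul_eq_mul] at hmono
  simp only [sol.initial] at hE
  have hle : t * (C3 * K ^ rExp d θ) ≤ T * (C3 * K ^ rExp d θ) :=
    mul_le_mul_of_nonneg_right ht.2 (by positivity)
  nlinarith [mul_le_mul_of_nonneg_left hKr hφ0]

end IsSolution

end Density

end MFG

namespace MFG

/-! ### A closed bound for the energy -/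

/-- Take l = R/(4b). The linear term is R/4 and the last one is P R^{1-μ}, which is at most R/4 once
R^μ ≥ 4P. So either R is below that threshold or R ≤ A + R/2. -/
theorem le_of_sublinear_bound {R A b μ : ℝ} (hb : 0 < b) (hμ : 0 < μ) (hR : 1 ≤ R)
    (h : ∀ l, 0 < l → R ≤ A + b * l + b * l ^ (-(1 + μ)) * R ^ 2) :
    R ≤ max (2 * A) ((4 * (b * (4 * b) ^ (1 + μ))) ^ (1 / μ)) := by
  have hR0 : 0 < R := by linarith
  set P := b * (4 * b) ^ (1 + μ) with hP
  have hP0 : 0 < P := by positivity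
  rcases le_total R ((4 * P) ^ (1 / μ)) with hle | hle
  · exact hle.trans (le_max_right _ _)
  · refine le_trans ?_ (le_max_left _ _)
    have h1 := h (R / (4 * b)) (by positivity)
    have h2 : b * (R / (4 * b)) = R / 4 := by field_simp
    have h3 : (R / (4 * b)) ^ (-(1 + μ)) * R ^ 2 = (4 * b) ^ (1 + μ) * R ^ (1 - μ) := by
      rw [Real.div_rpow hR0.le (by positivity), Real.rpow_neg (by positivity : 0 ≤ 4 * b),
        div_inv_eq_mul, mul_comm (R ^ _), mul_assoc, ← Real.rpow_natCast, ← Real.rpow_add hR0]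
      congr 2
      push_cast
      ring
    have h4 : 4 * P ≤ R ^ μ := by
      have := Real.rpow_le_rpow (by positivity) hle hμ.le
      rwa [← Real.rpow_mul (by positivity), one_div_mul_cancel hμ.ne', Real.rpow_one] at this
    have h5 : R ^ (1 - μ) * R ^ μ = R := by
      rw [← Real.rpow_add hR0, sub_add_cancel, Real.rpow_one]
    have h6 := mul_le_mul_of_nonneg_left h4 (Real.rpow_nonneg hR0.le (1 - μ))
    rw [mul_assoc b, h3, h2, ← mul_assoc b, ← hP] at h1
    rw [h5] at h6
    linarith

/-- A superlinear energy inequality with an integrable forcing closes. -/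
theorem exists_energy_bound {T c k G M φ₀ μ δ : ℝ} (hT : 0 < T) (hc : 0 < c) (hk : 0 < k)
    (hG : 0 ≤ G) (hM : 0 ≤ M) (hμ : 0 < μ) (hδ0 : 0 ≤ δ) (hδ1 : δ ≤ 1) :
    ∃ C : ℝ, 0 ≤ C ∧ ∀ φ D B e : ℝ → ℝ, ContinuousOn φ (Icc 0 T) → ContinuousOn D (Icc 0 T) →
      ContinuousOn B (Icc 0 T) → ContinuousOn e (Icc 0 T) →
      (∀ t ∈ Icc 0 T, 0 ≤ φ t) → (∀ t ∈ Icc 0 T, 0 ≤ D t) → (∀ t ∈ Icc 0 T, 0 ≤ B t) →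
      (∀ t ∈ Icc 0 T, φ t + c * ∫ s in (0 : ℝ)..t, D s ≤ φ₀ + k * ∫ s in (0 : ℝ)..t, B s) →
      (∀ s ∈ Icc 0 T, ∀ l, 0 < l →
        B s ≤ l * e s + l ^ (-(1 + μ)) * (1 + G * φ s ^ δ * (D s + φ s))) →
      ∫ s in (0 : ℝ)..T, e s ≤ M → ∀ t ∈ Icc 0 T, φ t ≤ C := by
  -- Time integration of 1 + G φ^δ (D + φ), with φ ≤ R, φ^δ ≤ R and ∫ D ≤ R/c, gives at most M' R².
  set M' : ℝ := T + G * (1 / c + T) with hM'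
  have hM'0 : 0 < M' := by positivity
  set b : ℝ := k * (M + M') with hb
  have hb0 : 0 < b := by positivity
  refine ⟨max (max (2 * (φ₀ + 1)) ((4 * (b * (4 * b) ^ (1 + μ))) ^ (1 / μ))) 0, le_max_right _ _,
    fun φ D B e hφc hDc hBc hec hφ0 hD0 hB0 hen hBl heM t ht => le_trans ?_ (le_max_left _ _)⟩
  have hTm : T ∈ Icc 0 T := ⟨hT.le, le_rfl⟩
  have ii : ∀ {f : ℝ → ℝ}, ContinuousOn f (Icc 0 T) → ∀ {t}, t ∈ Icc 0 T →
      IntervalIntegrable f volume 0 t := fun hf t ht =>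
    (hf.mono (by rw [uIcc_of_le ht.1]; exact Icc_subset_Icc_right ht.2)).intervalIntegrable
  have inn : ∀ {f : ℝ → ℝ}, (∀ t ∈ Icc 0 T, 0 ≤ f t) → ∀ {t}, t ∈ Icc 0 T →
      0 ≤ ∫ s in (0 : ℝ)..t, f s := fun hf t ht =>
    intervalIntegral.integral_nonneg ht.1 fun s hs => hf s ⟨hs.1, hs.2.trans ht.2⟩
  have hφR0 : ∀ t ∈ Icc 0 T, φ t ≤ φ₀ + k * ∫ s in (0 : ℝ)..T, B s := fun t ht => by
    have h1 := hen t ht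
    have h2 := mul_nonneg hc.le (inn hD0 ht)
    have h3 : ∫ s in (0 : ℝ)..t, B s ≤ ∫ s in (0 : ℝ)..T, B s :=
      intervalIntegral.integral_mono_interval le_rfl ht.1 ht.2
        ((ae_restrict_mem measurableSet_Ioc).mono fun s hs => hB0 s (Ioc_subset_Icc_self hs))
        (ii hBc hTm)
    have h4 := mul_le_mul_of_nonneg_left h3 hk.le
    linarith
  have hDR0 : c * ∫ s in (0 : ℝ)..T, D s ≤ φ₀ + k * ∫ s in (0 : ℝ)..T, B s := by
    linarith [hen T hTm, hφ0 T hTm]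
  -- R bounds both sup φ and c ∫ D. The maximum with 1 allows φ^δ ≤ R for δ ≤ 1 and accounts for the
  -- + 1 in the final constant.
  set R := max (φ₀ + k * ∫ s in (0 : ℝ)..T, B s) 1 with hR
  have hR1 : 1 ≤ R := le_max_right _ _
  have hφR : ∀ t ∈ Icc 0 T, φ t ≤ R := fun t ht => (hφR0 t ht).trans (le_max_left _ _)
  have hDR : ∫ s in (0 : ℝ)..T, D s ≤ R / c := by
    rw [le_div_iff₀ hc, mul_comm]
    exact hDR0.trans (le_max_left _ _)
  refine (hφR t ht).trans (le_of_sublinear_bound hb0 hμ hR1 fun l hl => ?_)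
  set L := l ^ (-(1 + μ)) with hL
  have hL0 : 0 < L := Real.rpow_pos_of_pos hl _
  have hB1 : ∀ s ∈ Icc 0 T, B s ≤ l * e s + L * (1 + G * R * (D s + R)) := fun s hs => by
    refine (hBl s hs l hl).trans (add_le_add_right (mul_le_mul_of_nonneg_left
      (add_le_add_right ?_ _) hL0.le) _)
    have hδ : φ s ^ δ ≤ R :=
      (Real.rpow_le_rpow (hφ0 s hs) (hφR s hs) hδ0).trans (Real.rpow_le_self_of_one_le hR1 hδ1)
    have := hφ0 s hs
    have := hD0 s hs
    exact mul_le_mul (mul_le_mul_of_nonneg_left hδ hG) (add_le_add_right (hφR s hs) _)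
      (by positivity) (by positivity)
  have hint : ∫ s in (0 : ℝ)..T, B s ≤
      ∫ s in (0 : ℝ)..T, (l * e s + L * (1 + G * R * (D s + R))) :=
    intervalIntegral.integral_mono_on hT.le (ii hBc hTm) (ii (by fun_prop) hTm) hB1
  have hDi := ii hDc hTm
  have hei := ii hec hTm
  have heq : ∫ s in (0 : ℝ)..T, (l * e s + L * (1 + G * R * (D s + R))) =
      l * (∫ s in (0 : ℝ)..T, e s) + L * (T + G * R * ((∫ s in (0 : ℝ)..T, D s) + T * R)) := by
    have e1 : ∀ s, l * e s + L * (1 + G * R * (D s + R)) =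
        l * e s + L * G * R * D s + L * (1 + G * R * R) := fun s => by ring
    simp only [e1]
    rw [intervalIntegral.integral_add ((hei.const_mul _).add (hDi.const_mul _))
      intervalIntegrable_const, intervalIntegral.integral_add (hei.const_mul _) (hDi.const_mul _),
      intervalIntegral.integral_const_mul, intervalIntegral.integral_const_mul,
      intervalIntegral.integral_const, smul_eq_mul, sub_zero]
    ring
  rw [heq] at hint
  have hR2 : 1 ≤ R ^ 2 := one_le_pow₀ hR1
  have hb1 : T + G * R * ((∫ s in (0 : ℝ)..T, D s) + T * R) ≤ M' * R ^ 2 := by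
    have h1 : G * R * ((∫ s in (0 : ℝ)..T, D s) + T * R) ≤ G * R * (R / c + T * R) :=
      mul_le_mul_of_nonneg_left (by linarith) (by positivity)
    have h2 : G * R * (R / c + T * R) = G * (1 / c + T) * R ^ 2 := by ring
    rw [hM', add_mul, ← h2]
    have := mul_le_mul_of_nonneg_left hR2 hT.le
    linarith
  have h1 : ∫ s in (0 : ℝ)..T, B s ≤ l * M + L * (M' * R ^ 2) :=
    hint.trans (add_le_add (mul_le_mul_of_nonneg_left heM hl.le)
      (mul_le_mul_of_nonneg_left hb1 hL0.le))
  have h2 := mul_le_mul_of_nonneg_left h1 hk.le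
  have hφ₀ : 0 ≤ φ₀ := by
    have := hen 0 ⟨le_rfl, hT.le⟩
    simp only [intervalIntegral.integral_same, mul_zero, add_zero] at this
    exact (hφ0 0 ⟨le_rfl, hT.le⟩).trans this
  have h3 : R ≤ φ₀ + k * (∫ s in (0 : ℝ)..T, B s) + 1 := by
    have := mul_nonneg hk.le (inn hB0 hTm)
    exact max_le (by linarith) (by linarith)
  have h4 : k * (l * M + L * (M' * R ^ 2)) ≤ b * l + b * L * R ^ 2 := by
    have h5 : 0 ≤ k * M' * l := by positivity
    have h6 : 0 ≤ k * M * L * R ^ 2 := by positivity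
    rw [hb]
    linarith
  linarith

/-! ### Integrability of the density without a bound on the drift -/

section

variable {d : ℕ} {T α ε μ : ℝ} {H : E d → E d → ℝ} {g : ℝ → ℝ} {uT m0 η : E d → ℝ}
  {u m : ℝ → E d → ℝ}

theorem sqrt_le_mul_rpow {s C E a : ℝ} (hE : 0 ≤ E) (h : s ≤ C * E ^ (2 * a)) :
    √s ≤ √|C| * E ^ a := by
  refine (Real.sqrt_le_sqrt (h.trans (mul_le_mul_of_nonneg_right (le_abs_self C)
    (Real.rpow_nonneg hE _)))).trans ?_
  rw [Real.sqrt_mul (abs_nonneg C), mul_comm 2 a, Real.rpow_mul hE, Real.rpow_two,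
    Real.sqrt_sq (Real.rpow_nonneg hE _)]

/-- The divergence of the drift is controlled by the second-order energy density. -/
theorem exists_abs_sum_pd_DpH_le (hH : HamiltonianBasic H) (hμ : 0 < μ)
    (hA9 : SecondDerivativeBounds H μ) :
    ∃ C : ℝ, 0 ≤ C ∧ ∀ u : E d → ℝ, ContDiff ℝ ∞ u → ∀ x,
      |∑ i, pd i (fun y => DpH H y (gradient u y) i) x| ≤
        C * (H x (gradient u x) + hessTrace H u x) ^ ((1 + μ) / (2 + μ)) := by
  obtain ⟨C1, hC1⟩ := hA9.dxp
  obtain ⟨C2, hC2⟩ := hA9.dpp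
  refine ⟨√d * √|C1| + √d * √|C2|, by positivity, fun u hu x => ?_⟩
  have hH1 := hH.one_le x (gradient u x)
  have hh := hessTrace_nonneg hH hu x
  set h := H x (gradient u x) with hh'
  set z := hessTrace H u x with hz
  have hE0 : 0 ≤ h + z := by linarith
  have ha : (2 + 2 * μ) / (2 + μ) = 2 * ((1 + μ) / (2 + μ)) := by ring
  have h1 : √(sqNorm (D2xpH H x (gradient u x))) ≤
      √|C1| * (h + z) ^ ((1 + μ) / (2 + μ)) := by
    refine (sqrt_le_mul_rpow (by linarith) (ha ▸ hC1 x (gradient u x))).trans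
      (mul_le_mul_of_nonneg_left ?_ (Real.sqrt_nonneg _))
    exact Real.rpow_le_rpow (by linarith) (by linarith) (by positivity)
  have h2 : √(sqNorm (D2ppH H x (gradient u x) * hess u x)) ≤
      √|C2| * (h + z) ^ ((1 + μ) / (2 + μ)) := by
    have := hC2 x (gradient u x) _ (hess_isSymm hu x)
    rw [Matrix.mul_assoc, ← sq] at this
    rw [← abs_abs C2]
    refine sqrt_le_mul_rpow hE0 ?_
    change _ ≤ C2 * h ^ (μ / (2 + μ)) * z at this
    refine this.trans ?_
    -- The exponents match: μ/(2+μ) + 1 = 2(1+μ)/(2+μ), the square of the power also governing D²_xp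
    -- H.
    have e : (h + z) ^ (2 * ((1 + μ) / (2 + μ))) = (h + z) ^ (μ / (2 + μ)) * (h + z) := by
      rw [← Real.rpow_add_one (by linarith)]
      congr 1
      field_simp
      ring
    rw [e, mul_assoc]
    have h3 : h ^ (μ / (2 + μ)) * z ≤ (h + z) ^ (μ / (2 + μ)) * (h + z) :=
      mul_le_mul (Real.rpow_le_rpow (by linarith) (by linarith) (by positivity)) (by linarith)
        hh (Real.rpow_nonneg hE0 _)
    exact mul_le_mul (le_abs_self C2) h3
      (mul_nonneg (Real.rpow_nonneg (by linarith) _) hh) (abs_nonneg _)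
  rw [sum_pd_DpH hH.smooth hu]
  refine (abs_add_le _ _).trans ?_
  rw [add_mul, mul_assoc, mul_assoc]
  exact add_le_add
    ((abs_trace_le _).trans (mul_le_mul_of_nonneg_left h1 (Real.sqrt_nonneg _)))
    ((abs_trace_le _).trans (mul_le_mul_of_nonneg_left h2 (Real.sqrt_nonneg _)))

/-- Young's inequality for the divergence term. -/
theorem rpow_mul_rpow_le {z E l β Q : ℝ} (hz : 0 < z) (hE : 0 < E) (hl : 0 < l) (hμ : 0 < μ)
    (hβ : 1 ≤ β) (hQ : β * (2 + μ) - (1 + μ) ≤ Q) :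
    z ^ β * E ^ ((1 + μ) / (2 + μ)) ≤ l * (E * z) + l ^ (-(1 + μ)) * (1 + z ^ Q) := by
  have h2 : 0 < 2 + μ := by linarith
  set a := (1 + μ) / (2 + μ) with ha
  have h1a : 1 - a = 1 / (2 + μ) := by rw [ha]; field_simp; ring
  -- One factor z^a is paired with E^a to form the integrable quantity E z. As 1/(1-a) = 2 + μ, the
  -- remainder has exponent (β-a)(2+μ) = β(2+μ) - (1+μ).
  have h := IsSolution.young_absorb (x := z ^ (β - a)) (Z := E * z) (c := l) (τ := a)
    (by positivity) (by positivity) hl (by positivity)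
    (by rw [ha, div_lt_one h2]; linarith)
  rw [Real.mul_rpow hE.le hz.le, mul_left_comm, ← Real.rpow_add hz, sub_add_cancel,
    mul_comm (E ^ a)] at h
  have e1 : -a / (1 - a) = -(1 + μ) := by rw [h1a, ha]; field_simp
  have e2 : (z ^ (β - a)) ^ (1 / (1 - a)) = z ^ (β * (2 + μ) - (1 + μ)) := by
    rw [← Real.rpow_mul hz.le, h1a, ha]
    congr 1
    field_simp
  rw [e1, e2] at h
  refine h.trans (add_le_add_right (mul_le_mul_of_nonneg_left ?_ (by positivity)) _)
  have hz' := Real.rpow_nonneg hz.le Q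
  rcases le_total z 1 with hz1 | hz1
  · have := Real.rpow_le_one (z := β * (2 + μ) - (1 + μ)) hz.le hz1 (by nlinarith)
    linarith
  · have := Real.rpow_le_rpow_of_exponent_le hz1 hQ
    linarith

namespace IsSolution

variable (S : Standing T α H g uT m0 η)

include S

/-- The density is bounded in `L^β` for every `β` below the critical exponent. -/
theorem exists_integral_rpow_le (hd : 2 ≤ d) (hA5 : SpaceDerivativeBounds H) (hμ : 0 < μ)
    (hA9 : SecondDerivativeBounds H μ) {β : ℝ} (hβ1 : 1 < β)
    (hβ : β * (d * (1 + μ) - 2) ≤ d * (1 + μ)) :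
    ∃ C : ℝ, 0 ≤ C ∧ ∀ ε, 0 ≤ ε → ∀ u m : ℝ → E d → ℝ, IsSolution T H g uT m0 η ε u m →
      ∀ t ∈ Icc 0 T, ∫ x, m t x ^ β ∂(torusMeasure d) ≤ C := by
  have hT := S.T_pos
  have hd' : (2 : ℝ) ≤ d := by exact_mod_cast hd
  have hd0 : (0 : ℝ) < d := by linarith
  have hβ0 : 0 < β := by linarith
  obtain ⟨M, hM0, hM⟩ := exists_second_order_bound S hA5
  obtain ⟨C1, hC10, hC1⟩ := exists_abs_sum_pd_DpH_le S.ham hμ hA9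
  -- With w = m^{β/2} and σ = 2, the low-order norm is the energy ∫ m^β itself, entering with power
  -- 2/d ≤ 1.
  obtain ⟨G, hG0, hG⟩ := exists_gagliardoNirenberg hd (σ := 2) two_pos
  set a : ℝ := (1 + μ) / (2 + μ) with ha
  have hk : 0 < (β - 1) * (C1 + 1) := mul_pos (by linarith) (by linarith)
  obtain ⟨C, hC0, hC⟩ := exists_energy_bound (T := T) (c := 4 * (β - 1) / β)
    (k := (β - 1) * (C1 + 1)) (G := G) (M := M) (φ₀ := ∫ x, m0 x ^ β ∂(torusMeasure d)) (μ := μ)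
    (δ := 2 / d) hT (div_pos (by linarith) hβ0) hk hG0.le hM0 hμ (by positivity)
    ((div_le_one hd0).2 hd')
  refine ⟨C, hC0, fun ε hε u m sol => ?_⟩
  have hm : SlabSmooth T m := sol.m_smooth
  have hu : SlabSmooth T u := sol.u_smooth
  have pos : ∀ t ∈ Icc 0 T, ∀ x, 0 < m t x := fun t ht x => m_pos S sol ht x
  have hE : SlabSmooth T fun t x => H x (gradient (u t) x) + hessTrace H (u t) x :=
    (slab_H S sol).add (slabSmooth_hessTrace S.ham hT hu)
  have hEpos : ∀ t ∈ Icc 0 T, ∀ x, 0 < H x (gradient (u t) x) + hessTrace H (u t) x :=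
    fun t ht x => by
      linarith [S.ham.one_le x (gradient (u t) x), hessTrace_nonneg S.ham (hu.slice ht) x]
  have hmβ := slabSmooth_rpow S sol β
  have hB := hmβ.mul (hE.rpow hEpos a)
  have hD := slabContinuous_norm_gradient_rpow S sol (β / 2)
  have hEm := hE.mul hm
  refine hC (fun t => ∫ x, m t x ^ β ∂(torusMeasure d))
    (fun t => ∫ x, ‖gradient (fun y => m t y ^ (β / 2)) x‖ ^ 2 ∂(torusMeasure d))
    (fun t => ∫ x, m t x ^ β * (H x (gradient (u t) x) + hessTrace H (u t) x) ^ a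
      ∂(torusMeasure d))
    (fun t => ∫ x, (H x (gradient (u t) x) + hessTrace H (u t) x) * m t x ∂(torusMeasure d))
    hmβ.slabContinuous.continuousOn_integral hD.continuousOn_integral
    hB.slabContinuous.continuousOn_integral hEm.slabContinuous.continuousOn_integral
    (fun t ht => integral_torus_nonneg fun x => Real.rpow_nonneg (pos t ht x).le _)
    (fun t ht => integral_torus_nonneg fun x => by positivity)
    (fun t ht => integral_torus_nonneg fun x => mul_nonneg (Real.rpow_nonneg (pos t ht x).le _)
      (Real.rpow_nonneg (hEpos t ht x).le _))
    (fun t ht => ?_) (fun s hs l hl => ?_) (hM ε hε u m sol)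
  · have hsub := hmβ.integral_sub hT ht
    simp only [sol.initial] at hsub
    have hDi := hD.intervalIntegrable_integral ht
    have hBi := hB.slabContinuous.intervalIntegrable_integral ht
    have hmono : ∫ s in (0 : ℝ)..t, ∫ x, dtW T (fun t x => m t x ^ β) s x ∂(torusMeasure d) ≤
        ∫ s in (0 : ℝ)..t, (-(4 * (β - 1) / β) *
          (∫ x, ‖gradient (fun y => m s y ^ (β / 2)) x‖ ^ 2 ∂(torusMeasure d)) +
          (β - 1) * (C1 + 1) * ∫ x, m s x ^ β *
            (H x (gradient (u s) x) + hessTrace H (u s) x) ^ a ∂(torusMeasure d)) := by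
      refine intervalIntegral.integral_mono_on ht.1
        ((hmβ.dtW hT).slabContinuous.intervalIntegrable_integral ht)
        ((hDi.const_mul _).add (hBi.const_mul _)) fun s hs => ?_
      have hs' : s ∈ Icc 0 T := ⟨hs.1, hs.2.trans ht.2⟩
      rw [integral_dt_rpow_divergence S sol hβ0 hs', mul_assoc (β - 1)]
      refine add_le_add_right (mul_le_mul_of_nonneg_left ?_ (by linarith)) _
      rw [← integral_const_mul]
      refine integral_torus_mono ?_ (((hB.slice hs').continuous).const_mul _) fun x => ?_
      · exact (hmβ.slice hs').continuous.fun_mul (continuous_finsetSum _ fun i _ =>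
          (contDiff_pd ((slab_b S sol i).slice hs') i).continuous)
      · rw [mul_left_comm]
        refine mul_le_mul_of_nonneg_left ?_ (Real.rpow_nonneg (pos s hs' x).le _)
        refine (le_abs_self _).trans ((hC1 _ (hu.slice hs') x).trans ?_)
        exact mul_le_mul_of_nonneg_right (by linarith) (Real.rpow_nonneg (hEpos s hs' x).le _)
    rw [intervalIntegral.integral_add (hDi.const_mul _) (hBi.const_mul _),
      intervalIntegral.integral_const_mul, intervalIntegral.integral_const_mul] at hmono
    linarith
  · have hms := hm.slice hs
    -- The restriction on β is used here: the exponent left by Young's inequality must not exceed β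
    -- + 2β/d from Gagliardo–Nirenberg.
    have hQ : β * (2 + μ) - (1 + μ) ≤ β / 2 * (2 + 2 * 2 / d) := by
      have : β / 2 * (2 + 2 * 2 / d) = β + 2 * β / d := by ring
      rw [this, ← sub_le_iff_le_add', le_div_iff₀ hd0]
      linarith
    have hcQ := continuous_rpow hms.continuous (pos s hs) (β / 2 * (2 + 2 * 2 / d))
    have hc0 := (hEm.slice hs).continuous
    have h1 : ∫ x, m s x ^ β * (H x (gradient (u s) x) + hessTrace H (u s) x) ^ a
        ∂(torusMeasure d) ≤ ∫ x, (l * ((H x (gradient (u s) x) + hessTrace H (u s) x) * m s x) +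
          l ^ (-(1 + μ)) * (1 + m s x ^ (β / 2 * (2 + 2 * 2 / d)))) ∂(torusMeasure d) :=
      integral_torus_mono (hB.slice hs).continuous
        ((hc0.const_mul _).add ((continuous_const.add hcQ).const_mul _)) fun x =>
        rpow_mul_rpow_le (pos s hs x) (hEpos s hs x) hl hμ hβ1.le hQ
    rw [integral_add ((integrable_torus hc0).const_mul _)
      (((integrable_const _).fun_add (integrable_torus hcQ)).const_mul _), integral_const_mul,
      integral_const_mul, integral_add (integrable_const _) (integrable_torus hcQ)] at h1
    simp only [integral_const, probReal_univ, one_smul] at h1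
    refine h1.trans (add_le_add_right (mul_le_mul_of_nonneg_left (add_le_add_right ?_ _)
      (Real.rpow_nonneg hl.le _)) _)
    have hw : ContDiff ℝ 1 fun x => m s x ^ (β / 2) :=
      (hms.of_le (WithTop.coe_le_coe.2 le_top)).rpow_const_of_ne fun x => (pos s hs x).ne'
    have hGN := hG _ hw ((sol.m_periodic s hs).comp fun z => z ^ (β / 2))
      (fun x => Real.rpow_pos_of_pos (pos s hs x) _)
    have e2 : ∀ x, (m s x ^ (β / 2)) ^ 2 = m s x ^ β := fun x => by
      rw [← Real.rpow_two, ← Real.rpow_mul (pos s hs x).le]; congr 1; ring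
    simp only [← Real.rpow_mul (pos s hs _).le, e2] at hGN
    rw [integral_add (integrable_torus (hD.slice hs))
      (integrable_torus (hmβ.slice hs).continuous), div_mul_cancel₀ β two_ne_zero] at hGN
    exact hGN

end IsSolution

end

end MFG

/-! ### From gradient bounds to integrability of the coupling -/

namespace MFG

section

variable {d : ℕ} {T α ε μ : ℝ} {H : E d → E d → ℝ} {g : ℝ → ℝ} {uT m0 η : E d → ℝ}
  {u m : ℝ → E d → ℝ}

/-- The growth of `D_p H`. -/
theorem exists_norm_DpH_sq_le (hA1 : HamiltonianBasic H) (hA7 : SuperquadraticGrowth H μ)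
    (hA8 : DpBound H μ) : ∃ C : ℝ, 1 ≤ C ∧ ∀ N : ℝ, 0 ≤ N → ∀ x p : E d, ‖p‖ ≤ N →
      ‖DpH H x p‖ ^ 2 ≤ C * (1 + N ^ (2 + 2 * μ)) := by
  obtain ⟨c₁, -, C₁, -, c₂, hc₂, C₂, hC₂, hgr⟩ := hA7.growth
  obtain ⟨C, hC⟩ := hA8
  have hμ := hA7.pos
  refine ⟨|C| * (c₂ + C₂ + 1) + 1, by linarith [show 0 ≤ |C| * (c₂ + C₂ + 1) by positivity],
    fun N hN x p hp => ?_⟩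
  have hH : H x p ≤ c₂ * N ^ (2 + μ) + C₂ := (hgr x p).2.trans (add_le_add_left
    (mul_le_mul_of_nonneg_left (Real.rpow_le_rpow (norm_nonneg p) hp (by linarith)) hc₂) _)
  have hpμ : ‖p‖ ^ μ ≤ N ^ μ := Real.rpow_le_rpow (norm_nonneg p) hp hμ.le
  have hH0 : 0 ≤ H x p := zero_le_one.trans (hA1.one_le x p)
  set Y := N ^ (2 + 2 * μ) with hY
  have hY0 : 0 ≤ Y := Real.rpow_nonneg hN _
  have h1 : ‖p‖ ^ μ * H x p ≤ N ^ μ * (c₂ * N ^ (2 + μ) + C₂) :=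
    mul_le_mul hpμ hH hH0 (Real.rpow_nonneg hN _)
  have h2 : N ^ μ * N ^ (2 + μ) = Y := by
    rw [← Real.rpow_add_of_nonneg hN hμ.le (by linarith)]; congr 1; ring
  have h3 : N ^ μ ≤ 1 + Y := by
    rcases le_total N 1 with h | h
    · linarith [Real.rpow_le_one hN h hμ.le]
    · linarith [Real.rpow_le_rpow_of_exponent_le h (by linarith : μ ≤ 2 + 2 * μ)]
  have h4 : ‖p‖ ^ μ * H x p ≤ c₂ * Y + C₂ * (1 + Y) := by
    have h5 := mul_le_mul_of_nonneg_left h3 hC₂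
    have h6 : N ^ μ * (c₂ * N ^ (2 + μ) + C₂) = c₂ * (N ^ μ * N ^ (2 + μ)) + C₂ * N ^ μ := by ring
    rw [h6, h2] at h1
    linarith
  have hC' := le_abs_self C
  have hp0 : 0 ≤ ‖p‖ ^ μ * H x p := by positivity
  have h5 := mul_le_mul_of_nonneg_right hC' hp0
  have h6 := mul_le_mul_of_nonneg_left h4 (abs_nonneg C)
  have h7 := hC x p
  have h8 : 0 ≤ |C| * (c₂ + Y) := by positivity
  linarith

/-- For d ≤ 1 the denominator d(1+μ) - 2 is negative because μ < 1, so the right endpoint is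
non-positive and the interval is empty. -/
theorem two_le_of_mem_Ico (hμ0 : 0 < μ) (hμ1 : μ < 1) {β : ℝ}
    (h : β ∈ Ico (1 : ℝ) (d * (1 + μ) / (d * (1 + μ) - 2))) : 2 ≤ d := by
  by_contra! hd
  have h1 : 1 < (d : ℝ) * (1 + μ) / (d * (1 + μ) - 2) := h.1.trans_lt h.2
  have hneg : (d : ℝ) * (1 + μ) - 2 ≤ 0 := by
    interval_cases d <;> norm_num; linarith
  have := div_nonpos_of_nonneg_of_nonpos (show 0 ≤ (d : ℝ) * (1 + μ) by positivity) hneg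
  linarith

namespace IsSolution

theorem lInfLp_gradient_ne_top (hT : 0 < T) (sol : IsSolution T H g uT m0 η ε u m) :
    LInfLp T ∞ (fun t => gradient (u t)) ≠ ⊤ := by
  have hu : SlabSmooth T u := sol.u_smooth
  obtain ⟨B, -, hB⟩ := SlabContinuous.exists_bound (f := fun t x => ‖gradient (u t) x‖)
    (ContinuousOn.norm (hu.gradient hT).slabContinuous) fun t ht =>
      (isPeriodic_gradient (sol.u_periodic t ht)).comp _
  refine ne_top_of_le_ne_top (ENNReal.ofReal_ne_top (r := B)) (essSup_le_of_ae_le _ ?_)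
  filter_upwards [ae_restrict_mem measurableSet_Ioo] with t ht
  refine (eLpNorm_le_of_ae_bound (C := B) (Eventually.of_forall fun x => ?_)).trans ?_
  · exact (le_abs_self _).trans (hB t (Ioo_subset_Icc_self ht) x)
  · simp

/-- Unfolds the iterated essential supremum into an almost-everywhere bound, which suffices because
the drift is only used under integrals. Finiteness of the norm makes the passage to a real number
lossless. -/
theorem ae_norm_gradient_le (hT : 0 < T) (sol : IsSolution T H g uT m0 η ε u m) :
    ∀ᵐ s ∂(volume.restrict (Ioc 0 T)), ∀ᵐ x ∂(torusMeasure d),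
      ‖gradient (u s) x‖ ≤ (LInfLp T ∞ fun t => gradient (u t)).toReal := by
  rw [← Measure.restrict_congr_set Ioo_ae_eq_Ioc]
  have h : ∀ᵐ s ∂(volume.restrict (Ioo 0 T)), eLpNorm (gradient (u s)) ∞ (torusMeasure d) ≤
      LInfLp T ∞ fun t => gradient (u t) := ae_le_essSup
  filter_upwards [h] with s hs
  rw [eLpNorm_exponent_top] at hs
  filter_upwards [ae_le_eLpNormEssSup (f := gradient (u s)) (μ := torusMeasure d)] with x hx
  rw [← toReal_enorm]
  exact ENNReal.toReal_mono (lInfLp_gradient_ne_top hT sol) (hx.trans hs)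

variable (S : Standing T α H g uT m0 η)

include S

theorem eLpNorm_gEps_le (hε : 0 ≤ ε) (sol : IsSolution T H g uT m0 η ε u m) {p B : ℝ}
    (hp : 1 ≤ p) (hpα : 1 ≤ α * p) {t : ℝ} (ht : t ∈ Icc 0 T)
    (h : ∫ x, m t x ^ (α * p) ∂(torusMeasure d) ≤ B) :
    eLpNorm (gEps η g ε (m t)) (ENNReal.ofReal p) (torusMeasure d) ≤
      ENNReal.ofReal (B ^ (1 / p)) := by
  have hp0 : 0 < p := by linarith
  have hm : SlabSmooth T m := sol.m_smooth
  have hmt := (hm.slice ht).continuous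
  obtain ⟨κ, hκ, hle⟩ := exists_m_lower_bound S sol
  have hg0 := gEps_nonneg S.mollifier hε S.power hmt hκ (hle t ht)
  rw [MemLp.eLpNorm_eq_integral_rpow_norm (by simpa using hp0) ENNReal.ofReal_ne_top
    (memLp_torus (continuous_gEps S.mollifier hε S.power hmt hκ (hle t ht)) _),
    ENNReal.toReal_ofReal hp0.le, one_div]
  refine ENNReal.ofReal_le_ofReal (Real.rpow_le_rpow ?_ ?_ (by positivity))
  · exact integral_torus_nonneg fun x => by positivity
  · simp only [Real.norm_of_nonneg (hg0 _)]
    exact (integral_gEps_rpow_le S.mollifier hε S.power hmt (sol.m_periodic t ht) hκ (hle t ht)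
      hp hpα).trans h

/-- The energy method needs β > 1 for its dissipation; at β = 1 conservation of mass takes its
place. -/
theorem exists_integral_rpow_initial_le (hd : 2 ≤ d) (hA5 : SpaceDerivativeBounds H) (hμ : 0 < μ)
    (hA9 : SecondDerivativeBounds H μ) {β : ℝ}
    (hβ : β ∈ Ico (1 : ℝ) (d * (1 + μ) / (d * (1 + μ) - 2))) :
    ∃ C : ℝ, 0 ≤ C ∧ ∀ ε, 0 ≤ ε → ∀ u m : ℝ → E d → ℝ, IsSolution T H g uT m0 η ε u m →
      ∀ t ∈ Icc 0 T, ∫ x, m t x ^ β ∂(torusMeasure d) ≤ C := by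
  rcases hβ.1.eq_or_lt with rfl | h1
  · refine ⟨1, zero_le_one, fun ε _ u m sol t ht => ?_⟩
    simp only [Real.rpow_one]
    exact (integral_m S sol ht).le
  · have hd' : (2 : ℝ) ≤ d := by exact_mod_cast hd
    have hpos : 0 < (d : ℝ) * (1 + μ) - 2 := by nlinarith
    exact exists_integral_rpow_le S hd hA5 hμ hA9 h1 ((lt_div_iff₀ hpos).1 hβ.2).le

/-- Interpolated integrability of the density in terms of the gradient bound. -/
theorem exists_integral_rpow_betaExp_le (hA5 : SpaceDerivativeBounds H)
    (hA7 : SuperquadraticGrowth H μ) (hA8 : DpBound H μ) (hA9 : SecondDerivativeBounds H μ)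
    {θ υ β₀ : ℝ} (hθ : 1 < θ) (hυ : υ ∈ Icc (0 : ℝ) 1)
    (hβ₀ : β₀ ∈ Ico (1 : ℝ) (d * (1 + μ) / (d * (1 + μ) - 2))) :
    ∃ C : ℝ, 0 ≤ C ∧ ∀ ε, 0 ≤ ε → ∀ u m : ℝ → E d → ℝ, IsSolution T H g uT m0 η ε u m →
      ∀ t ∈ Icc 0 T, ∫ x, m t x ^ betaExp θ υ β₀ ∂(torusMeasure d) ≤
        C * (1 + (LInfLp T ∞ fun t => gradient (u t)).toReal ^ (2 + 2 * μ)) ^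
          (rExp d θ * (υ * betaExp θ υ β₀ / (θ * β₀))) := by
  have hT := S.T_pos
  have hd := two_le_of_mem_Ico hA7.pos hA7.lt_one hβ₀
  obtain ⟨C₀, hC₀, h₀⟩ := exists_integral_rpow_initial_le S hd hA5 hA7.pos hA9 hβ₀
  obtain ⟨C₁, hC₁, h₁⟩ := exists_integral_rpow_le_drift S hd hθ hβ₀.1 C₀ hC₀
  obtain ⟨C₂, hC₂, h₂⟩ := exists_norm_DpH_sq_le S.ham hA7 hA8
  have hβ0 : 0 < β₀ := by linarith [hβ₀.1]
  have hθ0 : 0 < θ := by linarith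
  have hden : 1 ≤ θ + υ - θ * υ := by nlinarith [hυ.2]
  have hdenθ : υ ≤ θ + υ - θ * υ := by nlinarith [hυ.2]
  set b := betaExp θ υ β₀ with hb
  have hbe : b = θ * β₀ / (θ + υ - θ * υ) := rfl
  have hb0 : 0 < b := by rw [hbe]; positivity
  -- This equals υ/(θ+υ-θυ), the weight with (1-τ)β₀ + τθβ₀ = b. Keeping b in the formula lets it
  -- cancel against p = b/α in the final exponent.
  set τ := υ * b / (θ * β₀) with hτ
  have hτe : τ = υ / (θ + υ - θ * υ) := by rw [hτ, hbe]; field_simp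
  have hτ0 : 0 ≤ τ := by rw [hτe]; exact div_nonneg hυ.1 (by linarith)
  have hτ1 : τ ≤ 1 := by rw [hτe]; exact (div_le_one (by linarith)).2 hdenθ
  have hbτ : (1 - τ) * β₀ + τ * (θ * β₀) = b := by
    have hne : θ + υ - θ * υ ≠ 0 := by linarith
    have e1 : τ * (θ + υ - θ * υ) = υ := by rw [hτe, div_mul_cancel₀ _ hne]
    have e2 : b * (θ + υ - θ * υ) = θ * β₀ := by rw [hbe, div_mul_cancel₀ _ hne]
    refine mul_right_cancel₀ hne ?_
    linear_combination (θ * β₀ - β₀) * e1 - e2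
  refine ⟨C₀ ^ (1 - τ) * (C₁ * C₂ ^ rExp d θ) ^ τ, by positivity,
    fun ε hε u m sol t ht => ?_⟩
  set N := (LInfLp T ∞ fun t => gradient (u t)).toReal with hN
  have hN0 : 0 ≤ N := ENNReal.toReal_nonneg
  have hY : 0 ≤ N ^ (2 + 2 * μ) := Real.rpow_nonneg hN0 _
  have hm : SlabSmooth T m := sol.m_smooth
  have hdrift : ∀ᵐ s ∂(volume.restrict (Ioc 0 T)), ∀ᵐ x ∂(torusMeasure d),
      ‖DpH H x (gradient (u s) x)‖ ^ 2 ≤ C₂ * (1 + N ^ (2 + 2 * μ)) := by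
    filter_upwards [ae_norm_gradient_le hT sol] with s hs
    filter_upwards [hs] with x hx
    exact h₂ N hN0 x _ hx
  have hθβ := h₁ ε u m sol (h₀ ε hε u m sol) (C₂ * (1 + N ^ (2 + 2 * μ))) (by nlinarith) hdrift t ht
  have hint := integral_rpow_interpolate (hm.slice ht).continuous (m_pos S sol ht) β₀ (θ * β₀)
    hτ0 hτ1
  rw [hbτ] at hint
  refine hint.trans ?_
  have nn : ∀ q : ℝ, 0 ≤ ∫ x, m t x ^ q ∂(torusMeasure d) := fun q =>
    integral_torus_nonneg fun x => Real.rpow_nonneg (m_pos S sol ht x).le _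
  refine (mul_le_mul (Real.rpow_le_rpow (nn _) (h₀ ε hε u m sol t ht) (by linarith))
    (Real.rpow_le_rpow (nn _) hθβ hτ0) (Real.rpow_nonneg (nn _) _)
    (Real.rpow_nonneg hC₀ _)).trans (le_of_eq ?_)
  have hC₂0 : 0 ≤ C₂ := by linarith
  rw [Real.mul_rpow (x := C₂) hC₂0 (by linarith), ← mul_assoc C₁,
    Real.mul_rpow (by positivity) (by positivity), ← Real.rpow_mul (by positivity), mul_assoc]

end IsSolution

end

end MFG

/-! ### Proof of the estimate -/

theorem mainTheorem5 (d : ℕ) (T : ℝ) (hT : 0 < T) (α μ : ℝ)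
    (H : MFG.E d → MFG.E d → ℝ) (g : ℝ → ℝ) (uT m0 η : MFG.E d → ℝ)
    (hη : MFG.IsMollifier η)
    (hA1 : MFG.HamiltonianBasic H) (hA2 : MFG.DataBasic g uT m0)
    (hA3 : MFG.LagrangianBound H) (hA4 : MFG.PowerNonlinearity g α)
    (hA5 : MFG.SpaceDerivativeBounds H) (hA6 : MFG.InitialLowerBound m0)
    (hA7 : MFG.SuperquadraticGrowth H μ) (hA8 : MFG.DpBound H μ)
    (hA9 : MFG.SecondDerivativeBounds H μ)
    (θ υ β₀ r p : ℝ) (hθ : 1 < θ) (hυ : υ ∈ Set.Icc (0 : ℝ) 1)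
    (hβ₀ : β₀ ∈ Set.Ico (1 : ℝ) (d * (1 + μ) / (d * (1 + μ) - 2)))
    (hr : r = MFG.rExp d θ) (hp : p = MFG.betaExp θ υ β₀ / α) (hp1 : 1 < p) :
    ∃ C : ℝ≥0, ∀ ε : ℝ, 0 ≤ ε → ∀ u m : ℝ → MFG.E d → ℝ,
      MFG.IsSolution T H g uT m0 η ε u m →
        MFG.LInfLp T (ENNReal.ofReal p) (fun t => MFG.gEps η g ε (m t)) ≤
          C + C * MFG.LInfLp T ∞ (fun t => gradient (u t))
            ^ ((2 + 2 * μ) * r * υ * α / (θ * β₀)) := by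
  have S : MFG.Standing T α H g uT m0 η := ⟨hT, hη, hA1, hA2, hA3, hA4, hA6⟩
  obtain ⟨C, hC, hbound⟩ := MFG.IsSolution.exists_integral_rpow_betaExp_le S hA5 hA7 hA8 hA9 hθ hυ
    hβ₀
  have hα := hA4.pos
  have hβ1 := hβ₀.1
  have hβ0 : 0 < β₀ := by linarith
  have hθ0 : 0 < θ := by linarith
  have hυ0 := hυ.1
  have hμ := hA7.pos
  have hp0 : 0 < p := by linarith
  have hden1 : θ + υ - θ * υ ≤ θ := by nlinarith
  have hden0 : 0 < θ + υ - θ * υ := by nlinarith [hυ.2]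
  have hαp : α * p = MFG.betaExp θ υ β₀ := by rw [hp]; field_simp
  -- The inner mollification is removed by Jensen's inequality at exponent αp, which must be at
  -- least 1.
  have hb1 : 1 ≤ MFG.betaExp θ υ β₀ := by
    rw [MFG.betaExp, le_div_iff₀ hden0]
    nlinarith
  have hr0 : 0 ≤ r := by
    rw [hr, MFG.rExp]
    have := mul_nonneg (Nat.cast_nonneg (α := ℝ) d) (sub_pos.2 hθ).le
    linarith
  set s : ℝ := r * υ * α / (θ * β₀) with hs
  have hs0 : 0 ≤ s := by positivity
  have he : (2 + 2 * μ) * r * υ * α / (θ * β₀) = (2 + 2 * μ) * s := by rw [hs]; ring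
  have hexp : r * (υ * MFG.betaExp θ υ β₀ / (θ * β₀)) * (1 / p) = s := by
    rw [hs, ← hαp]; field_simp
  refine ⟨Real.toNNReal (C ^ (1 / p) * 2 ^ s), fun ε hε u m sol => ?_⟩
  set G := MFG.LInfLp T ∞ (fun t => gradient (u t)) with hG
  have hGtop : G ≠ ⊤ := MFG.IsSolution.lInfLp_gradient_ne_top hT sol
  set N := G.toReal with hN
  have hN0 : 0 ≤ N := ENNReal.toReal_nonneg
  have hY : 0 ≤ N ^ (2 + 2 * μ) := Real.rpow_nonneg hN0 _
  -- Comparing both summands with the larger one works for every s ≥ 0, whether or not s ≥ 1; it is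
  -- the source of 2^s in the constant.
  have hYs : (1 + N ^ (2 + 2 * μ)) ^ s ≤ 2 ^ s * (1 + N ^ ((2 + 2 * μ) * s)) := by
    rw [Real.rpow_mul hN0]
    rcases le_total (N ^ (2 + 2 * μ)) 1 with h | h
    · refine (Real.rpow_le_rpow (by linarith) (by linarith : 1 + N ^ (2 + 2 * μ) ≤ 2) hs0).trans ?_
      exact le_mul_of_one_le_right (by positivity) (by linarith [Real.rpow_nonneg hY s])
    · refine (Real.rpow_le_rpow (by linarith)
        (by linarith : 1 + N ^ (2 + 2 * μ) ≤ 2 * N ^ (2 + 2 * μ)) hs0).trans ?_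
      rw [Real.mul_rpow (by norm_num) hY]
      exact mul_le_mul_of_nonneg_left (by linarith) (by positivity)
  have hGN : G = ENNReal.ofReal N := (ENNReal.ofReal_toReal hGtop).symm
  have hA0 : 0 ≤ C ^ (1 / p) * 2 ^ s := by positivity
  have hrhs : (Real.toNNReal (C ^ (1 / p) * 2 ^ s) : ℝ≥0∞) +
      (Real.toNNReal (C ^ (1 / p) * 2 ^ s) : ℝ≥0∞) * G ^ ((2 + 2 * μ) * s) =
      ENNReal.ofReal (C ^ (1 / p) * 2 ^ s * (1 + N ^ ((2 + 2 * μ) * s))) := by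
    rw [hGN, ENNReal.ofReal_rpow_of_nonneg hN0 (by positivity), mul_add, mul_one,
      ENNReal.ofReal_add hA0 (by positivity), ENNReal.ofReal_mul (p := C ^ (1 / p) * 2 ^ s) hA0]
    rfl
  rw [he, hrhs]
  refine essSup_le_of_ae_le _ ?_
  filter_upwards [ae_restrict_mem measurableSet_Ioo] with t ht
  have ht' := Ioo_subset_Icc_self ht
  refine (MFG.IsSolution.eLpNorm_gEps_le S hε sol hp1.le (hαp ▸ hb1) ht'
    (hαp ▸ hbound ε hε u m sol t ht')).trans (ENNReal.ofReal_le_ofReal ?_)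
  rw [hαp, ← hr, Real.mul_rpow hC (by positivity), ← Real.rpow_mul (by positivity), hexp, mul_assoc]
  exact mul_le_mul_of_nonneg_left hYs (by positivity)
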